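/- **Setting.** Let $k$ be a field of characteristic $0$. For $n\ge 0$ let $B_n$ be the braid group on $n$ strands with standard generators $\sigma_1,\dots,\sigma_{n-1}$. For $\tau\in S_n$ let $\widetilde\tau\in B_n$ be its Matsumoto lift (write $\tau$ as a minimal length word in the adjacent transpositions and replace each $(i\;i+1)$ by $\sigma_i$), and let $$\mathbf S_n=\sum_{\tau\in S_n}\widetilde\tau\in k[B_n]$$ be the quantum symmetrizer. The profinite braided associative operad $\widehat{\mathrm{BrAss}}$ has as $\widehat{\mathrm{BrAss}}(n)$ the pro-vector space $(k[Q])_Q$, where $Q$ runs over the finite quotients of $B_n$; $B_n$ acts by right multiplication, and the partial compositions $\circ_i:\widehat{\mathrm{BrAss}}(m)\otimes\widehat{\mathrm{BrAss}}(n)\to\widehat{\mathrm{BrAss}}(m+n-1)$, $1\le i\le m$, are induced by the cabling of braids. A *left ideal* is a family of subobjects $\mathcal I(n)\le\widehat{\mathrm{BrAss}}(n)$ which are stable under $B_n$ and satisfy $\widehat{\mathrm{BrAss}}(m)\circ_i\mathcal I(n)\subseteq\mathcal I(m+n-1)$ for all $m,n,i$. It is *strict* if all transition maps of the inverse systems $\mathcal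 I(n)$ are epimorphisms. The *Woronowicz ideal* $\mathfrak W$ and the *Nichols module* $\mathrm{Nic}$ are $$\mathfrak W(n)=\ker\bigl(\mathbf S_n\cdot:\widehat{\mathrm{BrAss}}(n)\to\widehat{\mathrm{BrAss}}(n)\bigr),\qquad \mathrm{Nic}(n)=\widehat{\mathrm{BrAss}}(n)/\mathfrak W(n),$$ kernels and quotients being formed levelwise in $Q$. Let $\mathbf C$ be a $k$-linear abelian braided monoidal category with bilinear tensor product, which has all coproducts indexed by sets of the size of the universe of $k$ and all countable coproducts, such that $\otimes$ preserves countable coproducts. An object $V$ of $\mathbf C$ is *finitely braided* if for every $n$ the action of $B_n$ on $V^{\otimes n}$ factors through a finite quotient of $B_n$. For a braided sequence $\mathcal S$ of pro-vector spaces, $\mathcal S(n)=(\mathcal S(n)_j)_{j\in J_n}$, with right actions of $B_n$, the *Artin functor* assigns to $V$ the pro-object $\mathcal S[V]=\bigoplus_n\mathcal S(n)\otimes_{B_n}V^{\otimes n}$ of $\mathbf C$, that is, the system $\bigoplus_n\mathcal S(n)_{j_n}\otimes_{B_n}V^{\otimes n}$ indexed by $(j_n)_n\in\prod_nJ_n$.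 An algebra structure on $\mathrm{Nic}[V]$ is called *operadic* if its unit is the canonical map $\mathbf 1=V^{\otimes 0}\to\mathrm{Nic}[V]$, and its product satisfies $(g\otimes v)(h\otimes w)=(g|h)\otimes(v\otimes w)$ for $g\in B_p$, $h\in B_q$, $v$ in $V^{\otimes p}$, $w$ in $V^{\otimes q}$, where $g|h\in B_{p+q}$ is the juxtaposition (the composite in the operad of the trivial braid on two strands with $g$ and $h$). Let $T(V)=\bigoplus_nV^{\otimes n}$ be the tensor algebra and $T^{co}(V)$ the same object with the quantum shuffle product, i.e. the product $V^{\otimes p}\otimes V^{\otimes q}\to V^{\otimes(p+q)}$ given by $\sum\widetilde\tau$, the sum over the $(p,q)$-shuffles $\tau$. The *Nichols algebra* $\mathfrak B(V)$ is the image of the map $T(V)\to T^{co}(V)$ which is the identity on $V$ and takes concatenation products to quantum shuffle products; its algebra structure is the one for which $T(V)\to\mathfrak B(V)$ and $\mathfrak B(V)\to T^{co}(V)$ preserve units and products. **Proposition.** 1. $\mathfrak W$ is a strict left ideal in $\widehat{\mathrm{BrAss}}$. 2. For all $\mathbf C$ as above and every finitely braided $V\in\mathbf C$, the algebra structure on $\mathfrak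 B(V)$ just described and an operadic algebra structure on $\mathrm{Nic}[V]$ exist, and there is an isomorphism of algebras $$\mathrm{Nic}[V]\cong\mathfrak B(V)$$ in the category of pro-objects of $\mathbf C$, where $\mathfrak B(V)$ is regarded as a constant pro-object. It is compatible with the canonical maps from the tensor powers $V^{\otimes n}$ to both sides. -/

import Mathlib

open CategoryTheory MonoidalCategory Limits

universe t w v u

noncomputable section

namespace BraidedNichols

/-! ### Braid groups -/

/-- The braid relations `σᵢ σᵢ₊₁ σᵢ = σᵢ₊₁ σᵢ σᵢ₊₁` and `σᵢ σⱼ = σⱼ σᵢ` for `|i - j| > 1`. -/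
def braidRels (n : ℕ) : Set (FreeGroup (Fin (n - 1))) :=
  {r | (∃ i j : Fin (n - 1), (i : ℕ) + 1 = j ∧
          r = FreeGroup.of i * FreeGroup.of j * FreeGroup.of i *
            (FreeGroup.of j * FreeGroup.of i * FreeGroup.of j)⁻¹) ∨
       (∃ i j : Fin (n - 1), (i : ℕ) + 1 < j ∧
          r = FreeGroup.of i * FreeGroup.of j * (FreeGroup.of j * FreeGroup.of i)⁻¹)}

/-- The braid group on `n` strands (trivial for `n = 0, 1`). Strands are numbered from `0`. -/
abbrev Braid (n : ℕ) : Type := PresentedGroup (braidRels n)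

/-- The generator `σᵢ` crossing the strands `i` and `i + 1`, for `i + 1 < n` (and `1` otherwise). -/
def braidGen (n i : ℕ) : Braid n :=
  if h : i < n - 1 then PresentedGroup.of ⟨i, h⟩ else 1

/-- A sequence of elements of a group satisfying the relations of the braid group on `n` strands. -/
structure IsBraiding {G : Type*} [Monoid G] (n : ℕ) (s : ℕ → G) : Prop where
  braid : ∀ i, i + 2 < n → s i * s (i + 1) * s i = s (i + 1) * s i * s (i + 1)
  comm : ∀ i j, i + 1 < j → j + 1 < n → s i * s j = s j * s i

/-- The homomorphism out of the braid group determined by the images of the generators. -/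
def braidLift {G : Type*} [Group G] {n : ℕ} (s : ℕ → G) (hs : IsBraiding n s) : Braid n →* G :=
  PresentedGroup.toGroup (f := fun i : Fin (n - 1) => s i) (by
    rintro r (⟨i, j, hij, rfl⟩ | ⟨i, j, hij, rfl⟩)
    · have hj := j.2
      have := hs.braid i (by omega)
      simp only [map_mul, map_inv, FreeGroup.lift_apply_of, ← hij]
      rw [mul_inv_eq_one]; exact this
    · have hj := j.2
      have := hs.comm i j hij (by omega)
      simp only [map_mul, map_inv, FreeGroup.lift_apply_of]
      rw [mul_inv_eq_one]; exact this)

theorem braidLift_gen {G : Type*} [Group G] {n : ℕ} (s : ℕ → G) (hs : IsBraiding n s) (i : ℕ)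
    (hi : i + 1 < n) : braidLift s hs (braidGen n i) = s i := by
  have h : i < n - 1 := by omega
  simp [braidGen, h, braidLift]

theorem isBraiding_gen (n : ℕ) : IsBraiding n (braidGen n) where
  braid i hi := by
    have h1 : i < n - 1 := by omega
    have h2 : i + 1 < n - 1 := by omega
    simp only [braidGen, h1, h2, dif_pos]
    exact PresentedGroup.mk_eq_mk_of_mul_inv_mem (x := _ * _ * _) (y := _ * _ * _)
      (Or.inl ⟨⟨i, h1⟩, ⟨i + 1, h2⟩, rfl, rfl⟩)
  comm i j hij hj := by
    have h1 : i < n - 1 := by omega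
    have h2 : j < n - 1 := by omega
    simp only [braidGen, h1, h2, dif_pos]
    exact PresentedGroup.mk_eq_mk_of_mul_inv_mem (x := _ * _) (y := _ * _)
      (Or.inr ⟨⟨i, h1⟩, ⟨j, h2⟩, hij, rfl⟩)

/-- Placing a braid on `n` strands onto the strands `a, …, a + n - 1` of a braid on `N` strands. -/
def shift {n N : ℕ} (a : ℕ) (h : a + n ≤ N) : Braid n →* Braid N :=
  braidLift (fun i => braidGen N (a + i))
    { braid := fun i hi => (isBraiding_gen N).braid (a + i) (by omega)
      comm := fun i j hij hj => (isBraiding_gen N).comm (a + i) (a + j) (by omega) (by omega) }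

/-- Juxtaposition of braids. -/
def juxt {p q : ℕ} (g : Braid p) (h : Braid q) : Braid (p + q) :=
  shift p (by omega) h * shift 0 (by omega) g

/-- The adjacent transposition of `i` and `i + 1`, for `i + 1 < n` (and `1` otherwise). -/
def adjSwap (n i : ℕ) : Equiv.Perm (Fin n) :=
  if h : i + 1 < n then Equiv.swap ⟨i, by omega⟩ ⟨i + 1, h⟩ else 1

theorem adjSwap_val {n i : ℕ} (h : i + 1 < n) (x : Fin n) :
    (adjSwap n i x : ℕ) = if (x : ℕ) = i then i + 1 else if (x : ℕ) = i + 1 then i else x := by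
  simp only [adjSwap, h, dif_pos, Equiv.swap_apply_def, Fin.ext_iff]
  split_ifs <;> rfl

theorem adjSwap_inv (n i : ℕ) : (adjSwap n i)⁻¹ = adjSwap n i := by
  unfold adjSwap; split_ifs <;> simp

theorem isBraiding_adjSwap (n : ℕ) : IsBraiding n (adjSwap n) where
  braid i hi := by
    ext x
    have h1 : i + 1 < n := by omega
    simp only [Equiv.Perm.mul_apply, adjSwap_val h1, adjSwap_val hi]
    split_ifs <;> omega
  comm i j hij hj := by
    ext x
    have h1 : i + 1 < n := by omega
    simp only [Equiv.Perm.mul_apply, adjSwap_val h1, adjSwap_val hj]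
    split_ifs <;> omega

/-- The homomorphism from the braid group to the symmetric group. -/
def toPerm (n : ℕ) : Braid n →* Equiv.Perm (Fin n) := braidLift (adjSwap n) (isBraiding_adjSwap n)

/-! ### Cabling -/

section Cable

variable {G : Type*} [Group G]

/-- `s a * s (a+1) * ⋯ * s (a+n-1)`: moving one strand across `n` strands lying to its left. -/
def ascProd (s : ℕ → G) (a : ℕ) : ℕ → G
  | 0 => 1
  | n + 1 => ascProd s a n * s (a + n)

/-- `s (a+n-1) * ⋯ * s (a+1) * s a`: moving one strand across `n` strands lying to its right. -/
def descProd (s : ℕ → G) (a : ℕ) : ℕ → G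
  | 0 => 1
  | n + 1 => s (a + n) * descProd s a n

/-- The effect of the generator `σⱼ` when the strand ending at position `e` is replaced by `n`
parallel strands. -/
def cableGen (s : ℕ → G) (n j e : ℕ) : G :=
  if e < j then s (j + n - 1)
  else if e = j then descProd s j n
  else if e = j + 1 then ascProd s j n
  else s j

variable {s : ℕ → G} {N : ℕ}

theorem IsBraiding.comm_asc (hs : IsBraiding N s) {b a n : ℕ}
    (h : (b + 1 < a ∧ a + n < N ∨ a + n < b ∧ b + 1 < N)) :
    Commute (s b) (ascProd s a n) := by
  induction n with
  | zero => exact Commute.one_right _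
  | succ n ih =>
    refine (ih (by omega)).mul_right ?_
    rcases h with h | h
    · exact hs.comm b (a + n) (by omega) (by omega)
    · exact (hs.comm (a + n) b (by omega) (by omega)).symm

theorem IsBraiding.comm_desc (hs : IsBraiding N s) {b a n : ℕ}
    (h : (b + 1 < a ∧ a + n < N ∨ a + n < b ∧ b + 1 < N)) :
    Commute (s b) (descProd s a n) := by
  induction n with
  | zero => exact Commute.one_right _
  | succ n ih =>
    refine Commute.mul_right ?_ (ih (by omega))
    rcases h with h | h
    · exact hs.comm b (a + n) (by omega) (by omega)
    · exact (hs.comm (a + n) b (by omega) (by omega)).symm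

theorem IsBraiding.cable_one (hs : IsBraiding N s) {a n : ℕ} (h : a + n + 1 < N) :
    descProd s a n * descProd s (a + 1) n * s a =
      s (a + n) * descProd s a n * descProd s (a + 1) n := by
  induction n with
  | zero => simp [descProd]
  | succ n ih =>
    have h1 := ih (by omega)
    have h2 : s (a + n + 1) * descProd s a n = descProd s a n * s (a + n + 1) :=
      hs.comm_desc (b := a + n + 1) (Or.inr ⟨by omega, by omega⟩)
    have h3 := hs.braid (a + n) (by omega)
    have e : a + 1 + n = a + n + 1 := by omega
    have e' : a + (n + 1) = a + n + 1 := by omega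
    simp only [descProd, e, e']
    calc s (a + n) * descProd s a n * (s (a + n + 1) * descProd s (a + 1) n) * s a
        = s (a + n) * (descProd s a n * s (a + n + 1)) * descProd s (a + 1) n * s a := by group
      _ = s (a + n) * s (a + n + 1) * (descProd s a n * descProd s (a + 1) n * s a) := by
          rw [← h2]; group
      _ = (s (a + n) * s (a + n + 1) * s (a + n)) * descProd s a n * descProd s (a + 1) n := by
          rw [h1]; group
      _ = s (a + n + 1) * s (a + n) * (s (a + n + 1) * descProd s a n)
            * descProd s (a + 1) n := by rw [h3]; group
      _ = _ := by rw [h2]; group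

theorem IsBraiding.cable_two (hs : IsBraiding N s) {a n : ℕ} (h : a + n + 1 < N) :
    ascProd s a n * s (a + n) * descProd s a n =
      descProd s (a + 1) n * s a * ascProd s (a + 1) n := by
  induction n with
  | zero => simp [descProd, ascProd]
  | succ n ih =>
    have h1 := ih (by omega)
    have h2 : s (a + n + 1) * descProd s a n = descProd s a n * s (a + n + 1) :=
      hs.comm_desc (b := a + n + 1) (Or.inr ⟨by omega, by omega⟩)
    have h2' : s (a + n + 1) * ascProd s a n = ascProd s a n * s (a + n + 1) :=
      hs.comm_asc (b := a + n + 1) (Or.inr ⟨by omega, by omega⟩)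
    have h3 := hs.braid (a + n) (by omega)
    have e : a + 1 + n = a + n + 1 := by omega
    have e' : a + (n + 1) = a + n + 1 := by omega
    simp only [descProd, ascProd, e, e']
    calc ascProd s a n * s (a + n) * s (a + n + 1) * (s (a + n) * descProd s a n)
        = ascProd s a n * (s (a + n) * s (a + n + 1) * s (a + n)) * descProd s a n := by group
      _ = (ascProd s a n * s (a + n + 1)) * s (a + n) * (s (a + n + 1) * descProd s a n) := by
          rw [h3]; group
      _ = s (a + n + 1) * (ascProd s a n * s (a + n) * descProd s a n) * s (a + n + 1) := by
          rw [h2, ← h2']; group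
      _ = _ := by rw [h1]; group

theorem IsBraiding.cable_three (hs : IsBraiding N s) {a n : ℕ} (h : a + n + 1 < N) :
    s a * ascProd s (a + 1) n * ascProd s a n =
      ascProd s (a + 1) n * ascProd s a n * s (a + n) := by
  induction n with
  | zero => simp [ascProd]
  | succ n ih =>
    have h1 := ih (by omega)
    have h2 : s (a + n + 1) * ascProd s a n = ascProd s a n * s (a + n + 1) :=
      hs.comm_asc (b := a + n + 1) (Or.inr ⟨by omega, by omega⟩)
    have h3 := hs.braid (a + n) (by omega)
    have e : a + 1 + n = a + n + 1 := by omega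
    have e' : a + (n + 1) = a + n + 1 := by omega
    simp only [ascProd, e, e']
    calc s a * (ascProd s (a + 1) n * s (a + n + 1)) * (ascProd s a n * s (a + n))
        = s a * ascProd s (a + 1) n * (s (a + n + 1) * ascProd s a n) * s (a + n) := by group
      _ = (s a * ascProd s (a + 1) n * ascProd s a n) * s (a + n + 1) * s (a + n) := by
          rw [h2]; group
      _ = ascProd s (a + 1) n * ascProd s a n * (s (a + n) * s (a + n + 1) * s (a + n)) := by
          rw [h1]; group
      _ = ascProd s (a + 1) n * (ascProd s a n * s (a + n + 1)) * s (a + n) * s (a + n + 1) := by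
          rw [h3]; group
      _ = _ := by rw [← h2]; group

/-- The pair (cabled braids, permutation) attached to a generator; the function component is
indexed by the end position of the cabled strand. -/
def wreathGen (s : ℕ → G) (m n j : ℕ) :
    (Fin m → G) ⋊[mulAutArrow] Equiv.Perm (Fin m) :=
  ⟨fun e => cableGen s n j e, adjSwap m j⟩

theorem wreath_mul_left {m : ℕ} (x y : (Fin m → G) ⋊[mulAutArrow] Equiv.Perm (Fin m)) (e : Fin m) :
    (x * y).left e = x.left e * y.left (x.right⁻¹ e) := rfl

theorem cableGen_lt {n j e : ℕ} (h : e < j) : cableGen s n j e = s (j + n - 1) := by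
  simp [cableGen, h]

theorem cableGen_eq {n j e : ℕ} (h : e = j) : cableGen s n j e = descProd s j n := by
  simp [cableGen, h]

theorem cableGen_succ {n j e : ℕ} (h : e = j + 1) : cableGen s n j e = ascProd s j n := by
  simp [cableGen, h]

theorem cableGen_gt {n j e : ℕ} (h : j + 1 < e) : cableGen s n j e = s j := by
  have h1 : ¬ e < j := by omega
  have h2 : ¬ e = j := by omega
  have h3 : ¬ e = j + 1 := by omega
  simp [cableGen, h1, h2, h3]

theorem IsBraiding.wreath {m n : ℕ} (hs : IsBraiding N s) (h : m + n = N + 1) :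
    IsBraiding m (wreathGen s m n) where
  braid i hi := by
    have hi1 : i + 1 < m := by omega
    refine SemidirectProduct.ext ?_ ((isBraiding_adjSwap m).braid i hi)
    funext e
    have he := e.2
    simp only [wreath_mul_left, SemidirectProduct.mul_right, wreathGen, mul_inv_rev, adjSwap_inv,
      Equiv.Perm.mul_apply, adjSwap_val hi1, adjSwap_val hi]
    generalize (e : ℕ) = x at he
    have hx : x < i ∨ x = i ∨ x = i + 1 ∨ x = i + 2 ∨ i + 2 < x := by omega
    rcases hx with hx | rfl | rfl | rfl | hx
    · simp (disch := omega) only [if_true, if_neg, cableGen_lt]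
      have := hs.braid (i + n - 1) (by omega)
      rwa [show i + n - 1 + 1 = i + 1 + n - 1 by omega] at this
    · simp (disch := omega) only [if_true, if_pos, if_neg, cableGen_lt, cableGen_eq, cableGen_gt]
      rw [show x + 1 + n - 1 = x + n by omega]
      exact hs.cable_one (by omega)
    · simp (disch := omega) only [if_true, if_pos, if_neg, cableGen_lt, cableGen_eq, cableGen_gt,
        cableGen_succ]
      rw [show i + 1 + n - 1 = i + n by omega]
      exact hs.cable_two (by omega)
    · simp (disch := omega) only [if_true, if_pos, if_neg, cableGen_lt, cableGen_gt, cableGen_succ]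
      rw [show i + 1 + n - 1 = i + n by omega]
      exact hs.cable_three (by omega)
    · simp (disch := omega) only [if_true, if_neg, cableGen_gt]
      exact hs.braid i (by omega)
  comm i j hij hj := by
    have hi1 : i + 1 < m := by omega
    refine SemidirectProduct.ext ?_ ((isBraiding_adjSwap m).comm i j hij hj)
    funext e
    have he := e.2
    simp only [wreath_mul_left, wreathGen, adjSwap_inv, adjSwap_val hi1, adjSwap_val hj]
    generalize (e : ℕ) = x at he
    have hx : x < i ∨ x = i ∨ x = i + 1 ∨ (i + 1 < x ∧ x < j) ∨ x = j ∨ x = j + 1 ∨ j + 1 < x := by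
      omega
    rcases hx with hx | rfl | rfl | hx | rfl | rfl | hx
    · simp (disch := omega) only [if_true, if_neg, cableGen_lt]
      exact hs.comm _ _ (by omega) (by omega)
    · simp (disch := omega) only [if_true, if_pos, if_neg, cableGen_lt, cableGen_eq]
      exact (hs.comm_desc (Or.inr ⟨by omega, by omega⟩)).symm
    · simp (disch := omega) only [if_true, if_pos, if_neg, cableGen_lt, cableGen_succ]
      exact (hs.comm_asc (Or.inr ⟨by omega, by omega⟩)).symm
    · simp (disch := omega) only [if_true, if_neg, cableGen_lt, cableGen_gt]
      exact hs.comm _ _ (by omega) (by omega)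
    · simp (disch := omega) only [if_true, if_pos, if_neg, cableGen_eq, cableGen_gt]
      exact hs.comm_desc (Or.inl ⟨by omega, by omega⟩)
    · simp (disch := omega) only [if_true, if_pos, if_neg, cableGen_succ, cableGen_gt]
      exact hs.comm_asc (Or.inl ⟨by omega, by omega⟩)
    · simp (disch := omega) only [if_true, if_neg, cableGen_gt]
      exact hs.comm _ _ (by omega) (by omega)

end Cable

/-- A braid together with all its cablings, as an element of a wreath product. -/
def wreath {m n N : ℕ} (h : m + n = N + 1) :
    Braid m →* (Fin m → Braid N) ⋊[mulAutArrow] Equiv.Perm (Fin m) :=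
  braidLift (wreathGen (braidGen N) m n) ((isBraiding_gen N).wreath h)

theorem wreath_right {m n N : ℕ} (h : m + n = N + 1) (γ : Braid m) :
    (wreath h γ).right = toPerm m γ := by
  have : SemidirectProduct.rightHom.comp (wreath h) = toPerm m := by
    refine PresentedGroup.ext fun i => ?_
    simp [wreath, toPerm, braidLift, wreathGen]
  exact DFunLike.congr_fun this γ

/-- The braid obtained from `γ` by replacing the strand starting at `i` by `n` parallel strands. -/
def cable {m n N : ℕ} (h : m + n = N + 1) (i : Fin m) (γ : Braid m) : Braid N :=
  (wreath h γ).left (toPerm m γ i)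

theorem cable_mul {m n N : ℕ} (h : m + n = N + 1) (i : Fin m) (γ δ : Braid m) :
    cable h i (γ * δ) = cable h (toPerm m δ i) γ * cable h i δ := by
  unfold cable
  rw [map_mul, wreath_mul_left, wreath_right, map_mul]
  simp [Equiv.Perm.mul_apply]

/-- The cabling `γ ∘ᵢ ρ` of braids: `ρ` is inserted in a tube around the strand of `γ` starting at
position `i`. -/
def cabling {m n N : ℕ} (h : m + n = N + 1) (i : Fin m) (γ : Braid m) (ρ : Braid n) : Braid N :=
  cable h i γ * shift i (by omega) ρ

theorem cable_one' {m n N : ℕ} (h : m + n = N + 1) (i : Fin m) : cable h i 1 = 1 := by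
  have := cable_mul h i 1 1
  simpa using this

theorem cable_gen {m n N : ℕ} (h : m + n = N + 1) (i : Fin m) (j : ℕ) (hj : j + 1 < m) :
    cable h i (braidGen m j) = cableGen (braidGen N) n j (adjSwap m j i) := by
  unfold cable wreath toPerm
  rw [braidLift_gen _ _ _ hj, braidLift_gen _ _ _ hj]
  rfl

theorem cable_shift_one {p q : ℕ} (h : q + 1 + p = p + q + 1) (x : Braid q) :
    toPerm (q + 1) (shift (N := q + 1) 1 (by omega) x) 0 = 0 ∧
      cable h 0 (shift (N := q + 1) 1 (by omega) x) = shift p le_rfl x := by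
  have hx : x ∈ Subgroup.closure (Set.range (PresentedGroup.of (rels := braidRels q))) := by
    rw [PresentedGroup.closure_range_of]; trivial
  induction hx using Subgroup.closure_induction with
  | mem x hx =>
    obtain ⟨j, rfl⟩ := hx
    have hj := j.2
    have e : PresentedGroup.of j = braidGen q j := by simp [braidGen]
    have e0 : adjSwap (q + 1) (1 + j) 0 = 0 := by
      ext; rw [adjSwap_val (by omega)]; simp; omega
    rw [e, shift, shift, braidLift_gen _ _ _ (by omega), braidLift_gen _ _ _ (by omega), toPerm,
      braidLift_gen _ _ _ (by omega), cable_gen _ _ _ (by omega), e0]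
    refine ⟨rfl, ?_⟩
    rw [cableGen_lt (by simp)]
    congr 1
    omega
  | one => simp [cable_one']
  | mul x y _ _ hx hy =>
    rw [map_mul, map_mul, map_mul, cable_mul, hy.1, hx.2, hy.2, Equiv.Perm.mul_apply, hy.1]
    exact ⟨hx.1, rfl⟩
  | inv x _ hx =>
    have h1 : toPerm (q + 1) (shift (N := q + 1) 1 (by omega) x⁻¹) 0 = 0 := by
      rw [map_inv, map_inv, Equiv.Perm.inv_eq_iff_eq]; exact hx.1.symm
    refine ⟨h1, ?_⟩
    have h2 := cable_mul h 0 (shift (N := q + 1) 1 (by omega) x) (shift (N := q + 1) 1 (by omega) x⁻¹)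
    rw [h1, hx.2, ← map_mul, mul_inv_cancel, map_one, cable_one'] at h2
    rw [map_inv (shift p le_rfl) x, eq_inv_of_mul_eq_one_right h2.symm]

/-- Juxtaposition is the operadic composite of the trivial braid on two strands with two braids. -/
theorem cabling_one_two {p q : ℕ} (g : Braid p) (h : Braid q) :
    cabling (N := p + q) (show q + 1 + p = p + q + 1 by omega) 0
      (cabling (N := q + 1) (show 2 + q = q + 1 + 1 by omega) 1 (1 : Braid 2) h) g =
      juxt g h := by
  have h1 := cable_shift_one (p := p) (show q + 1 + p = p + q + 1 by omega) h
  unfold cabling juxt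
  rw [cable_one', one_mul]
  exact congrArg (· * _) h1.2

/-- The subgroup of pure braids all of whose cablings lie in `R`. -/
def cableKer {m n N : ℕ} (h : m + n = N + 1) (R : FiniteIndexNormalSubgroup (Braid N)) :
    FiniteIndexNormalSubgroup (Braid m) :=
  let φ : (Fin m → Braid N) ⋊[mulAutArrow] Equiv.Perm (Fin m) →*
      (Fin m → Braid N ⧸ R.toSubgroup) ⋊[mulAutArrow] Equiv.Perm (Fin m) :=
    SemidirectProduct.map ((QuotientGroup.mk' R.toSubgroup).compLeft (Fin m)) (MonoidHom.id _)
      (fun _ => rfl)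
  haveI : Finite ((Fin m → Braid N ⧸ R.toSubgroup) ⋊[mulAutArrow] Equiv.Perm (Fin m)) :=
    Finite.of_equiv _ SemidirectProduct.equivProd.symm
  haveI : (φ.comp (wreath h)).ker.FiniteIndex := Subgroup.finiteIndex_ker _
  .ofSubgroup (φ.comp (wreath h)).ker

theorem mem_cableKer {m n N : ℕ} {h : m + n = N + 1} {R : FiniteIndexNormalSubgroup (Braid N)}
    {p : Braid m} : p ∈ (cableKer h R).toSubgroup ↔
      toPerm m p = 1 ∧ ∀ i, cable h i p ∈ R.toSubgroup := by
  simp only [cableKer, FiniteIndexNormalSubgroup.toSubgroup_ofSubgroup, MonoidHom.mem_ker,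
    MonoidHom.comp_apply]
  constructor
  · intro hp
    have h1 : toPerm m p = 1 := by
      rw [← wreath_right h]; exact congrArg SemidirectProduct.right hp
    refine ⟨h1, fun i => ?_⟩
    have h2 := congrFun (congrArg SemidirectProduct.left hp) i
    rw [cable, h1]
    exact (QuotientGroup.eq_one_iff _).1 h2
  · rintro ⟨h1, h2⟩
    refine SemidirectProduct.ext (funext fun i => (QuotientGroup.eq_one_iff _).2 ?_) ?_
    · have := h2 i
      rwa [cable, h1] at this
    · exact (wreath_right h p).trans h1

theorem cableKer_mono {m n N : ℕ} (h : m + n = N + 1) {R R' : FiniteIndexNormalSubgroup (Braid N)}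
    (hR : R ≤ R') : cableKer h R ≤ cableKer h R' := fun _ hp =>
  mem_cableKer.2 ⟨(mem_cableKer.1 hp).1, fun i => hR ((mem_cableKer.1 hp).2 i)⟩

theorem cabling_congr {m n N : ℕ} (h : m + n = N + 1) (i : Fin m)
    (R : FiniteIndexNormalSubgroup (Braid N)) {γ γ' : Braid m} {ρ ρ' : Braid n}
    (hγ : γ⁻¹ * γ' ∈ (cableKer h R).toSubgroup)
    (hρ : ρ⁻¹ * ρ' ∈ R.toSubgroup.comap (shift (N := N) i (by omega))) :
    (QuotientGroup.mk (cabling h i γ ρ) : Braid N ⧸ R.toSubgroup) =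
      QuotientGroup.mk (cabling h i γ' ρ') := by
  obtain ⟨h1, h2'⟩ := mem_cableKer.1 hγ
  have h2 := h2' i
  have e : cable h i γ' = cable h i γ * cable h i (γ⁻¹ * γ') := by
    conv_lhs => rw [show γ' = γ * (γ⁻¹ * γ') by group, cable_mul, h1]
    rfl
  unfold cabling
  rw [QuotientGroup.mk_mul, QuotientGroup.mk_mul, e, QuotientGroup.mk_mul,
    (QuotientGroup.eq_one_iff _).2 h2, mul_one]
  congr 1
  rw [QuotientGroup.eq, ← map_inv, ← map_mul]
  exact hρ

/-! ### The Matsumoto section and the quantum symmetrizer -/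

/-- The permutation of `Fin n` obtained from a permutation of `Fin (n + 1)` by forgetting the last
point and its image. -/
def restrictLast {n : ℕ} (τ : Equiv.Perm (Fin (n + 1))) : Equiv.Perm (Fin n) :=
  Equiv.removeNone
    ((finSuccEquiv' (Fin.last n)).symm.trans (τ.trans (finSuccEquiv' (τ (Fin.last n)))))

theorem restrictLast_spec {n : ℕ} (τ : Equiv.Perm (Fin (n + 1))) (a : Fin n) :
    (τ (Fin.last n)).succAbove (restrictLast τ a) = τ a.castSucc := by
  have h := Equiv.removeNone_some
    ((finSuccEquiv' (Fin.last n)).symm.trans (τ.trans (finSuccEquiv' (τ (Fin.last n))))) (x := a) (by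
      have : τ a.castSucc ≠ τ (Fin.last n) := fun h =>
        (Fin.castSucc_lt_last a).ne (τ.injective h)
      obtain ⟨b, hb⟩ := Fin.exists_succAbove_eq this
      exact ⟨b, by simp [← hb]⟩)
  have h2 := congrArg (finSuccEquiv' (τ (Fin.last n))).symm h
  simpa [restrictLast] using h2

/-- A reduced word for `τ`. -/
def matsumotoWord : (n : ℕ) → Equiv.Perm (Fin n) → List ℕ
  | 0, _ => []
  | n + 1, τ => List.range' (τ (Fin.last n)) (n - τ (Fin.last n)) ++ matsumotoWord n (restrictLast τ)

theorem matsumotoWord_lt : ∀ (n : ℕ) (τ : Equiv.Perm (Fin n)), ∀ i ∈ matsumotoWord n τ, i + 1 < n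
  | 0, _ => by simp [matsumotoWord]
  | n + 1, τ => by
    intro i hi
    rcases List.mem_append.1 hi with hi | hi
    · have := List.mem_range'_1.1 hi
      omega
    · have := matsumotoWord_lt n _ i hi
      omega

theorem succAbove_val {n : ℕ} (p : Fin (n + 1)) (x : Fin n) :
    (p.succAbove x : ℕ) = if (x : ℕ) < p then (x : ℕ) else x + 1 := by
  rw [Fin.succAbove]
  split_ifs with h1 h2 h2 <;> simp_all [Fin.lt_def]

theorem range'_prod_val {n : ℕ} : ∀ (l j : ℕ), j + l = n → ∀ x : Fin (n + 1),
    ((((List.range' j l).map (adjSwap (n + 1))).prod x : Fin (n + 1)) : ℕ) =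
      if (x : ℕ) = n then j else if j ≤ x then x + 1 else x
  | 0, j, h, x => by
    have := x.2
    simp only [List.range'_zero, List.map_nil, List.prod_nil, Equiv.Perm.one_apply]
    split_ifs <;> omega
  | l + 1, j, h, x => by
    have := x.2
    rw [List.range'_succ, List.map_cons, List.prod_cons, Equiv.Perm.mul_apply,
      adjSwap_val (by omega), range'_prod_val l (j + 1) (by omega) x]
    split_ifs <;> omega

theorem word_castSucc_val {n : ℕ} : ∀ (w : List ℕ), (∀ i ∈ w, i + 1 < n) → 
    (w.map (adjSwap (n + 1))).prod (Fin.last n) = Fin.last n ∧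
    ∀ x : Fin n, (w.map (adjSwap (n + 1))).prod x.castSucc = ((w.map (adjSwap n)).prod x).castSucc
  | [], _ => by simp
  | i :: w, hw => by
    obtain ⟨h1, h2⟩ := word_castSucc_val w (fun j hj => hw j (by simp [hj]))
    have hi : i + 1 < n := hw i (by simp)
    refine ⟨?_, fun x => ?_⟩
    · rw [List.map_cons, List.prod_cons, Equiv.Perm.mul_apply, h1]
      ext
      rw [adjSwap_val (by omega), Fin.val_last]
      split_ifs <;> omega
    · rw [List.map_cons, List.prod_cons, Equiv.Perm.mul_apply, h2, List.map_cons, List.prod_cons,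
        Equiv.Perm.mul_apply]
      ext
      rw [adjSwap_val (by omega), Fin.val_castSucc, Fin.val_castSucc, adjSwap_val hi]

/-- The word `matsumotoWord n τ` represents `τ`. -/
theorem matsumotoWord_prod : ∀ (n : ℕ) (τ : Equiv.Perm (Fin n)),
    ((matsumotoWord n τ).map (adjSwap n)).prod = τ
  | 0, _ => by ext x; exact x.elim0
  | n + 1, τ => by
    obtain ⟨h1, h2⟩ := word_castSucc_val (matsumotoWord n (restrictLast τ))
      (matsumotoWord_lt n (restrictLast τ))
    have ih := matsumotoWord_prod n (restrictLast τ)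
    have hl : (τ (Fin.last n) : ℕ) + (n - τ (Fin.last n)) = n := by omega
    ext x
    rw [matsumotoWord, List.map_append, List.prod_append, Equiv.Perm.mul_apply,
      range'_prod_val _ _ hl]
    refine Fin.lastCases ?_ (fun x => ?_) x
    · rw [h1]; simp
    · rw [h2, ih, ← restrictLast_spec, succAbove_val, Fin.val_castSucc]
      have := (restrictLast τ x).2
      split_ifs <;> omega

theorem matsumotoWord_length_adjSwap_mul : ∀ (n : ℕ) (τ : Equiv.Perm (Fin n)) (i : ℕ), i + 1 < n →
    (matsumotoWord n (adjSwap n i * τ)).length ≤ (matsumotoWord n τ).length + 1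
  | 0, _, _, hi => by omega
  | n + 1, τ, i, hi => by
    have key : ∀ (a : Fin n), (((adjSwap (n + 1) i * τ) (Fin.last n)).succAbove
        (restrictLast (adjSwap (n + 1) i * τ) a) : ℕ) = adjSwap (n + 1) i
          ((τ (Fin.last n)).succAbove (restrictLast τ a)) := fun a => by
      rw [restrictLast_spec, restrictLast_spec]; rfl
    simp only [succAbove_val, adjSwap_val hi, Equiv.Perm.mul_apply] at key
    have hj := (τ (Fin.last n)).2
    simp only [matsumotoWord, List.length_append, List.length_range', Equiv.Perm.mul_apply,
      adjSwap_val hi]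
    by_cases h1 : (τ (Fin.last n) : ℕ) = i ∨ (τ (Fin.last n) : ℕ) = i + 1
    · have : restrictLast (adjSwap (n + 1) i * τ) = restrictLast τ := by
        ext a
        have := key a
        split_ifs at this <;> omega
      rw [this]
      split_ifs <;> omega
    · rw [if_neg (by omega), if_neg (by omega)] at key ⊢
      obtain ⟨i', hi', hii⟩ : ∃ i', i' + 1 < n ∧
          (i < (τ (Fin.last n) : ℕ) ∧ i' = i ∨ (τ (Fin.last n) : ℕ) < i ∧ i = i' + 1) := by
        rcases Nat.lt_or_ge i (τ (Fin.last n)) with h | h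
        · exact ⟨i, by omega, Or.inl ⟨h, rfl⟩⟩
        · exact ⟨i - 1, by omega, Or.inr ⟨by omega, by omega⟩⟩
      have h2 : restrictLast (adjSwap (n + 1) i * τ) = adjSwap n i' * restrictLast τ := by
        ext a
        have h4 := key a
        rw [Equiv.Perm.mul_apply, adjSwap_val hi']
        clear key
        generalize ((restrictLast (adjSwap (n + 1) i * τ)) a : ℕ) = y at *
        generalize (restrictLast τ a : ℕ) = z at *
        generalize (τ (Fin.last n) : ℕ) = j at *
        split_ifs at h4 ⊢ <;> omega
      have h3 := matsumotoWord_length_adjSwap_mul n (restrictLast τ) i' hi'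
      rw [h2]
      omega

theorem matsumotoWord_one : ∀ n : ℕ, matsumotoWord n 1 = []
  | 0 => rfl
  | n + 1 => by
    have : restrictLast (1 : Equiv.Perm (Fin (n + 1))) = 1 := by
      ext a
      have h := congrArg Fin.val (restrictLast_spec 1 a)
      have := (restrictLast 1 a).2
      simp only [succAbove_val, Equiv.Perm.one_apply, Fin.val_last, Fin.val_castSucc] at h
      rw [if_pos this] at h
      simpa using h
    simp [matsumotoWord, this, matsumotoWord_one n]

/-- The word `matsumotoWord n τ` has minimal length among the words representing `τ`. -/
theorem matsumotoWord_minimal (n : ℕ) : ∀ (w : List ℕ), (∀ i ∈ w, i + 1 < n) →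
    (matsumotoWord n (w.map (adjSwap n)).prod).length ≤ w.length
  | [], _ => by simp [matsumotoWord_one]
  | i :: w, hw => by
    have h1 := matsumotoWord_minimal n w (fun j hj => hw j (by simp [hj]))
    have h2 := matsumotoWord_length_adjSwap_mul n (w.map (adjSwap n)).prod i (hw i (by simp))
    simp only [List.map_cons, List.prod_cons, List.length_cons]
    omega

/-- The Matsumoto lift of a permutation: replace the letters of a reduced word by braids. -/
def matsumoto (n : ℕ) (τ : Equiv.Perm (Fin n)) : Braid n :=
  ((matsumotoWord n τ).map (braidGen n)).prod

section Symmetrizers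

variable (k : Type w) [Field k]

/-- The quantum symmetrizer, the sum of the Matsumoto lifts of all permutations. -/
def quantumSymmetrizer (n : ℕ) : MonoidAlgebra k (Braid n) :=
  ∑ τ : Equiv.Perm (Fin n), MonoidAlgebra.single (matsumoto n τ) 1

/-- `(p, n - p)`-shuffles: permutations of `Fin n` that are increasing on the first `p` elements and
on the remaining ones. -/
def IsShuffle {n : ℕ} (p : ℕ) (τ : Equiv.Perm (Fin n)) : Prop :=
  ∀ i j : Fin n, i < j → ((j : ℕ) < p ∨ p ≤ (i : ℕ)) → τ i < τ j

open Classical in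
/-- The sum of the Matsumoto lifts of all `(p, n - p)`-shuffles. -/
def shuffleSum (n p : ℕ) : MonoidAlgebra k (Braid n) :=
  ∑ τ : Equiv.Perm (Fin n) with IsShuffle p τ, MonoidAlgebra.single (matsumoto n τ) 1

end Symmetrizers

/-! ### Pro-objects -/

/-- A pro-object: a diagram indexed by a small cofiltered category. -/
structure Pro (C : Type u) [Category.{v} C] where
  /-- The indexing category. -/
  ι : Type t
  [cat : SmallCategory ι]
  [cofiltered : IsCofiltered ι]
  /-- The diagram. -/
  diag : ι ⥤ C

namespace Pro

attribute [instance] Pro.cat Pro.cofiltered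

variable {C : Type u} [Category.{v} C]

/-- Two maps out of terms of a pro-object are identified if they agree after restriction to a common
refinement. -/
def germSetoid (X : Pro.{t} C) (c : C) : Setoid (Σ i : X.ι, X.diag.obj i ⟶ c) where
  r a b := ∃ (l : X.ι) (f : l ⟶ a.1) (g : l ⟶ b.1), X.diag.map f ≫ a.2 = X.diag.map g ≫ b.2
  iseqv :=
    { refl := fun a => ⟨a.1, 𝟙 _, 𝟙 _, rfl⟩
      symm := fun ⟨l, f, g, h⟩ => ⟨l, g, f, h.symm⟩
      trans := by
        rintro a b c ⟨l, f, g, h⟩ ⟨l', f', g', h'⟩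
        obtain ⟨m, p, q, e⟩ := IsCofiltered.cospan g f'
        refine ⟨m, p ≫ f, q ≫ g', ?_⟩
        rw [Functor.map_comp, Functor.map_comp, Category.assoc, Category.assoc, h, ← h',
          ← Category.assoc, ← Functor.map_comp, e, Functor.map_comp, Category.assoc] }

/-- The filtered colimit `colim_i Hom(X_i, c)`. -/
def Germ (X : Pro.{t} C) (c : C) : Type (max t v) := Quotient (germSetoid X c)

/-- The class of a map `X_i ⟶ c`. -/
def Germ.mk {X : Pro.{t} C} {c : C} (i : X.ι) (f : X.diag.obj i ⟶ c) : Germ X c :=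
  Quotient.mk (germSetoid X c) ⟨i, f⟩

theorem Germ.ind {X : Pro.{t} C} {c : C} {p : Germ X c → Prop} (h : ∀ i f, p (Germ.mk i f))
    (a : Germ X c) : p a := Quotient.ind (fun ⟨i, f⟩ => h i f) a

theorem Germ.sound {X : Pro.{t} C} {c : C} {i j l : X.ι} {f : X.diag.obj i ⟶ c}
    {g : X.diag.obj j ⟶ c} (a : l ⟶ i) (b : l ⟶ j) (h : X.diag.map a ≫ f = X.diag.map b ≫ g) :
    Germ.mk i f = Germ.mk j g := Quotient.sound ⟨l, a, b, h⟩

theorem Germ.mk_eq {X : Pro.{t} C} {c : C} {i j : X.ι} {f : X.diag.obj i ⟶ c}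
    {g : X.diag.obj j ⟶ c} (b : i ⟶ j) (h : f = X.diag.map b ≫ g) :
    Germ.mk i f = Germ.mk j g := Germ.sound (𝟙 i) b (by simpa using h)

/-- Postcomposition of a class with a map. -/
def Germ.postcomp {X : Pro.{t} C} {c d : C} (a : Germ X c) (h : c ⟶ d) : Germ X d :=
  Quotient.map (fun x => ⟨x.1, x.2 ≫ h⟩)
    (by rintro _ _ ⟨l, f, g, e⟩; exact ⟨l, f, g, by simp [reassoc_of% e]⟩) a

/-- Morphisms `X ⟶ Y` of pro-objects: elements of `lim_j colim_i Hom(X_i, Y_j)`. -/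
@[ext]
structure Hom (X Y : Pro.{t} C) where
  /-- The components. -/
  germ : ∀ j : Y.ι, Germ X (Y.diag.obj j)
  compat : ∀ {j j' : Y.ι} (f : j ⟶ j'), (germ j).postcomp (Y.diag.map f) = germ j'

/-- Substitution of a morphism of pro-objects in a class. -/
def Hom.precomp {X Y : Pro.{t} C} (f : Hom X Y) {c : C} (a : Germ Y c) : Germ X c :=
  Quotient.lift (fun x : Σ j : Y.ι, Y.diag.obj j ⟶ c => (f.germ x.1).postcomp x.2) (by
    rintro ⟨j, x⟩ ⟨j', x'⟩ ⟨l, p, q, e⟩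
    have h1 : ∀ (g : Germ X (Y.diag.obj l)), (g.postcomp (Y.diag.map p)).postcomp x =
        (g.postcomp (Y.diag.map q)).postcomp x' := by
      refine Germ.ind fun i g => ?_
      change Germ.mk i _ = Germ.mk i _
      simp only [Category.assoc]
      exact congrArg _ (congrArg _ e)
    have h2 := h1 (f.germ l)
    rwa [f.compat, f.compat] at h2) a

instance : Category (Pro.{t} C) where
  Hom X Y := Hom X Y
  id X :=
    { germ := fun j => Germ.mk j (𝟙 _)
      compat := fun {j j'} f => Germ.sound (𝟙 _) f (by simp) }
  comp {X Y Z} f g :=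
    { germ := fun l => Hom.precomp f (g.germ l)
      compat := fun {l l'} h => by
        rw [← g.compat h]
        generalize g.germ l = a
        induction a using Germ.ind with | h j a =>
        change ((f.germ j).postcomp a).postcomp _ = (f.germ j).postcomp (a ≫ _)
        generalize f.germ j = b
        induction b using Germ.ind with | h i b =>
        change Germ.mk i _ = Germ.mk i _
        simp }
  id_comp {X Y} f := by
    refine Hom.ext (funext fun j => ?_)
    change Hom.precomp _ (f.germ j) = f.germ j
    generalize f.germ j = a
    induction a using Germ.ind with | h i a =>
    change Germ.mk i (𝟙 _ ≫ a) = _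
    simp
  comp_id {X Y} f := by
    refine Hom.ext (funext fun j => ?_)
    change (f.germ j).postcomp (𝟙 _) = f.germ j
    generalize f.germ j = a
    induction a using Germ.ind with | h i a =>
    change Germ.mk i (a ≫ 𝟙 _) = _
    simp
  assoc {W X Y Z} f g h := by
    refine Hom.ext (funext fun j => ?_)
    change Hom.precomp _ (h.germ j) = Hom.precomp f (Hom.precomp g (h.germ j))
    generalize h.germ j = a
    induction a using Germ.ind with | h l a =>
    change (Hom.precomp f (g.germ l)).postcomp a = Hom.precomp f ((g.germ l).postcomp a)
    generalize g.germ l = b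
    induction b using Germ.ind with | h m b =>
    change ((f.germ m).postcomp b).postcomp a = (f.germ m).postcomp (b ≫ a)
    generalize f.germ m = c
    induction c using Germ.ind with | h n c =>
    change Germ.mk n _ = Germ.mk n _
    simp

@[ext]
theorem hom_ext {X Y : Pro.{t} C} {f g : X ⟶ Y} (h : ∀ j, f.germ j = g.germ j) : f = g :=
  Hom.ext (funext h)

theorem comp_germ {X Y Z : Pro.{t} C} (f : X ⟶ Y) (g : Y ⟶ Z) (l : Z.ι) :
    (f ≫ g).germ l = Hom.precomp f (g.germ l) := rfl

theorem id_germ {X : Pro.{t} C} (l : X.ι) : Hom.germ (𝟙 X) l = Germ.mk l (𝟙 _) := rfl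

/-- The morphism given by a functor between the indexing categories and a natural family of maps. -/
def homMk {X Y : Pro.{t} C} (φ : Y.ι ⥤ X.ι) (a : φ ⋙ X.diag ⟶ Y.diag) : X ⟶ Y where
  germ j := Germ.mk (φ.obj j) (a.app j)
  compat {j j'} f := Germ.sound (𝟙 _) (φ.map f) (by simpa using (a.naturality f).symm)

/-- A pro-object is strict if all the maps of its diagram are epimorphisms. -/
def IsStrict (X : Pro.{t} C) : Prop := ∀ ⦃i j : X.ι⦄ (f : i ⟶ j), Epi (X.diag.map f)

variable (C) in
/-- Constant pro-objects. -/
def const : C ⥤ Pro.{t} C where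
  obj c := { ι := Discrete PUnit.{t + 1}, diag := (Functor.const _).obj c }
  map f := homMk (𝟭 _) ((Functor.const _).map f)
  map_id c := rfl
  map_comp f g := rfl

section Monoidal

variable [MonoidalCategory C]

/-- The tensor product of pro-objects, indexed by the product of the indexing categories. -/
def tensor (X Y : Pro.{t} C) : Pro.{t} C where
  ι := X.ι × Y.ι
  diag := X.diag.prod Y.diag ⋙ MonoidalCategory.tensor C

/-- The tensor product of classes. -/
def Germ.tensor {X Y : Pro.{t} C} {c d : C} (a : Germ X c) (b : Germ Y d) :
    Germ (Pro.tensor X Y) (c ⊗ d) :=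
  Quotient.map₂ (fun x y => ⟨(x.1, y.1), x.2 ⊗ₘ y.2⟩) (by
    rintro _ _ ⟨l, f, g, e⟩ _ _ ⟨l', f', g', e'⟩
    refine ⟨(l, l'), (f, f'), (g, g'), ?_⟩
    change (X.diag.map f ⊗ₘ Y.diag.map f') ≫ _ = (X.diag.map g ⊗ₘ Y.diag.map g') ≫ _
    simp only [MonoidalCategory.tensorHom_comp_tensorHom]
    rw [e, e']) a b

/-- The tensor product of morphisms. -/
def tensorMap {X X' Y Y' : Pro.{t} C} (f : X ⟶ X') (g : Y ⟶ Y') :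
    Pro.tensor X Y ⟶ Pro.tensor X' Y' where
  germ j := (f.germ j.1).tensor (g.germ j.2)
  compat {j j'} h := by
    change ((f.germ j.1).tensor (g.germ j.2)).postcomp (X'.diag.map h.1 ⊗ₘ Y'.diag.map h.2) = _
    rw [← f.compat h.1, ← g.compat h.2]
    generalize f.germ j.1 = a
    generalize g.germ j.2 = b
    induction a using Germ.ind with | h i a =>
    induction b using Germ.ind with | h i' b =>
    exact congrArg (Germ.mk (X := Pro.tensor X Y) (i, i'))
      (MonoidalCategory.tensorHom_comp_tensorHom _ _ _ _)

instance : MonoidalCategoryStruct (Pro.{t} C) where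
  tensorObj := Pro.tensor
  whiskerLeft X _ _ f := tensorMap (𝟙 X) f
  whiskerRight f Y := tensorMap f (𝟙 Y)
  tensorHom := tensorMap
  tensorUnit := (const C).obj (𝟙_ C)
  associator X Y Z :=
    { hom := homMk (X := Pro.tensor (Pro.tensor X Y) Z) (Y := Pro.tensor X (Pro.tensor Y Z))
        (prod.inverseAssociator _ _ _)
        { app := fun j => (α_ (X.diag.obj j.1) (Y.diag.obj j.2.1) (Z.diag.obj j.2.2)).hom
          naturality := fun j j' f => MonoidalCategory.associator_naturality _ _ _ }
      inv := homMk (X := Pro.tensor X (Pro.tensor Y Z)) (Y := Pro.tensor (Pro.tensor X Y) Z)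
        (prod.associator _ _ _)
        { app := fun j => (α_ (X.diag.obj j.1.1) (Y.diag.obj j.1.2) (Z.diag.obj j.2)).inv
          naturality := fun j j' f => MonoidalCategory.associator_inv_naturality _ _ _ }
      hom_inv_id := hom_ext fun j => congrArg (Germ.mk j) (Iso.hom_inv_id _)
      inv_hom_id := hom_ext fun j => congrArg (Germ.mk j) (Iso.inv_hom_id _) }
  leftUnitor X :=
    { hom := homMk (X := Pro.tensor ((const C).obj (𝟙_ C)) X) (Y := X)
        (Prod.sectR (⟨⟨⟩⟩ : Discrete PUnit.{t + 1}) _)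
        { app := fun j => (λ_ (X.diag.obj j)).hom
          naturality := fun j j' f => by
            change (𝟙 (𝟙_ C) ⊗ₘ X.diag.map f) ≫ (λ_ _).hom = (λ_ _).hom ≫ X.diag.map f
            simp }
      inv := homMk (X := X) (Y := Pro.tensor ((const C).obj (𝟙_ C)) X)
        (CategoryTheory.Prod.snd (Discrete PUnit.{t + 1}) X.ι)
        { app := fun j => (λ_ (X.diag.obj j.2)).inv
          naturality := fun j j' f => by
            change X.diag.map f.2 ≫ (λ_ _).inv = (λ_ _).inv ≫ (𝟙 (𝟙_ C) ⊗ₘ X.diag.map f.2)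
            simp }
      hom_inv_id := hom_ext fun j => congrArg (Germ.mk (X := Pro.tensor ((const C).obj (𝟙_ C)) X) j)
        (Iso.hom_inv_id (λ_ (X.diag.obj j.2)))
      inv_hom_id := hom_ext fun j => congrArg (Germ.mk j) (Iso.inv_hom_id (λ_ (X.diag.obj j))) }
  rightUnitor X :=
    { hom := homMk (X := Pro.tensor X ((const C).obj (𝟙_ C))) (Y := X)
        (Prod.sectL _ (⟨⟨⟩⟩ : Discrete PUnit.{t + 1}))
        { app := fun j => (ρ_ (X.diag.obj j)).hom
          naturality := fun j j' f => by
            change (X.diag.map f ⊗ₘ 𝟙 (𝟙_ C)) ≫ (ρ_ _).hom = (ρ_ _).hom ≫ X.diag.map f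
            simp }
      inv := homMk (X := X) (Y := Pro.tensor X ((const C).obj (𝟙_ C)))
        (CategoryTheory.Prod.fst X.ι (Discrete PUnit.{t + 1}))
        { app := fun j => (ρ_ (X.diag.obj j.1)).inv
          naturality := fun j j' f => by
            change X.diag.map f.1 ≫ (ρ_ _).inv = (ρ_ _).inv ≫ (X.diag.map f.1 ⊗ₘ 𝟙 (𝟙_ C))
            simp }
      hom_inv_id := hom_ext fun j => congrArg (Germ.mk (X := Pro.tensor X ((const C).obj (𝟙_ C))) j)
        (Iso.hom_inv_id (ρ_ (X.diag.obj j.1)))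
      inv_hom_id := hom_ext fun j => congrArg (Germ.mk j) (Iso.inv_hom_id (ρ_ (X.diag.obj j))) }

instance : MonoidalCategory (Pro.{t} C) := MonoidalCategory.ofTensorHom
  (id_tensorHom_id := fun X Y => hom_ext fun j =>
    congrArg (Germ.mk (X := Pro.tensor X Y) j) (MonoidalCategory.id_tensorHom_id _ _))
  (id_tensorHom := fun _ _ _ _ => rfl)
  (tensorHom_id := fun _ _ => rfl)
  (tensorHom_comp_tensorHom := fun {X₁ Y₁ Z₁ X₂ Y₂ Z₂} f₁ f₂ g₁ g₂ => hom_ext fun ⟨j, j'⟩ => by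
    change Hom.precomp (tensorMap f₁ f₂) ((g₁.germ j).tensor (g₂.germ j')) =
      (Hom.precomp f₁ (g₁.germ j)).tensor (Hom.precomp f₂ (g₂.germ j'))
    generalize g₁.germ j = a
    generalize g₂.germ j' = b
    induction a using Germ.ind with | h i a =>
    induction b using Germ.ind with | h i' b =>
    change ((f₁.germ i).tensor (f₂.germ i')).postcomp (a ⊗ₘ b) =
      ((f₁.germ i).postcomp a).tensor ((f₂.germ i').postcomp b)
    generalize f₁.germ i = c
    generalize f₂.germ i' = d
    induction c using Germ.ind with | h l c =>
    induction d using Germ.ind with | h l' d =>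
    exact congrArg (Germ.mk (X := Pro.tensor X₁ X₂) (l, l'))
      (MonoidalCategory.tensorHom_comp_tensorHom _ _ _ _))
  (associator_naturality := fun {X₁ X₂ X₃ Y₁ Y₂ Y₃} f₁ f₂ f₃ => hom_ext fun ⟨j₁, j₂, j₃⟩ => by
    change (((f₁.germ j₁).tensor (f₂.germ j₂)).tensor (f₃.germ j₃)).postcomp (α_ _ _ _).hom =
      Hom.precomp (α_ X₁ X₂ X₃).hom ((f₁.germ j₁).tensor ((f₂.germ j₂).tensor (f₃.germ j₃)))
    generalize f₁.germ j₁ = a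
    generalize f₂.germ j₂ = b
    generalize f₃.germ j₃ = c
    induction a using Germ.ind with | h i₁ a =>
    induction b using Germ.ind with | h i₂ b =>
    induction c using Germ.ind with | h i₃ c =>
    exact congrArg (Germ.mk (X := Pro.tensor (Pro.tensor X₁ X₂) X₃) ((i₁, i₂), i₃))
      (MonoidalCategory.associator_naturality _ _ _))
  (leftUnitor_naturality := fun {X Y} f => hom_ext fun j => by
    change ((Germ.mk (X := (const.{t} C).obj (𝟙_ C)) ⟨⟨⟩⟩ (𝟙 (𝟙_ C))).tensor (f.germ j)).postcomp (λ_ _).hom =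
      Hom.precomp (λ_ X).hom (f.germ j)
    generalize f.germ j = a
    induction a using Germ.ind with | h i a =>
    refine congrArg (Germ.mk (X := Pro.tensor ((const C).obj (𝟙_ C)) X) (⟨⟨⟩⟩, i)) ?_
    change (𝟙 (𝟙_ C) ⊗ₘ a) ≫ (λ_ _).hom = (λ_ _).hom ≫ a
    simp)
  (rightUnitor_naturality := fun {X Y} f => hom_ext fun j => by
    change ((f.germ j).tensor (Germ.mk (X := (const.{t} C).obj (𝟙_ C)) ⟨⟨⟩⟩ (𝟙 (𝟙_ C)))).postcomp (ρ_ _).hom =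
      Hom.precomp (ρ_ X).hom (f.germ j)
    generalize f.germ j = a
    induction a using Germ.ind with | h i a =>
    refine congrArg (Germ.mk (X := Pro.tensor X ((const C).obj (𝟙_ C))) (i, ⟨⟨⟩⟩)) ?_
    change (a ⊗ₘ 𝟙 (𝟙_ C)) ≫ (ρ_ _).hom = (ρ_ _).hom ≫ a
    simp)
  (pentagon := fun W X Y Z => hom_ext fun ⟨j₁, j₂, j₃, j₄⟩ => by
    refine congrArg (Germ.mk (X := Pro.tensor (Pro.tensor (Pro.tensor W X) Y) Z)
      (((j₁, j₂), j₃), j₄)) ?_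
    change ((α_ _ _ _).hom ⊗ₘ 𝟙 _) ≫ (α_ _ _ _).hom ≫ (𝟙 _ ⊗ₘ (α_ _ _ _).hom) =
      (α_ _ _ _).hom ≫ (α_ _ _ _).hom
    simp)
  (triangle := fun X Y => hom_ext fun ⟨j₁, j₂⟩ => by
    refine congrArg (Germ.mk (X := Pro.tensor (Pro.tensor X ((const C).obj (𝟙_ C))) Y)
      ((j₁, ⟨⟨⟩⟩), j₂)) ?_
    change (α_ _ _ _).hom ≫ (𝟙 _ ⊗ₘ (λ_ _).hom) = ((ρ_ _).hom ⊗ₘ 𝟙 _)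
    simp)

/-- The inclusion of constant pro-objects is lax (in fact strongly) monoidal. -/
instance : (const.{t} C).LaxMonoidal where
  ε := 𝟙 ((const C).obj (𝟙_ C))
  μ X Y := homMk (X := Pro.tensor ((const C).obj X) ((const C).obj Y)) (Y := (const C).obj (X ⊗ Y))
    (Functor.diag _)
    { app := fun _ => 𝟙 (X ⊗ Y)
      naturality := fun _ _ _ => by
        change (𝟙 X ⊗ₘ 𝟙 Y) ≫ 𝟙 (X ⊗ Y) = 𝟙 (X ⊗ Y) ≫ 𝟙 (X ⊗ Y)
        simp }
  μ_natural_left {X Y} f Z := hom_ext fun j => by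
    refine congrArg (Germ.mk (X := Pro.tensor ((const C).obj X) ((const C).obj Z)) (j, j)) ?_
    change (f ⊗ₘ 𝟙 Z) ≫ 𝟙 _ = 𝟙 _ ≫ (f ▷ Z)
    simp
  μ_natural_right {X Y} Z f := hom_ext fun j => by
    refine congrArg (Germ.mk (X := Pro.tensor ((const C).obj Z) ((const C).obj X)) (j, j)) ?_
    change (𝟙 Z ⊗ₘ f) ≫ 𝟙 _ = 𝟙 _ ≫ (Z ◁ f)
    simp
  associativity X Y Z := hom_ext fun j => by
    refine congrArg (Germ.mk (X := Pro.tensor (Pro.tensor ((const C).obj X) ((const C).obj Y))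
      ((const C).obj Z)) ((j, j), j)) ?_
    change (𝟙 (X ⊗ Y) ⊗ₘ 𝟙 Z) ≫ 𝟙 _ ≫ (α_ X Y Z).hom =
      (α_ X Y Z).hom ≫ (𝟙 X ⊗ₘ 𝟙 (Y ⊗ Z)) ≫ 𝟙 _
    simp
  left_unitality X := hom_ext fun j => by
    refine congrArg (Germ.mk (X := Pro.tensor ((const C).obj (𝟙_ C)) ((const C).obj X)) (j, j)) ?_
    change (λ_ X).hom = (𝟙 (𝟙_ C) ⊗ₘ 𝟙 X) ≫ 𝟙 _ ≫ (λ_ X).hom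
    simp
  right_unitality X := hom_ext fun j => by
    refine congrArg (Germ.mk (X := Pro.tensor ((const C).obj X) ((const C).obj (𝟙_ C))) (j, j)) ?_
    change (ρ_ X).hom = (𝟙 X ⊗ₘ 𝟙 (𝟙_ C)) ≫ 𝟙 _ ≫ (ρ_ X).hom
    simp

end Monoidal

end Pro

/-! ### Braided sequences and left ideals in pro-vector spaces -/

section Sequences

variable (k : Type w) [Field k]

/-- A braided sequence of pro-vector spaces: for each `n` an inverse system of vector spaces with
compatible right actions of the braid group on `n` strands. -/
structure BraidedSeq where
  /-- The `n`-th pro-vector space. -/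
  obj : ℕ → Pro.{t} (ModuleCat.{w} k)
  /-- The action of a braid. -/
  act : ∀ n, Braid n → ((obj n).diag ⟶ (obj n).diag)
  act_one : ∀ n, act n 1 = 𝟙 _
  /-- It is a right action: `x · (g h) = (x · g) · h`. -/
  act_mul : ∀ n g h, act n (g * h) = act n g ≫ act n h

/-- A braided sequence together with partial composition maps `∘ᵢ`. -/
structure BraidedSeqWithComp extends BraidedSeq.{t} k where
  /-- The partial composition inserting an operation in the `i`-th input. -/
  circ : ∀ {m n N : ℕ}, m + n = N + 1 → Fin m → (obj m ⊗ obj n ⟶ obj N)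

variable {k}

/-- The action of a braid as a morphism of pro-vector spaces. -/
def BraidedSeq.actPro (S : BraidedSeq.{t} k) (n : ℕ) (g : Braid n) : S.obj n ⟶ S.obj n :=
  Pro.homMk (𝟭 _) (S.act n g)

/-- A braided sequence is strict if each of its pro-vector spaces is strict. -/
def BraidedSeq.IsStrict (S : BraidedSeq.{t} k) : Prop := ∀ n, (S.obj n).IsStrict

/-- The family of morphisms `φ` makes `I` a left ideal in `O`: it consists of equivariant
monomorphisms, and inserting operations of `I` in operations of `O` gives operations of `I`. -/
structure IsLeftIdeal (O : BraidedSeqWithComp.{t} k) (I : BraidedSeq.{t} k)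
    (φ : ∀ n, I.obj n ⟶ O.obj n) : Prop where
  mono : ∀ n, Mono (φ n)
  equivariant : ∀ n (g : Braid n), I.actPro n g ≫ φ n = φ n ≫ O.actPro n g
  circ_mem : ∀ {m n N : ℕ} (h : m + n = N + 1) (i : Fin m),
    ∃ c : O.obj m ⊗ I.obj n ⟶ I.obj N, c ≫ φ N = (O.obj m ◁ φ n) ≫ O.circ h i

end Sequences

/-! ### The profinite braided associative operad -/

section BrAssHat

variable (k : Type w) [Field k]

/-- Finite quotients of a group, indexed by their kernels. -/
abbrev FinQuot (n : ℕ) : Type := FiniteIndexNormalSubgroup (Braid n)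

instance (n : ℕ) : Nonempty (FinQuot n) := ⟨.ofSubgroup ⊤⟩

/-- The group ring of a finite quotient of the braid group. -/
abbrev QuotAlg {n : ℕ} (Q : FinQuot n) : Type w := MonoidAlgebra k (Braid n ⧸ Q.toSubgroup)

/-- The projection from the group ring of the braid group. -/
def toQuotAlg {n : ℕ} (Q : FinQuot n) : MonoidAlgebra k (Braid n) →ₐ[k] QuotAlg k Q :=
  MonoidAlgebra.mapDomainAlgHom k k (QuotientGroup.mk' Q.toSubgroup)

/-- The projection between group rings of finite quotients. -/
def quotAlgMap {n : ℕ} {P Q : FinQuot n} (h : P ≤ Q) : QuotAlg k P →ₐ[k] QuotAlg k Q :=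
  MonoidAlgebra.mapDomainAlgHom k k
    (QuotientGroup.map P.toSubgroup Q.toSubgroup (MonoidHom.id _) h)

theorem quotAlgMap_single {n : ℕ} {P Q : FinQuot n} (h : P ≤ Q) (g : Braid n) (c : k) :
    quotAlgMap k h (MonoidAlgebra.single (g : Braid n ⧸ P.toSubgroup) c) =
      MonoidAlgebra.single (g : Braid n ⧸ Q.toSubgroup) c := by
  exact MonoidAlgebra.mapDomain_single

theorem toQuotAlg_single {n : ℕ} (Q : FinQuot n) (g : Braid n) (c : k) :
    toQuotAlg k Q (MonoidAlgebra.single g c) =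
      MonoidAlgebra.single (g : Braid n ⧸ Q.toSubgroup) c := by
  exact MonoidAlgebra.mapDomain_single

variable {k} in
theorem quotAlg_hom_ext {n : ℕ} {Q : FinQuot n} {M : Type*} [AddCommGroup M] [Module k M]
    {f f' : QuotAlg k Q →ₗ[k] M}
    (h : ∀ g : Braid n, f (MonoidAlgebra.single (g : Braid n ⧸ Q.toSubgroup) 1) =
      f' (MonoidAlgebra.single (g : Braid n ⧸ Q.toSubgroup) 1)) : f = f' := by
  refine (MonoidAlgebra.basis _ k).ext fun x => ?_
  induction x using QuotientGroup.induction_on with | H g =>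
  simpa using h g

theorem quotAlgMap_toQuotAlg {n : ℕ} {P Q : FinQuot n} (h : P ≤ Q) (x : MonoidAlgebra k (Braid n)) :
    quotAlgMap k h (toQuotAlg k P x) = toQuotAlg k Q x := by
  change ((quotAlgMap k h).comp (toQuotAlg k P)) x = _
  refine LinearMap.congr_fun (f := ((quotAlgMap k h).comp (toQuotAlg k P)).toLinearMap)
    (g := (toQuotAlg k Q).toLinearMap) ((MonoidAlgebra.basis _ k).ext fun g => ?_) x
  rw [MonoidAlgebra.basis_apply]
  change quotAlgMap k h (toQuotAlg k P _) = toQuotAlg k Q _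
  rw [toQuotAlg_single, quotAlgMap_single, toQuotAlg_single]

/-- The inverse system `k[Q]` of group rings of finite quotients of the braid group. -/
def brAssHatDiag (n : ℕ) : FinQuot n ⥤ ModuleCat.{w} k where
  obj Q := ModuleCat.of k (QuotAlg k Q)
  map f := ModuleCat.ofHom (quotAlgMap k (leOfHom f)).toLinearMap
  map_id Q := ModuleCat.hom_ext (quotAlg_hom_ext fun g => quotAlgMap_single k _ g 1)
  map_comp f f' := ModuleCat.hom_ext (quotAlg_hom_ext fun g => by
    refine (quotAlgMap_single k _ g 1).trans ?_
    change _ = quotAlgMap k _ (quotAlgMap k _ _)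
    rw [quotAlgMap_single, quotAlgMap_single])

/-- Right multiplication by a braid on `k[Q]`. -/
def rightMul {n : ℕ} (Q : FinQuot n) (g : Braid n) : QuotAlg k Q →ₗ[k] QuotAlg k Q :=
  LinearMap.mulRight k (MonoidAlgebra.single (g : Braid n ⧸ Q.toSubgroup) 1)

theorem rightMul_apply {n : ℕ} (Q : FinQuot n) (g : Braid n) (x : QuotAlg k Q) :
    rightMul k Q g x = x * MonoidAlgebra.single (g : Braid n ⧸ Q.toSubgroup) 1 := rfl

theorem rightMul_one {n : ℕ} (Q : FinQuot n) (x : QuotAlg k Q) : rightMul k Q 1 x = x :=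
  mul_one x

theorem rightMul_mul {n : ℕ} (Q : FinQuot n) (g h : Braid n) (x : QuotAlg k Q) :
    rightMul k Q (g * h) x = rightMul k Q h (rightMul k Q g x) := by
  rw [rightMul_apply, rightMul_apply, rightMul_apply, mul_assoc, MonoidAlgebra.single_mul_single,
    one_mul]
  rfl

theorem quotAlgMap_rightMul {n : ℕ} {P Q : FinQuot n} (h : P ≤ Q) (g : Braid n) (x : QuotAlg k P) :
    quotAlgMap k h (rightMul k P g x) = rightMul k Q g (quotAlgMap k h x) := by
  rw [rightMul_apply, map_mul, quotAlgMap_single, rightMul_apply]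

/-- The braided sequence underlying the profinite braided associative operad. -/
def brAssHatSeq : BraidedSeq.{0} k where
  obj n := { ι := FinQuot n, diag := brAssHatDiag k n }
  act n g :=
    { app := fun Q => ModuleCat.ofHom (rightMul k Q g)
      naturality := fun P Q f => ModuleCat.hom_ext
        (LinearMap.ext fun x => (quotAlgMap_rightMul k (leOfHom f) g x).symm) }
  act_one n := NatTrans.ext (funext fun Q => ModuleCat.hom_ext
    (LinearMap.ext fun x => rightMul_one k Q x))
  act_mul n g h := NatTrans.ext (funext fun Q => ModuleCat.hom_ext
    (LinearMap.ext fun x => rightMul_mul k Q g h x))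

/-- Cabling of elements of finite quotients of the braid groups. -/
def quotCabling {m n N : ℕ} (h : m + n = N + 1) (i : Fin m) {P : FinQuot m} {Q : FinQuot n} {R : FinQuot N}
    (hP : P ≤ cableKer h R) (hQ : Q ≤ R.comap (shift (N := N) i (by omega))) :
    Braid m ⧸ P.toSubgroup → Braid n ⧸ Q.toSubgroup → Braid N ⧸ R.toSubgroup :=
  Quotient.map₂ (cabling h i) (fun _ _ hγ _ _ hρ => Quotient.exact
    (cabling_congr h i R (hP (QuotientGroup.leftRel_apply.1 hγ))
      (hQ (QuotientGroup.leftRel_apply.1 hρ))))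

/-- The bilinear extension `k[P] ⊗ k[Q] ⟶ k[R]` of the cabling. -/
def quotCirc {m n N : ℕ} (h : m + n = N + 1) (i : Fin m) {P : FinQuot m} {Q : FinQuot n} {R : FinQuot N}
    (hP : P ≤ cableKer h R) (hQ : Q ≤ R.comap (shift (N := N) i (by omega))) :
    TensorProduct k (QuotAlg k P) (QuotAlg k Q) →ₗ[k] QuotAlg k R :=
  TensorProduct.lift ((MonoidAlgebra.basis _ k).constr k fun γ =>
    MonoidAlgebra.mapDomainLinearMap k k (quotCabling h i hP hQ γ))

theorem quotCirc_single {m n N : ℕ} (h : m + n = N + 1) (i : Fin m) {P : FinQuot m} {Q : FinQuot n}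
    {R : FinQuot N} (hP : P ≤ cableKer h R) (hQ : Q ≤ R.comap (shift (N := N) i (by omega)))
    (γ : Braid m) (ρ : Braid n) :
    quotCirc k h i hP hQ (TensorProduct.tmul k
      (MonoidAlgebra.single (γ : Braid m ⧸ P.toSubgroup) 1)
      (MonoidAlgebra.single (ρ : Braid n ⧸ Q.toSubgroup) 1)) =
    MonoidAlgebra.single (cabling h i γ ρ : Braid N ⧸ R.toSubgroup) 1 := by
  have e : (MonoidAlgebra.single (γ : Braid m ⧸ P.toSubgroup) (1 : k)) =
    MonoidAlgebra.basis _ k (γ : Braid m ⧸ P.toSubgroup) := by simp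
  rw [quotCirc, TensorProduct.lift.tmul, e, Module.Basis.constr_basis,
    MonoidAlgebra.mapDomainLinearMap_single]
  rfl

/-- The partial composition `∘ᵢ` of the profinite braided associative operad. -/
def brAssHatCirc {m n N : ℕ} (h : m + n = N + 1) (i : Fin m) :
    (brAssHatSeq k).obj m ⊗ (brAssHatSeq k).obj n ⟶ (brAssHatSeq k).obj N where
  germ := fun R : FinQuot N => Pro.Germ.mk
    (X := Pro.tensor ((brAssHatSeq k).obj m) ((brAssHatSeq k).obj n))
    ((cableKer h R, R.comap (shift (N := N) i (by omega))) : FinQuot m × FinQuot n)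
    (ModuleCat.ofHom (quotCirc k h i le_rfl le_rfl))
  compat := fun {R R' : FinQuot N} f => by
    refine Pro.Germ.mk_eq (X := Pro.tensor ((brAssHatSeq k).obj m) ((brAssHatSeq k).obj n))
      ((homOfLE (cableKer_mono h (leOfHom f)) : cableKer h R ⟶ cableKer h R'),
        (homOfLE (FiniteIndexNormalSubgroup.comap_mono _ (leOfHom f)) :
          R.comap (shift (N := N) i (by omega)) ⟶ R'.comap (shift (N := N) i (by omega)))) ?_
    refine ModuleCat.hom_ext (TensorProduct.ext (quotAlg_hom_ext fun γ =>
      quotAlg_hom_ext fun ρ => ?_))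
    change quotAlgMap k (leOfHom f) (quotCirc k h i _ _ (TensorProduct.tmul k _ _)) =
      quotCirc k h i _ _ (TensorProduct.tmul k (quotAlgMap k _ _) (quotAlgMap k _ _))
    rw [quotAlgMap_single, quotAlgMap_single, quotCirc_single, quotCirc_single, quotAlgMap_single]

/-- The profinite braided associative operad: the inverse systems of group rings of the finite
quotients of the braid groups, with partial compositions given by cabling. -/
def brAssHat : BraidedSeqWithComp.{0} k where
  toBraidedSeq := brAssHatSeq k
  circ h i := brAssHatCirc k h i

/-- The action of the quantum symmetrizer on `k[Q]` by left multiplication. -/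
def symMul {n : ℕ} (Q : FinQuot n) : QuotAlg k Q →ₗ[k] QuotAlg k Q :=
  LinearMap.mulLeft k (toQuotAlg k Q (quantumSymmetrizer k n))

theorem quotAlgMap_symMul {n : ℕ} {P Q : FinQuot n} (h : P ≤ Q) (x : QuotAlg k P) :
    quotAlgMap k h (symMul k P x) = symMul k Q (quotAlgMap k h x) := by
  rw [symMul, symMul, LinearMap.mulLeft_apply, LinearMap.mulLeft_apply, map_mul,
    quotAlgMap_toQuotAlg]

theorem rightMul_symMul {n : ℕ} (Q : FinQuot n) (g : Braid n) (x : QuotAlg k Q) :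
    rightMul k Q g (symMul k Q x) = symMul k Q (rightMul k Q g x) := mul_assoc _ _ _

/-- The kernel of the quantum symmetrizer on `k[Q]`. -/
def worKer {n : ℕ} (Q : FinQuot n) : Submodule k (QuotAlg k Q) := LinearMap.ker (symMul k Q)

theorem quotAlgMap_mem {n : ℕ} {P Q : FinQuot n} (h : P ≤ Q) (x : QuotAlg k P)
    (hx : x ∈ worKer k P) : quotAlgMap k h x ∈ worKer k Q := by
  rw [worKer, LinearMap.mem_ker] at *
  rw [← quotAlgMap_symMul, hx, map_zero]

theorem rightMul_mem {n : ℕ} (Q : FinQuot n) (g : Braid n) (x : QuotAlg k Q)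
    (hx : x ∈ worKer k Q) : rightMul k Q g x ∈ worKer k Q := by
  rw [worKer, LinearMap.mem_ker] at *
  rw [← rightMul_symMul, hx, map_zero]

/-- The Woronowicz ideal: the kernel of left multiplication by the quantum symmetrizers on the
profinite braided associative operad. -/
def woronowicz : BraidedSeq.{0} k where
  obj n :=
    { ι := FinQuot n
      diag :=
        { obj := fun Q => ModuleCat.of k (worKer k Q)
          map := fun {P Q} f => ModuleCat.ofHom
            ((quotAlgMap k (leOfHom f)).toLinearMap.restrict (quotAlgMap_mem k (leOfHom f)))
          map_id := fun Q => ModuleCat.hom_ext (LinearMap.ext fun x => Subtype.ext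
            (congrArg (fun F => F.hom x.1) ((brAssHatDiag k n).map_id Q)))
          map_comp := fun f f' => ModuleCat.hom_ext (LinearMap.ext fun x => Subtype.ext
            (congrArg (fun F => F.hom x.1) ((brAssHatDiag k n).map_comp f f'))) } }
  act n g :=
    { app := fun Q => ModuleCat.ofHom ((rightMul k Q g).restrict (rightMul_mem k Q g))
      naturality := fun P Q f => ModuleCat.hom_ext (LinearMap.ext fun x => Subtype.ext
        (quotAlgMap_rightMul k (leOfHom f) g x.1).symm) }
  act_one n := NatTrans.ext (funext fun Q => ModuleCat.hom_ext
    (LinearMap.ext fun x => Subtype.ext (rightMul_one k Q x.1)))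
  act_mul n g h := NatTrans.ext (funext fun Q => ModuleCat.hom_ext
    (LinearMap.ext fun x => Subtype.ext (rightMul_mul k Q g h x.1)))

/-- The inclusion of the Woronowicz ideal. -/
def woronowiczIncl (n : ℕ) : (woronowicz k).obj n ⟶ (brAssHat k).obj n :=
  Pro.homMk (X := (woronowicz k).obj n) (Y := (brAssHat k).obj n) (𝟭 (FinQuot n))
    { app := fun Q => ModuleCat.ofHom (worKer k Q).subtype
      naturality := fun _ _ _ => rfl }

/-- The Nichols module: the quotient of the profinite braided associative operad by the Woronowicz
ideal. -/
def nic : BraidedSeq.{0} k where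
  obj n :=
    { ι := FinQuot n
      diag :=
        { obj := fun Q => ModuleCat.of k (QuotAlg k Q ⧸ worKer k Q)
          map := fun {P Q} f => ModuleCat.ofHom
            ((worKer k P).mapQ (worKer k Q) (quotAlgMap k (leOfHom f)).toLinearMap
              (quotAlgMap_mem k (leOfHom f)))
          map_id := fun Q => ModuleCat.hom_ext (Submodule.linearMap_qext _ (LinearMap.ext fun x =>
            congrArg (fun F => (worKer k Q).mkQ (F.hom x)) ((brAssHatDiag k n).map_id Q)))
          map_comp := fun {P Q R} f f' => ModuleCat.hom_ext (Submodule.linearMap_qext _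
            (LinearMap.ext fun x =>
              congrArg (fun F => (worKer k R).mkQ (F.hom x))
                ((brAssHatDiag k n).map_comp f f'))) } }
  act n g :=
    { app := fun Q => ModuleCat.ofHom
        ((worKer k Q).mapQ (worKer k Q) (rightMul k Q g) (rightMul_mem k Q g))
      naturality := fun P Q f => ModuleCat.hom_ext (Submodule.linearMap_qext _
        (LinearMap.ext fun x => congrArg (worKer k Q).mkQ
          (quotAlgMap_rightMul k (leOfHom f) g x).symm)) }
  act_one n := NatTrans.ext (funext fun Q => ModuleCat.hom_ext (Submodule.linearMap_qext _
    (LinearMap.ext fun x => congrArg (worKer k Q).mkQ (rightMul_one k Q x))))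
  act_mul n g h := NatTrans.ext (funext fun Q => ModuleCat.hom_ext (Submodule.linearMap_qext _
    (LinearMap.ext fun x => congrArg (worKer k Q).mkQ (rightMul_mul k Q g h x))))

end BrAssHat

/-! ### Tensor powers and the braid group action -/

section TensorPowers

variable {C : Type u} [Category.{v} C] [MonoidalCategory C]

/-- The tensor powers `V ⊗ ⋯ ⊗ V`, bracketed from the left. -/
def tensorPow (V : C) : ℕ → C
  | 0 => 𝟙_ C
  | n + 1 => tensorPow V n ⊗ V

/-- The concatenation isomorphisms. -/
def concat (V : C) (p : ℕ) : ∀ q, tensorPow V p ⊗ tensorPow V q ≅ tensorPow V (p + q)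
  | 0 => ρ_ (tensorPow V p)
  | q + 1 => (α_ (tensorPow V p) (tensorPow V q) V).symm ≪≫ whiskerRightIso (concat V p q) V

variable [BraidedCategory C]

/-- The braiding of the last two factors. -/
def lastBraid (X V : C) : Aut ((X ⊗ V) ⊗ V) :=
  α_ X V V ≪≫ whiskerLeftIso X (β_ V V) ≪≫ (α_ X V V).symm

/-- Tensoring automorphisms with the identity of `V`. -/
def whiskerAut (X V : C) : Aut X →* Aut (X ⊗ V) where
  toFun e := whiskerRightIso e V
  map_one' := Iso.ext (id_whiskerRight X V)
  map_mul' e f := Iso.ext (comp_whiskerRight f.hom e.hom V)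

/-- The braiding of the factors `i` and `i + 1` of a tensor power, for `i + 1 < n`; the factors are
numbered from `0`, beginning on the left. -/
def genAct (V : C) : ∀ n, ℕ → Aut (tensorPow V n)
  | 0, _ => 1
  | 1, _ => 1
  | n + 2, i =>
    if i = n then lastBraid (tensorPow V n) V else whiskerAut (tensorPow V (n + 1)) V (genAct V (n + 1) i)

theorem genAct_last (V : C) (n : ℕ) : genAct V (n + 2) n = lastBraid (tensorPow V n) V :=
  if_pos rfl

theorem genAct_of_ne (V : C) {n i : ℕ} (h : i ≠ n) :
    genAct V (n + 2) i = whiskerAut (tensorPow V (n + 1)) V (genAct V (n + 1) i) := if_neg h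

theorem lastBraid_comm (X V : C) (e : Aut X) :
    whiskerAut _ V (whiskerAut X V e) * lastBraid X V = lastBraid X V * whiskerAut _ V (whiskerAut X V e) := by
  refine Iso.ext ?_
  change (lastBraid X V).hom ≫ e.hom ▷ V ▷ V = e.hom ▷ V ▷ V ≫ (lastBraid X V).hom
  simp only [lastBraid, Iso.trans_hom, whiskerLeftIso_hom, Iso.symm_hom, Category.assoc]
  rw [← associator_inv_naturality_left, whisker_exchange_assoc, associator_naturality_left_assoc]

theorem lastBraid_braid (X V : C) :
    (lastBraid X V).hom ▷ V ≫ (lastBraid (X ⊗ V) V).hom ≫ (lastBraid X V).hom ▷ V =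
      (lastBraid (X ⊗ V) V).hom ≫ (lastBraid X V).hom ▷ V ≫ (lastBraid (X ⊗ V) V).hom := by
  have h := congrArg (fun f => X ◁ f) (BraidedCategory.yang_baxter V V V)
  simp only [lastBraid, Iso.trans_hom, whiskerLeftIso_hom, Iso.symm_hom]
  calc _ = 𝟙 _ ⊗≫ X ◁ ((α_ V V V).inv ≫ (β_ V V).hom ▷ V ≫ (α_ V V V).hom ≫ V ◁ (β_ V V).hom ≫
          (α_ V V V).inv ≫ (β_ V V).hom ▷ V ≫ (α_ V V V).hom) ⊗≫ 𝟙 _ := by monoidal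
    _ = _ := by rw [h]; monoidal

theorem isBraiding_genAct (V : C) : ∀ n, IsBraiding n (genAct V n)
  | 0 => ⟨fun _ h => absurd h (by omega), fun _ _ _ h => absurd h (by omega)⟩
  | 1 => ⟨fun _ h => absurd h (by omega), fun _ _ _ h => absurd h (by omega)⟩
  | n + 2 => by
    have ih := isBraiding_genAct V (n + 1)
    constructor
    · intro i hi
      by_cases h1 : i + 1 = n
      · subst h1
        rw [genAct_last, genAct_of_ne V (show i ≠ i + 1 by omega), genAct_last]
        exact Iso.ext (lastBraid_braid _ V)
      · rw [genAct_of_ne V h1, genAct_of_ne V (show i ≠ n by omega)]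
        have h := congrArg (whiskerAut (tensorPow V (n + 1)) V) (ih.braid i (by omega))
        simp only [map_mul] at h
        exact h
    · intro i j hij hj
      by_cases h1 : j = n
      · subst h1
        obtain ⟨m, rfl⟩ : ∃ m, j = m + 1 := ⟨j - 1, by omega⟩
        rw [genAct_last, genAct_of_ne V (show i ≠ m + 1 by omega),
          genAct_of_ne V (show i ≠ m by omega)]
        exact lastBraid_comm _ V _
      · rw [genAct_of_ne V h1, genAct_of_ne V (show i ≠ n by omega)]
        have h := congrArg (whiskerAut (tensorPow V (n + 1)) V) (ih.comm i j hij (by omega))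
        simp only [map_mul] at h
        exact h

/-- The left action of the braid group on a tensor power. (Multiplication in `Aut` is the
composition of maps in the usual order.) -/
def braidAct (V : C) (n : ℕ) : Braid n →* Aut (tensorPow V n) :=
  braidLift (genAct V n) (isBraiding_genAct V n)

/-- The action of a braid on a tensor power, as a map. -/
def braidMap (V : C) (n : ℕ) (g : Braid n) : tensorPow V n ⟶ tensorPow V n := (braidAct V n g).hom

/-- An object is finitely braided if for each `n` the action of the braid group on its `n`-th tensor
power factors through a finite quotient. -/
def FinitelyBraided (V : C) : Prop := ∀ n, (braidAct V n).ker.FiniteIndex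

variable (k : Type w) [Field k] [Preadditive C] [Linear k C]

/-- The linear extension of the action of the braid group on a tensor power. -/
def algAct (V : C) (n : ℕ) : MonoidAlgebra k (Braid n) →ₐ[k] End (tensorPow V n) :=
  MonoidAlgebra.lift k _ (Braid n)
    { toFun := braidMap V n
      map_one' := by rw [braidMap, map_one]; rfl
      map_mul' := fun g h => by rw [braidMap, map_mul]; rfl }

end TensorPowers

/-! ### Balanced tensor products and the Artin functor -/

section Balanced

variable {k : Type w} [Field k] {C : Type u} [Category.{v} C] [Preadditive C] [Linear k C]
  [HasCoproducts.{w} C] [HasCoequalizers C]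

section

variable {G : Type} (M : ModuleCat.{w} k) (ρ : G → (M ⟶ M)) {X : C} (a : G → (X ⟶ X))

/-- The first map in the presentation of the balanced tensor product. -/
def balL : ∐ (fun _ : (k × M × M) ⊕ (G × M) => X) ⟶ ∐ (fun _ : M => X) :=
  Sigma.desc fun
    | .inl x => Sigma.ι (fun _ : M => X) (x.1 • x.2.1 + x.2.2)
    | .inr x => Sigma.ι (fun _ : M => X) (ρ x.1 x.2)

/-- The second map in the presentation of the balanced tensor product. -/
def balR : ∐ (fun _ : (k × M × M) ⊕ (G × M) => X) ⟶ ∐ (fun _ : M => X) :=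
  Sigma.desc fun
    | .inl x => x.1 • Sigma.ι (fun _ : M => X) x.2.1 + Sigma.ι (fun _ : M => X) x.2.2
    | .inr x => a x.1 ≫ Sigma.ι (fun _ : M => X) x.2

/-- The balanced tensor product `M ⊗_G X` of a vector space `M` with a right action `ρ` of `G` and
an object `X` with a left action `a` of `G`: it is the quotient of the sum of copies of `X` indexed by
the elements of `M` by the relations making `m ⊗ x` linear in `m`, and
`(m · g) ⊗ x = m ⊗ (g · x)`. -/
def bal : C := coequalizer (balL M ρ (X := X)) (balR M a)

variable {M ρ a}

variable (M ρ a) in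
/-- The quotient map. -/
def bal.π : ∐ (fun _ : M => X) ⟶ bal M ρ a := coequalizer.π _ _

theorem bal.condition : balL M ρ (X := X) ≫ bal.π M ρ a = balR M a ≫ bal.π M ρ a :=
  coequalizer.condition _ _

/-- The map `x ↦ m ⊗ x`. -/
def bal.ι (m : M) : X ⟶ bal M ρ a := Sigma.ι (fun _ : M => X) m ≫ bal.π M ρ a

theorem bal.ι_smul_add (c : k) (m m' : M) :
    (bal.ι (c • m + m') : X ⟶ bal M ρ a) = c • bal.ι m + bal.ι m' := by
  have h := Sigma.ι (fun _ : (k × M × M) ⊕ (G × M) => X) (.inl (c, m, m')) ≫=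
    bal.condition (M := M) (ρ := ρ) (a := a)
  simpa [balL, balR, bal.ι] using h

theorem bal.ι_act (g : G) (m : M) : (bal.ι (ρ g m) : X ⟶ bal M ρ a) = a g ≫ bal.ι m := by
  have h := Sigma.ι (fun _ : (k × M × M) ⊕ (G × M) => X) (.inr (g, m)) ≫=
    bal.condition (M := M) (ρ := ρ) (a := a)
  simpa [balL, balR, bal.ι] using h

/-- The universal property of the balanced tensor product. -/
def bal.desc {Z : C} (f : M → (X ⟶ Z)) (h1 : ∀ (c : k) (m m' : M), f (c • m + m') = c • f m + f m')
    (h2 : ∀ g m, f (ρ g m) = a g ≫ f m) : bal M ρ a ⟶ Z :=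
  coequalizer.desc (Sigma.desc f) (Sigma.hom_ext _ _ fun
    | .inl x => by simp [balL, balR, h1]
    | .inr x => by simp [balL, balR, h2])

theorem bal.ι_desc {Z : C} (f : M → (X ⟶ Z))
    (h1 : ∀ (c : k) (m m' : M), f (c • m + m') = c • f m + f m')
    (h2 : ∀ g m, f (ρ g m) = a g ≫ f m) (m : M) : bal.ι m ≫ bal.desc f h1 h2 = f m := by
  have h : bal.π M ρ a ≫ bal.desc f h1 h2 = Sigma.desc f := coequalizer.π_desc _ _
  rw [bal.ι, Category.assoc, h, Sigma.ι_desc]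

theorem bal.hom_ext {Z : C} {f f' : bal M ρ a ⟶ Z} (h : ∀ m, bal.ι m ≫ f = bal.ι m ≫ f') :
    f = f' :=
  coequalizer.hom_ext (Sigma.hom_ext _ _ fun m =>
    ((Category.assoc _ _ _).symm.trans (h m)).trans (Category.assoc _ _ _))

/-- Functoriality of the balanced tensor product in `M`. -/
def bal.map {M' : ModuleCat.{w} k} {ρ' : G → (M' ⟶ M')} (φ : M ⟶ M')
    (h : ∀ g, ρ g ≫ φ = φ ≫ ρ' g) : bal M ρ a ⟶ bal M' ρ' a :=
  bal.desc (fun m => bal.ι (φ m)) (fun c m m' => by rw [map_add, map_smul, bal.ι_smul_add])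
    (fun g m => by
      rw [← bal.ι_act]
      exact congrArg bal.ι (ConcreteCategory.congr_hom (h g) m))

theorem bal.ι_map {M' : ModuleCat.{w} k} {ρ' : G → (M' ⟶ M')} (φ : M ⟶ M')
    (h : ∀ g, ρ g ≫ φ = φ ≫ ρ' g) (m : M) :
    (bal.ι m : X ⟶ bal M ρ a) ≫ bal.map φ h = bal.ι (φ m) := bal.ι_desc _ _ _ m

end

variable [MonoidalCategory C] [BraidedCategory C] [HasCountableCoproducts C]

/-- The terms `S(n) ⊗_{Bₙ} V ⊗ ⋯ ⊗ V` of the Artin functor. -/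
def artinTerm (S : BraidedSeq.{t} k) (V : C) (n : ℕ) (i : (S.obj n).ι) : C :=
  bal ((S.obj n).diag.obj i) (fun g => (S.act n g).app i) (braidMap V n)

/-- The map `v ↦ x ⊗ v`. -/
def artinTerm.ι (S : BraidedSeq.{t} k) (V : C) (n : ℕ) (i : (S.obj n).ι) (x : (S.obj n).diag.obj i) :
    tensorPow V n ⟶ artinTerm S V n i := bal.ι x

theorem artinTerm.hom_ext {S : BraidedSeq.{t} k} {V : C} {n : ℕ} {i : (S.obj n).ι} {Z : C}
    {f f' : artinTerm S V n i ⟶ Z}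
    (h : ∀ x, artinTerm.ι S V n i x ≫ f = artinTerm.ι S V n i x ≫ f') : f = f' := bal.hom_ext h

/-- The transition maps of the terms of the Artin functor. -/
def artinTerm.map (S : BraidedSeq.{t} k) (V : C) (n : ℕ) {i i' : (S.obj n).ι} (f : i ⟶ i') :
    artinTerm S V n i ⟶ artinTerm S V n i' :=
  bal.map ((S.obj n).diag.map f) fun g => ((S.act n g).naturality f).symm

theorem artinTerm.ι_map (S : BraidedSeq.{t} k) (V : C) (n : ℕ) {i i' : (S.obj n).ι} (f : i ⟶ i')
    (x : (S.obj n).diag.obj i) :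
    artinTerm.ι S V n i x ≫ artinTerm.map S V n f =
      artinTerm.ι S V n i' ((S.obj n).diag.map f x) := bal.ι_map _ _ _

theorem artinTerm.map_id (S : BraidedSeq.{t} k) (V : C) (n : ℕ) (i : (S.obj n).ι) :
    artinTerm.map S V n (𝟙 i) = 𝟙 _ :=
  artinTerm.hom_ext fun x => by
    rw [artinTerm.ι_map, Category.comp_id, (S.obj n).diag.map_id]; rfl

theorem artinTerm.map_comp (S : BraidedSeq.{t} k) (V : C) (n : ℕ) {i i' i'' : (S.obj n).ι}
    (f : i ⟶ i') (f' : i' ⟶ i'') :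
    artinTerm.map S V n (f ≫ f') = artinTerm.map S V n f ≫ artinTerm.map S V n f' :=
  artinTerm.hom_ext fun x => by
    rw [artinTerm.ι_map, ← Category.assoc, artinTerm.ι_map, artinTerm.ι_map,
      (S.obj n).diag.map_comp]; rfl

theorem artinTerm.ι_sigmaMap (S : BraidedSeq.{t} k) (V : C) {j j' : ∀ n, (S.obj n).ι} (f : j ⟶ j')
    (n : ℕ) (x : (S.obj n).diag.obj (j n)) :
    (artinTerm.ι S V n (j n) x ≫ Sigma.ι (fun n => artinTerm S V n (j n)) n) ≫
        Limits.Sigma.map (fun n => artinTerm.map S V n (f n)) =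
      artinTerm.ι S V n (j' n) ((S.obj n).diag.map (f n) x) ≫
        Sigma.ι (fun n => artinTerm S V n (j' n)) n := by
  rw [Category.assoc, Sigma.ι_map, ← Category.assoc, artinTerm.ι_map]

/-- The Artin functor: the pro-object `⨁ₙ S(n) ⊗_{Bₙ} V ⊗ ⋯ ⊗ V`, indexed by the product of the
indexing categories of the pro-vector spaces `S(n)`. -/
def artin (S : BraidedSeq.{t} k) (V : C) : Pro.{t} C where
  ι := ∀ n, (S.obj n).ι
  diag :=
    { obj := fun j => ∐ fun n => artinTerm S V n (j n)
      map := fun {j j'} f => Limits.Sigma.map fun n => artinTerm.map S V n (f n)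
      map_id := fun j => Sigma.hom_ext _ _ fun n => by
        rw [Sigma.ι_map, Category.comp_id, Pi.id_apply, artinTerm.map_id, Category.id_comp]
      map_comp := fun {j j' j''} f f' => Sigma.hom_ext _ _ fun n => by
        rw [Sigma.ι_map, Sigma.ι_map_assoc, Sigma.ι_map, Pi.comp_apply, artinTerm.map_comp,
          Category.assoc] }

/-- The map from the `n`-th tensor power of `V` to `S[V]` given by `v ↦ x ⊗ v`, for a compatible
family `x` of elements of the inverse system `S(n)`. -/
def artin.eval (S : BraidedSeq.{t} k) (V : C) (n : ℕ) (x : ∀ j, (S.obj n).diag.obj j)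
    (hx : ∀ {j j' : (S.obj n).ι} (f : j ⟶ j'), (S.obj n).diag.map f (x j) = x j') :
    (Pro.const C).obj (tensorPow V n) ⟶ artin S V where
  germ := fun j => Pro.Germ.mk (X := (Pro.const C).obj (tensorPow V n)) ⟨⟨⟩⟩
    (artinTerm.ι S V n (j n) (x (j n)) ≫ Sigma.ι (fun n => artinTerm S V n (j n)) n)
  compat := fun {j j'} f => by
    refine congrArg (Pro.Germ.mk (X := (Pro.const C).obj (tensorPow V n)) ⟨⟨⟩⟩) ?_
    refine (artinTerm.ι_sigmaMap S V f n (x (j n))).trans ?_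
    rw [hx (f n)]
    rfl

end Balanced

section NicEval

variable (k : Type w) [Field k]

/-- The class in `Nic(n)` of an element of the group ring of the braid group. -/
def nicClass {n : ℕ} (α : MonoidAlgebra k (Braid n)) (Q : FinQuot n) : QuotAlg k Q ⧸ worKer k Q :=
  (worKer k Q).mkQ (toQuotAlg k Q α)

theorem nicClass_compat {n : ℕ} (α : MonoidAlgebra k (Braid n)) {P Q : FinQuot n} (f : P ⟶ Q) :
    (((nic k).obj n).diag.map f : ModuleCat.of k (QuotAlg k P ⧸ worKer k P) ⟶
      ModuleCat.of k (QuotAlg k Q ⧸ worKer k Q)) (nicClass k α P) = nicClass k α Q :=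
  congrArg (worKer k Q).mkQ (quotAlgMap_toQuotAlg k (leOfHom f) α)

variable {C : Type u} [Category.{v} C] [Preadditive C] [Linear k C] [HasCoproducts.{w} C]
  [HasCoequalizers C] [MonoidalCategory C] [BraidedCategory C] [HasCountableCoproducts C]

/-- The map from the `n`-th tensor power of `V` to `Nic[V]` given by `v ↦ g ⊗ v`,
for a braid `g`. -/
def nicEval (V : C) {n : ℕ} (g : Braid n) :
    (Pro.const C).obj (tensorPow V n) ⟶ artin (nic k) V :=
  artin.eval (nic k) V n (nicClass k (MonoidAlgebra.single g 1)) fun f => nicClass_compat k _ f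

end NicEval

/-! ### Tensor algebras and Nichols algebras -/

section TensorAlgebra

variable {C : Type u} [Category.{v} C] [MonoidalCategory C] [BraidedCategory C]
  [HasCountableCoproducts C] [∀ X : C, PreservesColimitsOfShape (Discrete ℕ) (tensorLeft X)]

/-- Maps out of `X ⊗ ∐ Y`. -/
def descLeft {Y : ℕ → C} {Z : C} (X : C) (f : ∀ q, X ⊗ Y q ⟶ Z) : X ⊗ ∐ Y ⟶ Z :=
  (PreservesCoproduct.iso (tensorLeft X) Y).hom ≫ Sigma.desc f

theorem ι_descLeft {Y : ℕ → C} {Z : C} (X : C) (f : ∀ q, X ⊗ Y q ⟶ Z) (q : ℕ) :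
    X ◁ Sigma.ι Y q ≫ descLeft X f = f q := by
  have h : (tensorLeft X).map (Sigma.ι Y q) ≫ (PreservesCoproduct.iso (tensorLeft X) Y).hom =
      Sigma.ι (fun q => (tensorLeft X).obj (Y q)) q := by
    rw [← Iso.eq_comp_inv, PreservesCoproduct.inv_hom]
    exact (ι_comp_sigmaComparison (tensorLeft X) Y q).symm
  calc _ = ((tensorLeft X).map (Sigma.ι Y q) ≫ (PreservesCoproduct.iso (tensorLeft X) Y).hom) ≫
        Sigma.desc f := (Category.assoc _ _ _).symm
    _ = _ := by rw [h, Sigma.ι_desc]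

/-- Maps out of `(∐ Y) ⊗ (∐ Y')`. -/
def descTwo {Y Y' : ℕ → C} {Z : C} (f : ∀ p q, Y p ⊗ Y' q ⟶ Z) : (∐ Y) ⊗ (∐ Y') ⟶ Z :=
  descLeft (∐ Y) fun q =>
    (β_ (∐ Y) (Y' q)).hom ≫ descLeft (Y' q) fun p => (β_ (Y p) (Y' q)).inv ≫ f p q

theorem ι_descTwo {Y Y' : ℕ → C} {Z : C} (f : ∀ p q, Y p ⊗ Y' q ⟶ Z) (p q : ℕ) :
    (Sigma.ι Y p ⊗ₘ Sigma.ι Y' q) ≫ descTwo f = f p q := by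
  rw [MonoidalCategory.tensorHom_def, Category.assoc, descTwo, ι_descLeft,
    BraidedCategory.braiding_naturality_left_assoc, ι_descLeft, Iso.hom_inv_id_assoc]

/-- The object underlying the tensor algebra `T(V)` and the tensor coalgebra of `V`. -/
def tensorAlg (V : C) : C := ∐ fun n => tensorPow V n

/-- The inclusion of a tensor power. -/
def tensorAlg.ι (V : C) (n : ℕ) : tensorPow V n ⟶ tensorAlg V := Sigma.ι _ n

/-- The product of the tensor algebra `T(V)`: concatenation. -/
def concatMul (V : C) : tensorAlg V ⊗ tensorAlg V ⟶ tensorAlg V :=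
  descTwo fun p q => (concat V p q).hom ≫ tensorAlg.ι V (p + q)

variable (k : Type w) [Field k] [Preadditive C] [Linear k C]

/-- The product of the tensor coalgebra of `V`: the quantum shuffle product. -/
def shuffleMul (V : C) : tensorAlg V ⊗ tensorAlg V ⟶ tensorAlg V :=
  descTwo fun p q =>
    (concat V p q).hom ≫ algAct k V (p + q) (shuffleSum k (p + q) p) ≫ tensorAlg.ι V (p + q)

/-- The iterated quantum shuffle product `v₁ ⊗ ⋯ ⊗ vₙ ↦ v₁ ⋆ ⋯ ⋆ vₙ` of elements of `V`. -/
def iterShuffle (V : C) : ∀ n, tensorPow V n ⟶ tensorPow V n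
  | 0 => 𝟙 _
  | n + 1 => iterShuffle V n ▷ V ≫ algAct k V (n + 1) (shuffleSum k (n + 1) n)

/-- The map from the tensor algebra (with concatenation) to the tensor coalgebra (with the quantum
shuffle product) which is multiplicative and restricts to the identity of `V`. -/
def tensorAlgToCo (V : C) : tensorAlg V ⟶ tensorAlg V :=
  Limits.Sigma.map fun n => iterShuffle k V n

variable [HasImages C]

/-- The Nichols algebra of `V`: the image of the tensor algebra in the tensor coalgebra. -/
def nichols (V : C) : C := image (tensorAlgToCo k V)

/-- The inclusion of the Nichols algebra in the tensor coalgebra. -/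
def nichols.incl (V : C) : nichols k V ⟶ tensorAlg V := image.ι (tensorAlgToCo k V)

/-- The projection from the tensor algebra to the Nichols algebra. -/
def nichols.proj (V : C) : tensorAlg V ⟶ nichols k V := factorThruImage (tensorAlgToCo k V)

open MonObj in
/-- The algebra structure on the Nichols algebra is the one for which the projection from the tensor
algebra (with concatenation) and the inclusion in the tensor coalgebra (with the quantum shuffle
product) are algebra maps. -/
structure IsNicholsAlgebra (V : C) [MonObj (nichols k V)] : Prop where
  one_incl : η[nichols k V] ≫ nichols.incl k V = tensorAlg.ι V 0
  mul_incl : μ[nichols k V] ≫ nichols.incl k V =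
    (nichols.incl k V ⊗ₘ nichols.incl k V) ≫ shuffleMul k V
  one_proj : tensorAlg.ι V 0 ≫ nichols.proj k V = η[nichols k V]
  mul_proj : concatMul V ≫ nichols.proj k V =
    (nichols.proj k V ⊗ₘ nichols.proj k V) ≫ μ[nichols k V]

end TensorAlgebra

section NicAlgebra

variable {C : Type u} [Category.{v} C] [MonoidalCategory C]

/-- Constant pro-objects on algebras are algebras. -/
instance constMonObj (A : C) [MonObj A] : MonObj ((Pro.const.{t} C).obj A) :=
  Functor.monObjObj (F := Pro.const.{t} C) A

variable (k : Type w) [Field k] [Preadditive C] [Linear k C] [HasCoproducts.{w} C]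
  [HasCoequalizers C] [BraidedCategory C] [HasCountableCoproducts C]

open MonObj in
/-- The algebra structure on `Nic[V]` induced by the left module structure of `Nic` over the
profinite braided associative operad: the unit is given by the trivial braid on no strands, and
`(g ⊗ v) (h ⊗ w) = (g | h) ⊗ (v ⊗ w)`, where `g | h`, the juxtaposition of the braids `g` and
`h`, is the operadic composite of the trivial braid on two strands with `g` and `h`. -/
structure IsNicAlgebra (V : C) [MonObj (artin (nic k) V)] : Prop where
  one : η[artin (nic k) V] = nicEval k V (1 : Braid 0)
  mul : ∀ {p q : ℕ} (g : Braid p) (h : Braid q),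
    (nicEval k V g ⊗ₘ nicEval k V h) ≫ μ[artin (nic k) V] =
      Functor.LaxMonoidal.μ (Pro.const C) _ _ ≫ (Pro.const C).map (concat V p q).hom ≫
        nicEval k V (juxt g h)

end NicAlgebra

end BraidedNichols

end

/-!
Write `S n` for the quantum symmetrizer. Every permutation of `N` points is uniquely the product of
one which is increasing on a given block of `n` points and one which permutes the block, and lengths
add up. Hence `S N` is a left multiple of the copy of `S n` on any block of strands. A braid `γ` of
the outer strands can be pulled through the copy of a braid in the cabled strand, which moves that
copy from one block to another. So `S N * (γ ∘ᵢ x)` is a left multiple of the copy of `S n * x`,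
and the kernels of the symmetrizers form a left ideal.

In characteristic `0` the group ring of a finite quotient embeds as a left ideal in that of a larger
one, through right multiplication by the idempotent which averages the kernel of the transition map.
This lifts the kernel of `S n` along transition maps: the ideal is strict.

The map from `T(V)` to `T^{co}(V)` is the action of `S n` in degree `n`. If `B_n` acts on `V^{⊗ n}`
through a finite quotient, the group ring of the quotient is semisimple, hence von Neumann regular,
and contains `t` with `S n * t * S n = S n`. Then `1 - t * S n` generates the kernel of `S n`, so
`x ⊗ v ↦ x v` identifies `Nic[V]` in degree `n` with the quotient of `V^{⊗ n}` by the image of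
`1 - t * S n`, that is, with the image of `S n`. Strictness makes the terms of `Nic[V]` over finer
quotients agree with this one.
-/

namespace BraidedNichols

noncomputable section

section Crossings

variable {G : Type*} [Group G] {s : ℕ → G} {N : ℕ}

theorem IsBraiding.inv (hs : IsBraiding N s) : IsBraiding N s⁻¹ where
  braid i hi := by
    simpa only [Pi.inv_apply, mul_inv_rev, mul_assoc] using congrArg (·⁻¹) (hs.braid i hi)
  comm i j hij hj := Commute.inv_inv (hs.comm i j hij hj)

theorem ascProd_succ' (s : ℕ → G) (a : ℕ) : ∀ l, ascProd s a (l + 1) = s a * ascProd s (a + 1) l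
  | 0 => by simp only [ascProd, one_mul, mul_one, Nat.add_zero]
  | l + 1 => by rw [ascProd, ascProd_succ' s a l, ascProd, mul_assoc, Nat.add_right_comm a 1 l,
      Nat.add_assoc a l 1]

theorem inv_ascProd_inv (s : ℕ → G) (a : ℕ) : ∀ l, (ascProd s⁻¹ a l)⁻¹ = descProd s a l
  | 0 => inv_one
  | l + 1 => by rw [ascProd, mul_inv_rev, Pi.inv_apply, inv_inv, inv_ascProd_inv s a l, descProd]

theorem prod_map_range' (s : ℕ → G) (a : ℕ) : ∀ l,
    ((List.range' a l).map s).prod = ascProd s a l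
  | 0 => rfl
  | l + 1 => by
    rw [List.range'_concat, List.map_append, List.prod_append, prod_map_range' s a l, Nat.one_mul,
      List.map_singleton, List.prod_singleton, ascProd]

theorem IsBraiding.semiconjBy_ascProd (hs : IsBraiding N s) {a j : ℕ} (haj : a ≤ j) :
    ∀ {l : ℕ}, j + 2 ≤ a + l → a + l < N → SemiconjBy (ascProd s a l) (s j) (s (j + 1))
  | 0, h, _ => by omega
  | l + 1, h, hl => by
    rcases Nat.lt_or_ge (a + l) (j + 2) with hj | hj
    · obtain ⟨b, rfl⟩ := Nat.exists_eq_add_of_le haj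
      obtain rfl : l = b + 1 := by omega
      have braid : SemiconjBy (s (a + b) * s (a + b + 1)) (s (a + b)) (s (a + b + 1)) :=
        (hs.braid (a + b) (by omega)).trans (mul_assoc _ _ _)
      have comm : SemiconjBy (ascProd s a b) (s (a + b + 1)) (s (a + b + 1)) :=
        (hs.comm_asc (Or.inr ⟨by omega, by omega⟩)).symm
      rw [ascProd, ascProd, mul_assoc]
      exact comm.mul_left braid
    · have comm : SemiconjBy (s (a + l)) (s j) (s j) :=
        (hs.comm j (a + l) (by omega) (by omega)).symm
      exact (hs.semiconjBy_ascProd haj hj (by omega)).mul_left comm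

theorem IsBraiding.semiconjBy_descProd (hs : IsBraiding N s) {a j l : ℕ} (haj : a ≤ j)
    (hj : j + 2 ≤ a + l) (hl : a + l < N) : SemiconjBy (descProd s a l) (s (j + 1)) (s j) := by
  rw [← inv_ascProd_inv]
  exact (SemiconjBy.inv_right_iff.1 (hs.inv.semiconjBy_ascProd haj hj hl)).inv_symm_left

end Crossings

theorem shift_gen {n N : ℕ} (a : ℕ) (h : a + n ≤ N) {i : ℕ} (hi : i + 1 < n) :
    shift a h (braidGen n i) = braidGen N (a + i) := by
  rw [shift, braidLift_gen _ _ _ hi]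

theorem shift_zero_prod_map_gen {n N : ℕ} (h : 0 + n ≤ N) {w : List ℕ} (hw : ∀ i ∈ w, i + 1 < n) :
    shift 0 h (w.map (braidGen n)).prod = (w.map (braidGen N)).prod := by
  rw [map_list_prod, List.map_map]
  refine congrArg List.prod (List.map_congr_left fun i hi => ?_)
  rw [Function.comp_apply, shift_gen _ _ (hw i hi), Nat.zero_add]

/-! ### The Matsumoto section -/

/-- The value `i` is taken before the value `i + 1`: left multiplication of `τ` by the adjacent
transposition of `i` and `i + 1` increases the length. -/
def IsAscent {n : ℕ} (τ : Equiv.Perm (Fin n)) (i : ℕ) : Prop :=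
  ∀ x y : Fin n, (τ x : ℕ) = i → (τ y : ℕ) = i + 1 → x < y

theorem adjSwap_mul_self (n i : ℕ) : adjSwap n i * adjSwap n i = 1 := by
  simpa only [adjSwap_inv] using inv_mul_cancel (adjSwap n i)

theorem adjSwap_mul_apply_val {n i : ℕ} (hi : i + 1 < n) (τ : Equiv.Perm (Fin n)) (x : Fin n) :
    ((adjSwap n i * τ) x : ℕ) =
      if (τ x : ℕ) = i then i + 1 else if (τ x : ℕ) = i + 1 then i else τ x :=
  adjSwap_val hi (τ x)

section RestrictLast

variable {n i : ℕ} {τ : Equiv.Perm (Fin (n + 1))}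

theorem castSucc_val_eq_restrictLast (τ : Equiv.Perm (Fin (n + 1))) (x : Fin n) :
    (τ x.castSucc : ℕ) = if (restrictLast τ x : ℕ) < τ (Fin.last n) then (restrictLast τ x : ℕ)
      else restrictLast τ x + 1 := by
  rw [← restrictLast_spec, succAbove_val]

theorem restrictLast_eq_of_castSucc_val {σ : Equiv.Perm (Fin n)}
    (h : ∀ x, (τ x.castSucc : ℕ) = if (σ x : ℕ) < τ (Fin.last n) then (σ x : ℕ) else σ x + 1) :
    restrictLast τ = σ := by
  ext x
  refine congrArg Fin.val (Fin.succAbove_right_injective (p := τ (Fin.last n)) (Fin.ext ?_))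
  rw [restrictLast_spec, succAbove_val, h]

theorem restrictLast_adjSwap_mul_of_eq (hi : i < n) (hτ : (τ (Fin.last n) : ℕ) = i + 1) :
    restrictLast (adjSwap (n + 1) i * τ) = restrictLast τ := by
  refine restrictLast_eq_of_castSucc_val fun x => ?_
  simp only [adjSwap_mul_apply_val (Nat.succ_lt_succ hi), castSucc_val_eq_restrictLast]
  split_ifs <;> omega

theorem restrictLast_adjSwap_mul_of_lt (hτ : i + 1 < (τ (Fin.last n) : ℕ)) :
    restrictLast (adjSwap (n + 1) i * τ) = adjSwap n i * restrictLast τ := by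
  have := (τ (Fin.last n)).2
  refine restrictLast_eq_of_castSucc_val fun x => ?_
  rw [adjSwap_mul_apply_val (by omega), adjSwap_mul_apply_val (by omega),
    adjSwap_mul_apply_val (by omega), castSucc_val_eq_restrictLast]
  split_ifs <;> omega

theorem restrictLast_adjSwap_succ_mul_of_le (hi : i + 1 < n) (hτ : (τ (Fin.last n) : ℕ) ≤ i) :
    restrictLast (adjSwap (n + 1) (i + 1) * τ) = adjSwap n i * restrictLast τ := by
  refine restrictLast_eq_of_castSucc_val fun x => ?_
  rw [adjSwap_mul_apply_val (by omega), adjSwap_mul_apply_val (by omega),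
    adjSwap_mul_apply_val (by omega), castSucc_val_eq_restrictLast]
  split_ifs <;> omega

theorem IsAscent.apply_last_ne (h : IsAscent τ i) (hi : i < n) : (τ (Fin.last n) : ℕ) ≠ i :=
  fun hτ => (Fin.le_last _).not_gt
    (h (Fin.last n) (τ⁻¹ ⟨i + 1, Nat.succ_lt_succ hi⟩) hτ (by simp))

theorem IsAscent.restrictLast_cases (h : IsAscent τ i) (hi : i < n) :
    (τ (Fin.last n) : ℕ) = i + 1 ∨
      i + 1 < (τ (Fin.last n) : ℕ) ∧ IsAscent (restrictLast τ) i ∨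
      ∃ j, i = j + 1 ∧ (τ (Fin.last n) : ℕ) ≤ j ∧ IsAscent (restrictLast τ) j := by
  have hne := h.apply_last_ne hi
  have ascent_of {x y : Fin n} (hx : (τ x.castSucc : ℕ) = i) (hy : (τ y.castSucc : ℕ) = i + 1) :
      x < y := Fin.castSucc_lt_castSucc_iff.1 (h _ _ hx hy)
  rcases lt_trichotomy (τ (Fin.last n) : ℕ) (i + 1) with hlt | heq | hgt
  · obtain ⟨j, rfl⟩ : ∃ j, i = j + 1 := ⟨i - 1, by omega⟩
    refine .inr (.inr ⟨j, rfl, by omega, fun x y hx hy => ascent_of ?_ ?_⟩) <;>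
      rw [castSucc_val_eq_restrictLast, if_neg (by omega)] <;> omega
  · exact .inl heq
  · refine .inr (.inl ⟨hgt, fun x y hx hy => ascent_of ?_ ?_⟩) <;>
      rw [castSucc_val_eq_restrictLast, if_pos (by omega)] <;> omega

end RestrictLast

theorem matsumotoWord_length_succ {n : ℕ} (τ : Equiv.Perm (Fin (n + 1))) :
    (matsumotoWord (n + 1) τ).length =
      n - τ (Fin.last n) + (matsumotoWord n (restrictLast τ)).length := by
  rw [matsumotoWord, List.length_append, List.length_range']

theorem IsAscent.length_adjSwap_mul : ∀ {n : ℕ} {τ : Equiv.Perm (Fin n)} {i : ℕ},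
    IsAscent τ i → i + 1 < n →
      (matsumotoWord n (adjSwap n i * τ)).length = (matsumotoWord n τ).length + 1
  | 0, _, _, _, hi => by omega
  | n + 1, τ, i, h, hi => by
    rw [matsumotoWord_length_succ, matsumotoWord_length_succ, adjSwap_mul_apply_val hi]
    have hlast := (τ (Fin.last n)).2
    rcases h.restrictLast_cases (by omega) with hτ | ⟨hτ, hr⟩ | ⟨j, rfl, hτ, hr⟩
    · rw [restrictLast_adjSwap_mul_of_eq (by omega) hτ]
      split_ifs <;> omega
    · rw [restrictLast_adjSwap_mul_of_lt hτ, hr.length_adjSwap_mul (by omega)]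
      split_ifs <;> omega
    · rw [restrictLast_adjSwap_succ_mul_of_le (by omega) hτ, hr.length_adjSwap_mul (by omega)]
      split_ifs <;> omega

theorem matsumoto_one (n : ℕ) : matsumoto n 1 = 1 := by
  rw [matsumoto, matsumotoWord_one, List.map_nil, List.prod_nil]

theorem matsumoto_succ {n : ℕ} (τ : Equiv.Perm (Fin (n + 1))) :
    matsumoto (n + 1) τ = ascProd (braidGen (n + 1)) (τ (Fin.last n)) (n - τ (Fin.last n)) *
      shift 0 (by omega) (matsumoto n (restrictLast τ)) := by
  rw [matsumoto, matsumotoWord, List.map_append, List.prod_append, prod_map_range', matsumoto,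
    shift_zero_prod_map_gen _ (matsumotoWord_lt n _)]

theorem IsAscent.matsumoto_adjSwap_mul : ∀ {n : ℕ} {τ : Equiv.Perm (Fin n)} {i : ℕ},
    IsAscent τ i → i + 1 < n → matsumoto n (adjSwap n i * τ) = braidGen n i * matsumoto n τ
  | 0, _, _, _, hi => by omega
  | n + 1, τ, i, h, hi => by
    have hlast := (τ (Fin.last n)).2
    have hs := isBraiding_gen (n + 1)
    rw [matsumoto_succ, matsumoto_succ, adjSwap_mul_apply_val hi]
    rcases h.restrictLast_cases (by omega) with hτ | ⟨hτ, hr⟩ | ⟨j, rfl, hτ, hr⟩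
    · rw [restrictLast_adjSwap_mul_of_eq (by omega) hτ, if_neg (by omega), if_pos hτ, hτ,
        show n - i = n - (i + 1) + 1 by omega, ascProd_succ', mul_assoc]
    · have comm := hs.comm_asc (b := i) (n := n - τ (Fin.last n)) (.inl ⟨hτ, by omega⟩)
      rw [restrictLast_adjSwap_mul_of_lt hτ, if_neg (by omega), if_neg (by omega),
        hr.matsumoto_adjSwap_mul (by omega), map_mul, shift_gen _ _ (by omega), Nat.zero_add,
        ← mul_assoc, ← comm.eq, mul_assoc]
    · have semiconj := hs.semiconjBy_ascProd hτ (l := n - τ (Fin.last n)) (by omega) (by omega)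
      rw [restrictLast_adjSwap_succ_mul_of_le (by omega) hτ, if_neg (by omega), if_neg (by omega),
        hr.matsumoto_adjSwap_mul (by omega), map_mul, shift_gen _ _ (by omega), Nat.zero_add,
        ← mul_assoc, semiconj.eq, mul_assoc]

theorem eq_one_of_strictMono {n : ℕ} {τ : Equiv.Perm (Fin n)} (h : StrictMono τ) : τ = 1 :=
  Equiv.ext fun x => DFunLike.congr_fun
    (Subsingleton.elim (h.orderIsoOfSurjective _ τ.surjective) (OrderIso.refl _)) x

theorem exists_isAscent_adjSwap_mul {n : ℕ} {τ : Equiv.Perm (Fin n)} (h : τ ≠ 1) :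
    ∃ i, i + 1 < n ∧ IsAscent (adjSwap n i * τ) i := by
  by_contra! hc
  refine h (inv_eq_one.1 (eq_one_of_strictMono ?_))
  cases n with
  | zero => exact fun x => x.elim0
  | succ n =>
    refine Fin.strictMono_iff_lt_succ.2 fun i => ?_
    by_contra! hi
    refine hc i (by omega) fun x y hx hy => ?_
    rw [adjSwap_mul_apply_val (by omega)] at hx hy
    obtain rfl : x = τ⁻¹ i.succ := Equiv.Perm.eq_inv_iff_eq.2 <| Fin.ext <| by
      rw [Fin.val_succ]; split_ifs at hx <;> omega
    obtain rfl : y = τ⁻¹ i.castSucc := Equiv.Perm.eq_inv_iff_eq.2 <| Fin.ext <| by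
      rw [Fin.val_castSucc]; split_ifs at hy <;> omega
    exact hi.lt_of_ne (τ⁻¹.injective.ne Fin.castSucc_lt_succ.ne')

theorem perm_ascent_induction {n : ℕ} {P : Equiv.Perm (Fin n) → Prop} (one : P 1)
    (adjSwap_mul : ∀ τ i, i + 1 < n → IsAscent τ i → P τ → P (adjSwap n i * τ))
    (τ : Equiv.Perm (Fin n)) : P τ := by
  induction hl : (matsumotoWord n τ).length using Nat.strong_induction_on generalizing τ with
  | _ l ih =>
    by_cases h : τ = 1
    · rwa [h]
    · obtain ⟨i, hi, ha⟩ := exists_isAscent_adjSwap_mul h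
      have cancel : adjSwap n i * (adjSwap n i * τ) = τ := by
        rw [← mul_assoc, adjSwap_mul_self, one_mul]
      have hlen := ha.length_adjSwap_mul hi
      rw [cancel] at hlen
      rw [← cancel]
      exact adjSwap_mul _ _ hi ha (ih _ (by omega) _ rfl)

-- The hypothesis says that the lengths of `τ` and `w` add up.
theorem matsumoto_mul {n : ℕ} (τ w : Equiv.Perm (Fin n))
    (h : ∀ u v, w u < w v → v < u → τ (w u) < τ (w v)) :
    matsumoto n (τ * w) = matsumoto n τ * matsumoto n w := by
  induction τ using perm_ascent_induction with
  | one => rw [matsumoto_one, one_mul, one_mul]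
  | adjSwap_mul τ i hi ha ih =>
    simp only [Fin.lt_def (a := (adjSwap n i * τ) _), adjSwap_mul_apply_val hi] at h
    have hτ : ∀ u v, w u < w v → v < u → τ (w u) < τ (w v) := fun u v huv hvu => by
      have lt := h u v huv hvu
      by_contra! hle
      rw [Fin.le_def] at hle
      refine huv.not_gt (ha (w v) (w u) ?_ ?_) <;> (split_ifs at lt <;> omega)
    have hτw : IsAscent (τ * w) i := fun x y hx hy => by
      rw [Equiv.Perm.mul_apply] at hx hy
      have hxy := ha _ _ hx hy
      by_contra! hyx
      have lt := h x y hxy (hyx.lt_of_ne fun e => hxy.ne (congrArg w e).symm)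
      split_ifs at lt <;> omega
    rw [mul_assoc, hτw.matsumoto_adjSwap_mul hi, ih hτ, ← mul_assoc, ha.matsumoto_adjSwap_mul hi]

/-! ### Factorizations of the quantum symmetrizer -/

section Block

variable {n N : ℕ} (a : ℕ) (h : a + n ≤ N)

/-- The `i`-th point of the block `a, …, a + n - 1` of `Fin N`. -/
def blockPos (i : Fin n) : Fin N := ⟨a + i, by omega⟩

theorem blockPos_val (i : Fin n) : (blockPos a h i : ℕ) = a + i := rfl

theorem blockPos_strictMono : StrictMono (blockPos a h) :=
  fun _ _ hij => Nat.add_lt_add_left hij a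

theorem exists_blockPos_eq {x : Fin N} (h₁ : a ≤ x) (h₂ : (x : ℕ) < a + n) :
    ∃ i, blockPos a h i = x :=
  ⟨⟨x - a, by omega⟩, Fin.ext (Nat.add_sub_cancel' h₁)⟩

theorem notMem_block_or_exists_blockPos_eq (x : Fin N) :
    ((x : ℕ) < a ∨ a + n ≤ x) ∨ ∃ i, blockPos a h i = x := by
  rcases Nat.lt_or_ge x a with h₁ | h₁
  · exact .inl (.inl h₁)
  rcases Nat.lt_or_ge x (a + n) with h₂ | h₂
  · exact .inr (exists_blockPos_eq a h h₁ h₂)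
  · exact .inl (.inr h₂)

/-- The permutation of `Fin N` acting as a permutation of `Fin n` on the block `a, …, a + n - 1`
and as the identity elsewhere. -/
def blockPerm : Equiv.Perm (Fin n) →* Equiv.Perm (Fin N) :=
  Equiv.Perm.extendDomainHom
    { toFun := fun i => (⟨blockPos a h i, by simp only [blockPos_val]; omega⟩ :
        {x : Fin N // a ≤ x ∧ (x : ℕ) < a + n})
      invFun := fun x => ⟨x.1 - a, by have := x.2; omega⟩
      left_inv := fun i => Fin.ext (Nat.add_sub_cancel_left ..)
      right_inv := fun x => Subtype.ext (Fin.ext (Nat.add_sub_cancel' x.2.1)) }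

theorem blockPerm_blockPos (w : Equiv.Perm (Fin n)) (i : Fin n) :
    blockPerm a h w (blockPos a h i) = blockPos a h (w i) :=
  Equiv.Perm.extendDomain_apply_image w _ i

theorem blockPerm_of_notMem (w : Equiv.Perm (Fin n)) {x : Fin N}
    (hx : (x : ℕ) < a ∨ a + n ≤ x) : blockPerm a h w x = x :=
  Equiv.Perm.extendDomain_apply_not_subtype w _ (by omega)

theorem blockPerm_adjSwap {i : ℕ} (hi : i + 1 < n) :
    blockPerm a h (adjSwap n i) = adjSwap N (a + i) := by
  ext x
  rw [adjSwap_val (by omega)]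
  rcases notMem_block_or_exists_blockPos_eq a h x with hx | ⟨j, rfl⟩
  · rw [blockPerm_of_notMem a h _ hx]
    split_ifs <;> omega
  · rw [blockPerm_blockPos, blockPos_val, blockPos_val, adjSwap_val hi]
    split_ifs <;> omega

variable {a h} in
theorem IsAscent.blockPerm {τ : Equiv.Perm (Fin n)} {i : ℕ} (hτ : IsAscent τ i)
    (hi : i + 1 < n) : IsAscent (blockPerm a h τ) (a + i) := fun x y hx hy => by
  rcases notMem_block_or_exists_blockPos_eq a h x with hx' | ⟨x, rfl⟩
  · rw [blockPerm_of_notMem a h _ hx'] at hx; omega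
  rcases notMem_block_or_exists_blockPos_eq a h y with hy' | ⟨y, rfl⟩
  · rw [blockPerm_of_notMem a h _ hy'] at hy; omega
  rw [blockPerm_blockPos, blockPos_val] at hx hy
  exact blockPos_strictMono a h (hτ x y (by omega) (by omega))

theorem matsumoto_blockPerm (w : Equiv.Perm (Fin n)) :
    matsumoto N (blockPerm a h w) = shift a h (matsumoto n w) := by
  induction w using perm_ascent_induction with
  | one => rw [map_one, matsumoto_one, matsumoto_one, map_one]
  | adjSwap_mul τ i hi hτ ih =>
    rw [map_mul, blockPerm_adjSwap a h hi, (hτ.blockPerm hi).matsumoto_adjSwap_mul (by omega), ih,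
      hτ.matsumoto_adjSwap_mul hi, map_mul, shift_gen _ _ hi]

/-- The permutation `τ` is increasing on the block `a, …, a + n - 1`: it is the shortest element
of its coset `τ * Set.range (blockPerm a h)`. -/
def IsIncreasingOnBlock (τ : Equiv.Perm (Fin N)) : Prop := StrictMono (τ ∘ blockPos a h)

variable {a h} in
theorem IsIncreasingOnBlock.matsumoto_mul_blockPerm {τ : Equiv.Perm (Fin N)}
    (hτ : IsIncreasingOnBlock a h τ) (w : Equiv.Perm (Fin n)) :
    matsumoto N (τ * blockPerm a h w) = matsumoto N τ * shift a h (matsumoto n w) := by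
  rw [← matsumoto_blockPerm]
  refine matsumoto_mul _ _ fun u v huv hvu => ?_
  rcases notMem_block_or_exists_blockPos_eq a h u with hu | ⟨u, rfl⟩ <;>
    rcases notMem_block_or_exists_blockPos_eq a h v with hv | ⟨v, rfl⟩
  · rw [blockPerm_of_notMem a h _ hu, blockPerm_of_notMem a h _ hv] at huv
    exact absurd hvu huv.not_gt
  · rw [blockPerm_of_notMem a h _ hu, blockPerm_blockPos] at huv
    simp only [Fin.lt_def, blockPos_val] at huv hvu
    omega
  · rw [blockPerm_of_notMem a h _ hv, blockPerm_blockPos] at huv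
    simp only [Fin.lt_def, blockPos_val] at huv hvu
    omega
  · rw [blockPerm_blockPos, blockPerm_blockPos] at huv ⊢
    exact hτ ((blockPos_strictMono a h).lt_iff_lt.1 huv)

theorem mul_blockPerm_comp_blockPos (τ : Equiv.Perm (Fin N)) (w : Equiv.Perm (Fin n)) :
    ⇑(τ * blockPerm a h w) ∘ blockPos a h = (τ ∘ blockPos a h) ∘ w :=
  funext fun i => congrArg τ (blockPerm_blockPos a h w i)

/-- The permutation sorting the values of `τ` on the block `a, …, a + n - 1`. -/
def blockSort (τ : Equiv.Perm (Fin N)) : Equiv.Perm (Fin n) :=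
  Tuple.sort (τ ∘ blockPos a h)

theorem isIncreasingOnBlock_mul_blockSort (τ : Equiv.Perm (Fin N)) :
    IsIncreasingOnBlock a h (τ * blockPerm a h (blockSort a h τ)) := by
  rw [IsIncreasingOnBlock, mul_blockPerm_comp_blockPos]
  exact (Tuple.monotone_sort _).strictMono_of_injective
    ((τ.injective.comp (blockPos_strictMono a h).injective).comp (Equiv.injective _))

variable {a h} in
theorem IsIncreasingOnBlock.blockSort_mul_blockPerm {τ : Equiv.Perm (Fin N)}
    (hτ : IsIncreasingOnBlock a h τ) (w : Equiv.Perm (Fin n)) :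
    blockSort a h (τ * blockPerm a h w) = w⁻¹ := by
  have sorted := isIncreasingOnBlock_mul_blockSort a h (τ * blockPerm a h w)
  rw [mul_assoc, ← map_mul, IsIncreasingOnBlock, mul_blockPerm_comp_blockPos] at sorted
  exact eq_inv_of_mul_eq_one_right (eq_one_of_strictMono fun i j hij => hτ.lt_iff_lt.1 (sorted hij))

end Block

theorem isShuffle_iff {p q : ℕ} (τ : Equiv.Perm (Fin (p + q))) :
    IsShuffle p τ ↔ IsIncreasingOnBlock (n := p) 0 (by omega) τ ∧
      IsIncreasingOnBlock (n := q) p le_rfl τ := by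
  constructor
  · exact fun h => ⟨fun i j hij => h _ _ (blockPos_strictMono _ _ hij)
        (.inl (by rw [blockPos_val]; omega)),
      fun i j hij => h _ _ (blockPos_strictMono _ _ hij) (.inr (Nat.le_add_right _ _))⟩
  · have left_le : 0 + p ≤ p + q := by omega
    rintro ⟨inc_left, inc_right⟩ x y hxy hblock
    rcases hblock with hy | hx
    · obtain ⟨i, rfl⟩ := exists_blockPos_eq 0 left_le (Nat.zero_le x) (by omega)
      obtain ⟨j, rfl⟩ := exists_blockPos_eq 0 left_le (Nat.zero_le y) (by omega)
      exact inc_left ((blockPos_strictMono _ _).lt_iff_lt.1 hxy)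
    · obtain ⟨i, rfl⟩ := exists_blockPos_eq (n := q) p le_rfl hx x.2
      obtain ⟨j, rfl⟩ := exists_blockPos_eq (n := q) p le_rfl (by omega) y.2
      exact inc_right ((blockPos_strictMono _ _).lt_iff_lt.1 hxy)

section Symmetrizers

variable (k : Type w) [Field k]

/-- The homomorphism of group rings induced by `shift a h`. -/
def shiftAlg {n N : ℕ} (a : ℕ) (h : a + n ≤ N) :
    MonoidAlgebra k (Braid n) →ₐ[k] MonoidAlgebra k (Braid N) :=
  MonoidAlgebra.mapDomainAlgHom k k (shift a h)

theorem shiftAlg_single {n N : ℕ} (a : ℕ) (h : a + n ≤ N) (g : Braid n) (c : k) :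
    shiftAlg k a h (MonoidAlgebra.single g c) = MonoidAlgebra.single (shift a h g) c := by
  exact MonoidAlgebra.mapDomain_single

open Classical in
theorem sum_matsumoto_eq_mul_shiftAlg {n N : ℕ} (a : ℕ) (h : a + n ≤ N)
    (P : Equiv.Perm (Fin N) → Prop) (hP : ∀ τ w, P τ → P (τ * blockPerm a h w)) :
    ∑ τ with P τ, MonoidAlgebra.single (matsumoto N τ) (1 : k) =
      (∑ τ with P τ ∧ IsIncreasingOnBlock a h τ, MonoidAlgebra.single (matsumoto N τ) (1 : k)) *
        shiftAlg k a h (quantumSymmetrizer k n) := by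
  rw [quantumSymmetrizer, map_sum, Finset.sum_mul_sum, ← Finset.sum_product']
  refine (Finset.sum_nbij' (fun x => x.1 * blockPerm a h x.2)
    (fun τ => (τ * blockPerm a h (blockSort a h τ), (blockSort a h τ)⁻¹))
    ?_ ?_ ?_ ?_ ?_).symm <;>
    simp only [Finset.mem_product, Finset.mem_filter, Finset.mem_univ, true_and, and_true,
      Prod.forall]
  · exact fun τ w hτ => hP _ _ hτ.1
  · exact fun τ hτ => ⟨hP _ _ hτ, isIncreasingOnBlock_mul_blockSort a h τ⟩
  · intro τ w hτ
    rw [hτ.2.blockSort_mul_blockPerm, inv_inv, mul_assoc, ← map_mul, mul_inv_cancel, map_one,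
      mul_one]
  · intro τ _
    rw [mul_assoc, ← map_mul, mul_inv_cancel, map_one, mul_one]
  · intro τ w hτ
    rw [shiftAlg_single, MonoidAlgebra.single_mul_single, mul_one, hτ.2.matsumoto_mul_blockPerm]

open Classical in
theorem quantumSymmetrizer_eq_sum_mul {n N : ℕ} (a : ℕ) (h : a + n ≤ N) :
    quantumSymmetrizer k N =
      (∑ τ with IsIncreasingOnBlock a h τ, MonoidAlgebra.single (matsumoto N τ) (1 : k)) *
        shiftAlg k a h (quantumSymmetrizer k n) := by
  simpa only [Finset.filter_true, true_and, quantumSymmetrizer] using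
    sum_matsumoto_eq_mul_shiftAlg k a h (fun _ => True) fun _ _ => id

theorem quantumSymmetrizer_add (p q : ℕ) :
    quantumSymmetrizer k (p + q) =
      shuffleSum k (p + q) p * shiftAlg k p le_rfl (quantumSymmetrizer k q) *
        shiftAlg k 0 (by omega) (quantumSymmetrizer k p) := by
  classical
  rw [quantumSymmetrizer_eq_sum_mul k (n := p) 0 (by omega)]
  simp only [shuffleSum, isShuffle_iff]
  congr 1
  refine sum_matsumoto_eq_mul_shiftAlg k p le_rfl _ fun τ w hτ i j hij => ?_
  rw [Function.comp_apply, Function.comp_apply, Equiv.Perm.mul_apply, Equiv.Perm.mul_apply,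
    blockPerm_of_notMem _ _ _ (.inl (by rw [blockPos_val]; omega)),
    blockPerm_of_notMem _ _ _ (.inl (by rw [blockPos_val]; omega))]
  exact hτ hij

theorem quantumSymmetrizer_one : quantumSymmetrizer k 1 = 1 := by
  rw [quantumSymmetrizer, Fintype.sum_unique, Subsingleton.elim default 1, matsumoto_one,
    MonoidAlgebra.one_def]

theorem quantumSymmetrizer_succ (n : ℕ) :
    quantumSymmetrizer k (n + 1) =
      shuffleSum k (n + 1) n * shiftAlg k 0 (by omega) (quantumSymmetrizer k n) := by
  rw [quantumSymmetrizer_add, quantumSymmetrizer_one, map_one, mul_one]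

end Symmetrizers
/-! ### Naturality of cabling -/

theorem semiconjBy_cable_gen_shift_gen {m n N : ℕ} (h : m + n = N + 1) (i : Fin m) {j : ℕ}
    (hj : j + 1 < m) {b : ℕ} (hb : b + 1 < n) :
    SemiconjBy (cable h i (braidGen m j)) (braidGen N (i + b))
      (braidGen N (adjSwap m j i + b)) := by
  have hs := isBraiding_gen N
  have hi := i.2
  rw [cable_gen _ _ _ hj, adjSwap_val hj]
  generalize (i : ℕ) = x at hi
  split_ifs with hxj hxj'
  · rw [cableGen_succ rfl, hxj, Nat.add_right_comm]
    exact hs.semiconjBy_ascProd (by omega) (by omega) (by omega)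
  · rw [cableGen_eq rfl, hxj', Nat.add_right_comm]
    exact hs.semiconjBy_descProd (by omega) (by omega) (by omega)
  · rcases Nat.lt_or_gt_of_ne hxj with lt | gt
    · rw [cableGen_lt lt]
      exact (hs.comm _ _ (by omega) (by omega)).symm
    · rw [cableGen_gt (by omega)]
      exact hs.comm _ _ (by omega) (by omega)

theorem braid_induction {n : ℕ} {P : Braid n → Prop} (gen : ∀ j, j + 1 < n → P (braidGen n j))
    (one : P 1) (mul : ∀ x y, P x → P y → P (x * y)) (inv : ∀ x, P x → P x⁻¹) (x : Braid n) :
    P x := by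
  have hx : x ∈ Subgroup.closure (Set.range (PresentedGroup.of (rels := braidRels n))) :=
    PresentedGroup.closure_range_of (braidRels n) ▸ Subgroup.mem_top x
  induction hx using Subgroup.closure_induction with
  | mem x hx =>
    obtain ⟨⟨j, hj⟩, rfl⟩ := hx
    simpa only [braidGen, dif_pos hj] using gen j (by omega)
  | one => exact one
  | mul x y _ _ hx hy => exact mul x y hx hy
  | inv x _ hx => exact inv x hx

theorem cable_inv {m n N : ℕ} (h : m + n = N + 1) (i : Fin m) (γ : Braid m) :
    cable h i γ⁻¹ = (cable h (toPerm m γ⁻¹ i) γ)⁻¹ :=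
  eq_inv_of_mul_eq_one_right (by rw [← cable_mul, mul_inv_cancel, cable_one'])

theorem semiconjBy_cable_shift {m n N : ℕ} (h : m + n = N + 1) (γ : Braid m) (i : Fin m)
    (x : Braid n) :
    SemiconjBy (cable h i γ) (shift (N := N) i (by omega) x)
      (shift (N := N) (toPerm m γ i) (by omega) x) := by
  induction γ using braid_induction generalizing i with
  | gen j hj =>
    induction x using braid_induction with
    | gen b hb =>
      rw [shift_gen _ _ hb, shift_gen _ _ hb, toPerm, braidLift_gen _ _ _ hj]
      exact semiconjBy_cable_gen_shift_gen h i hj hb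
    | one => rw [map_one, map_one]; exact SemiconjBy.one_right _
    | mul x y hx hy => rw [map_mul, map_mul]; exact hx.mul_right hy
    | inv x hx => rw [map_inv, map_inv]; exact hx.inv_right
  | one =>
    simp only [cable_one', map_one, Equiv.Perm.one_apply]
    exact SemiconjBy.one_left _
  | mul γ δ hγ hδ =>
    simp only [cable_mul, map_mul, Equiv.Perm.mul_apply]
    exact (hγ _).mul_left (hδ i)
  | inv γ hγ =>
    have hi : toPerm m γ (toPerm m γ⁻¹ i) = i := by
      rw [map_inv]
      exact (toPerm m γ).apply_symm_apply i
    have semiconj := hγ (toPerm m γ⁻¹ i)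
    simp only [hi] at semiconj
    rw [cable_inv]
    exact semiconj.inv_symm_left

/-! ### Group rings of finite groups -/

theorem toQuotAlg_surjective (k : Type w) [Field k] {n : ℕ} (Q : FinQuot n) :
    Function.Surjective (toQuotAlg k Q) := by
  refine LinearMap.range_eq_top (f := (toQuotAlg k Q).toLinearMap).1 (top_le_iff.1 ?_)
  rw [← (MonoidAlgebra.basis (Braid n ⧸ Q.toSubgroup) k).span_eq, Submodule.span_le]
  rintro _ ⟨x, rfl⟩
  induction x using QuotientGroup.induction_on with | H g =>
  rw [MonoidAlgebra.basis_apply]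
  exact ⟨MonoidAlgebra.single g 1, toQuotAlg_single k Q g 1⟩

section KerAverage

variable (k : Type*) [CommSemiring k] {G H : Type*} [Group G] [Group H] (f : G →* H)
  [Fintype f.ker] [Invertible (Fintype.card f.ker : k)]

/-- The average of the elements of the kernel of a homomorphism `f`: the idempotent of the group
ring through which the map induced by `f` splits. -/
def kerAverage : MonoidAlgebra k G :=
  MonoidAlgebra.mapDomainAlgHom k k f.ker.subtype (GroupAlgebra.average k f.ker)

theorem single_mul_kerAverage {x : G} (hx : x ∈ f.ker) :
    MonoidAlgebra.single x 1 * kerAverage k f = kerAverage k f := by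
  have hsingle : MonoidAlgebra.mapDomainAlgHom k k f.ker.subtype
      (MonoidAlgebra.single ⟨x, hx⟩ 1) = MonoidAlgebra.single x 1 := MonoidAlgebra.mapDomain_single
  rw [kerAverage, ← hsingle, ← map_mul, GroupAlgebra.mul_average_left]

theorem single_mul_kerAverage_congr {x y : G} (hxy : f x = f y) :
    MonoidAlgebra.single x 1 * kerAverage k f = MonoidAlgebra.single y 1 * kerAverage k f := by
  have hker : y⁻¹ * x ∈ f.ker := by
    rw [MonoidHom.mem_ker, map_mul, map_inv, hxy, inv_mul_cancel]
  conv_rhs => rw [← single_mul_kerAverage k f hker, ← mul_assoc, MonoidAlgebra.single_mul_single,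
    mul_inv_cancel_left, one_mul]

theorem mapDomainAlgHom_kerAverage :
    MonoidAlgebra.mapDomainAlgHom k k f (kerAverage k f) = 1 := by
  have hsingle (x : f.ker) : MonoidAlgebra.mapDomainAlgHom k k f
      (MonoidAlgebra.mapDomainAlgHom k k f.ker.subtype (MonoidAlgebra.of k f.ker x)) = 1 := by
    simp only [MonoidAlgebra.mapDomainAlgHom_apply, MonoidAlgebra.of_apply,
      MonoidAlgebra.mapDomain_single, Subgroup.subtype_apply, MonoidHom.mem_ker.1 x.2,
      MonoidAlgebra.one_def]
  rw [kerAverage, GroupAlgebra.average, map_smul, map_smul, map_sum, map_sum,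
    Finset.sum_congr rfl fun x _ => hsingle x, Finset.sum_const, Finset.card_univ,
    ← Nat.cast_smul_eq_nsmul k, smul_smul, invOf_mul_self, one_smul]

theorem mul_kerAverage_eq_zero {z : MonoidAlgebra k G}
    (hz : MonoidAlgebra.mapDomainAlgHom k k f z = 0) : z * kerAverage k f = 0 := by
  let lift : MonoidAlgebra k H →ₗ[k] MonoidAlgebra k G := (MonoidAlgebra.basis H k).constr k
    fun y => MonoidAlgebra.single (Function.invFun f y) 1 * kerAverage k f
  have hlift : lift ∘ₗ (MonoidAlgebra.mapDomainAlgHom k k f).toLinearMap =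
      LinearMap.mulRight k (kerAverage k f) := by
    refine (MonoidAlgebra.basis G k).ext fun g => ?_
    have hsingle : MonoidAlgebra.mapDomainAlgHom k k f (MonoidAlgebra.single g 1) =
        MonoidAlgebra.basis H k (f g) := by
      rw [MonoidAlgebra.basis_apply]; exact MonoidAlgebra.mapDomain_single
    rw [MonoidAlgebra.basis_apply, LinearMap.comp_apply, AlgHom.toLinearMap_apply, hsingle,
      Module.Basis.constr_basis, LinearMap.mulRight_apply]
    exact single_mul_kerAverage_congr k f (Function.invFun_eq ⟨g, rfl⟩)
  rw [← LinearMap.mulRight_apply (R := k), ← hlift, LinearMap.comp_apply,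
    AlgHom.toLinearMap_apply, hz, map_zero]

end KerAverage

theorem exists_mul_mul_eq {R : Type*} [Ring R] [IsSemisimpleRing R] (s : R) :
    ∃ t, s * t * s = s := by
  obtain ⟨q, hq⟩ := exists_isCompl (Submodule.span R {s})
  obtain ⟨a, ha, b, hb, hab⟩ :=
    Submodule.mem_sup.1 (hq.sup_eq_top ▸ Submodule.mem_top : (1 : R) ∈ _)
  obtain ⟨t, rfl⟩ := Submodule.mem_span_singleton.1 ha
  have hsb : s * b = s - s * t * s := by
    rw [eq_sub_iff_add_eq', mul_assoc, ← smul_eq_mul t s, ← mul_add, hab, mul_one]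
  have hsb_mem : s * b ∈ Submodule.span R {s} := hsb ▸
    Submodule.sub_mem _ (Submodule.mem_span_singleton_self s)
      (Submodule.mem_span_singleton.2 ⟨s * t, rfl⟩)
  have hsb_zero : s * b = 0 := Submodule.disjoint_def.1 hq.disjoint _ hsb_mem (q.smul_mem s hb)
  exact ⟨t, (sub_eq_zero.1 (hsb.symm.trans hsb_zero)).symm⟩

section CharZero

variable (k : Type w) [Field k] [CharZero k]

theorem exists_quantumSymmetrizer_mul_mul {n : ℕ} (Q : FinQuot n) :
    ∃ t : MonoidAlgebra k (Braid n),
      toQuotAlg k Q (quantumSymmetrizer k n * t * quantumSymmetrizer k n) =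
        toQuotAlg k Q (quantumSymmetrizer k n) := by
  have : NeZero (Nat.card (Braid n ⧸ Q.toSubgroup) : k) := ⟨Nat.cast_ne_zero.2 Nat.card_pos.ne'⟩
  obtain ⟨t, ht⟩ := exists_mul_mul_eq (toQuotAlg k Q (quantumSymmetrizer k n))
  obtain ⟨t, rfl⟩ := toQuotAlg_surjective k Q t
  exact ⟨t, by rw [map_mul, map_mul, ht]⟩

theorem exists_mem_worKer_quotAlgMap_eq {n : ℕ} {P Q : FinQuot n} (h : P ≤ Q) {x : QuotAlg k Q}
    (hx : x ∈ worKer k Q) : ∃ y ∈ worKer k P, quotAlgMap k h y = x := by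
  let f := QuotientGroup.map P.toSubgroup Q.toSubgroup (MonoidHom.id _) h
  have := Fintype.ofFinite f.ker
  have := invertibleOfNonzero (Nat.cast_ne_zero (R := k).2 (Fintype.card_ne_zero (α := f.ker)))
  obtain ⟨y, rfl⟩ := toQuotAlg_surjective k Q x
  refine ⟨toQuotAlg k P y * kerAverage k f, ?_, ?_⟩
  · rw [worKer, LinearMap.mem_ker, symMul, LinearMap.mulLeft_apply] at hx ⊢
    rw [← mul_assoc]
    refine mul_kerAverage_eq_zero k f ?_
    change quotAlgMap k h _ = 0
    rw [map_mul, quotAlgMap_toQuotAlg, quotAlgMap_toQuotAlg, hx]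
  · rw [map_mul, quotAlgMap_toQuotAlg]
    exact (congrArg _ (mapDomainAlgHom_kerAverage k f)).trans (mul_one _)

theorem woronowicz_isStrict : (woronowicz k).IsStrict := fun n P Q f => by
  rw [ModuleCat.epi_iff_surjective]
  rintro ⟨x, hx⟩
  obtain ⟨y, hy, hyx⟩ := exists_mem_worKer_quotAlgMap_eq k (leOfHom f) hx
  exact ⟨⟨y, hy⟩, Subtype.ext hyx⟩

end CharZero

/-! ### The Woronowicz ideal -/

section LeftIdeal

variable (k : Type w) [Field k]

/-- The homomorphism of group rings of finite quotients induced by `shift a h`. -/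
def shiftQuot {n N : ℕ} (a : ℕ) (h : a + n ≤ N) {Q : FinQuot n} {R : FinQuot N}
    (hQ : Q ≤ R.comap (shift a h)) : QuotAlg k Q →ₐ[k] QuotAlg k R :=
  MonoidAlgebra.mapDomainAlgHom k k (QuotientGroup.map Q.toSubgroup R.toSubgroup (shift a h) hQ)

theorem shiftQuot_single {n N : ℕ} (a : ℕ) (h : a + n ≤ N) {Q : FinQuot n} {R : FinQuot N}
    (hQ : Q ≤ R.comap (shift a h)) (g : Braid n) (c : k) :
    shiftQuot k a h hQ (MonoidAlgebra.single (g : Braid n ⧸ Q.toSubgroup) c) =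
      MonoidAlgebra.single (shift a h g : Braid N ⧸ R.toSubgroup) c := by
  exact MonoidAlgebra.mapDomain_single

theorem shiftQuot_toQuotAlg {n N : ℕ} (a : ℕ) (h : a + n ≤ N) {Q : FinQuot n} {R : FinQuot N}
    (hQ : Q ≤ R.comap (shift a h)) (x : MonoidAlgebra k (Braid n)) :
    shiftQuot k a h hQ (toQuotAlg k Q x) = toQuotAlg k R (shiftAlg k a h x) := by
  induction x using MonoidAlgebra.induction_linear with
  | zero => simp only [map_zero]
  | add x y hx hy => simp only [map_add, hx, hy]
  | single g c => rw [toQuotAlg_single, shiftQuot_single, shiftAlg_single, toQuotAlg_single]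

theorem semiconjBy_single_cable_shiftAlg {m n N : ℕ} (h : m + n = N + 1) (i : Fin m) (γ : Braid m)
    (x : MonoidAlgebra k (Braid n)) :
    SemiconjBy (MonoidAlgebra.single (cable h i γ) 1)
      (shiftAlg k i (by omega) x) (shiftAlg k (toPerm m γ i) (by omega) x) := by
  induction x using MonoidAlgebra.induction_linear with
  | zero => rw [map_zero, map_zero]; exact SemiconjBy.zero_right _
  | add x y hx hy => rw [map_add, map_add]; exact hx.add_right hy
  | single g c =>
    rw [SemiconjBy, shiftAlg_single, shiftAlg_single, MonoidAlgebra.single_mul_single,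
      MonoidAlgebra.single_mul_single, (semiconjBy_cable_shift h γ i g).eq, mul_comm c]

theorem exists_quantumSymmetrizer_mul_single_cable {m n N : ℕ} (h : m + n = N + 1) (i : Fin m)
    (γ : Braid m) : ∃ y, quantumSymmetrizer k N * MonoidAlgebra.single (cable h i γ) 1 =
      y * shiftAlg k i (by omega) (quantumSymmetrizer k n) := by
  classical
  rw [quantumSymmetrizer_eq_sum_mul k (n := n) (N := N) (toPerm m γ i) (by omega), mul_assoc,
    ← (semiconjBy_single_cable_shiftAlg k h i γ _).eq, ← mul_assoc]
  exact ⟨_, rfl⟩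

section QuotCirc

variable {m n N : ℕ} (h : m + n = N + 1) (i : Fin m)

section

variable {P : FinQuot m} {Q : FinQuot n} {R : FinQuot N}
  (hP : P ≤ cableKer h R) (hQ : Q ≤ R.comap (shift (N := N) i (by omega)))

theorem quotCirc_single_tmul (γ : Braid m) (w : QuotAlg k Q) :
    quotCirc k h i hP hQ (TensorProduct.tmul k
      (MonoidAlgebra.single (γ : Braid m ⧸ P.toSubgroup) 1) w) =
    MonoidAlgebra.single (cable h i γ : Braid N ⧸ R.toSubgroup) 1 *
      shiftQuot k i (by omega) hQ w := by
  refine LinearMap.congr_fun (f := quotCirc k h i hP hQ ∘ₗ TensorProduct.mk k _ _ _)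
    (g := LinearMap.mulLeft k (MonoidAlgebra.single (cable h i γ : Braid N ⧸ R.toSubgroup) 1) ∘ₗ
      (shiftQuot k i (by omega) hQ).toLinearMap) (quotAlg_hom_ext fun ρ => ?_) w
  rw [LinearMap.comp_apply, TensorProduct.mk_apply, quotCirc_single, LinearMap.comp_apply,
    AlgHom.toLinearMap_apply, shiftQuot_single, LinearMap.mulLeft_apply,
    MonoidAlgebra.single_mul_single, mul_one, cabling]
  rfl

theorem quotCirc_single_tmul_mem_worKer (γ : Braid m) {w : QuotAlg k Q} (hw : w ∈ worKer k Q) :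
    quotCirc k h i hP hQ (TensorProduct.tmul k
      (MonoidAlgebra.single (γ : Braid m ⧸ P.toSubgroup) 1) w) ∈ worKer k R := by
  obtain ⟨y, hy⟩ := exists_quantumSymmetrizer_mul_single_cable k h i γ
  rw [worKer, LinearMap.mem_ker, symMul, LinearMap.mulLeft_apply] at hw ⊢
  rw [quotCirc_single_tmul, ← toQuotAlg_single, ← mul_assoc, ← map_mul, hy, map_mul,
    ← shiftQuot_toQuotAlg k _ _ hQ, mul_assoc, ← map_mul, hw, map_zero, mul_zero]

theorem quotCirc_mem_worKer (x : TensorProduct k (QuotAlg k P) (worKer k Q)) :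
    (quotCirc k h i hP hQ ∘ₗ (worKer k Q).subtype.lTensor (QuotAlg k P)) x ∈ worKer k R := by
  refine LinearMap.congr_fun (f := symMul k R ∘ₗ quotCirc k h i hP hQ ∘ₗ
    (worKer k Q).subtype.lTensor (QuotAlg k P)) (g := 0) (TensorProduct.ext ?_) x
  exact quotAlg_hom_ext fun γ => LinearMap.ext fun w =>
    quotCirc_single_tmul_mem_worKer k h i hP hQ γ w.2

end

theorem quotAlgMap_quotCirc {R R' : FinQuot N} (hR : R ≤ R') (x : QuotAlg k (cableKer h R))
    (w : QuotAlg k (R.comap (shift (n := n) (N := N) i (by omega)))) :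
    quotAlgMap k hR (quotCirc k h i le_rfl le_rfl (TensorProduct.tmul k x w)) =
      quotCirc k h i le_rfl le_rfl (TensorProduct.tmul k
        (quotAlgMap k (cableKer_mono h hR) x)
        (quotAlgMap k (FiniteIndexNormalSubgroup.comap_mono _ hR) w)) := by
  refine LinearMap.congr_fun (f := (quotAlgMap k hR).toLinearMap ∘ₗ quotCirc k h i le_rfl le_rfl)
    (g := quotCirc k h i le_rfl le_rfl ∘ₗ
      TensorProduct.map (quotAlgMap k (cableKer_mono h hR)).toLinearMap
        (quotAlgMap k (FiniteIndexNormalSubgroup.comap_mono _ hR)).toLinearMap)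
    (TensorProduct.ext (quotAlg_hom_ext fun γ => quotAlg_hom_ext fun ρ => ?_)) _
  change quotAlgMap k hR (quotCirc k h i _ _ (TensorProduct.tmul k _ _)) =
    quotCirc k h i _ _ (TensorProduct.tmul k (quotAlgMap k _ _) (quotAlgMap k _ _))
  rw [quotAlgMap_single, quotAlgMap_single, quotCirc_single, quotCirc_single, quotAlgMap_single]

end QuotCirc

theorem Pro.Germ.postcomp_injective {C : Type u} [Category.{v} C] {X : Pro.{t} C} {c d : C}
    (f : c ⟶ d) [Mono f] : Function.Injective fun a : Pro.Germ X c => a.postcomp f := by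
  intro a b
  induction a using Pro.Germ.ind with | h i a =>
  induction b using Pro.Germ.ind with | h j b =>
  intro hab
  obtain ⟨l, p, q, hpq⟩ := Quotient.exact hab
  refine Pro.Germ.sound p q ((cancel_mono f).1 ?_)
  exact (Category.assoc _ _ _).trans (hpq.trans (Category.assoc _ _ _).symm)

theorem mono_woronowiczIncl (n : ℕ) : Mono (woronowiczIncl k n) where
  right_cancellation {Z} _ _ hfg := Pro.hom_ext fun Q =>
    have : Mono (ModuleCat.ofHom (worKer k Q).subtype) :=
      (ModuleCat.mono_iff_injective _).2 Subtype.val_injective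
    Pro.Germ.postcomp_injective (ModuleCat.ofHom (worKer k Q).subtype)
      (congrArg (fun F : Z ⟶ (brAssHat k).obj n => F.germ Q) hfg)

/-- The partial composition of `brAssHat k` restricted to the Woronowicz ideal in its second
argument. -/
def woronowiczCirc {m n N : ℕ} (h : m + n = N + 1) (i : Fin m) :
    Pro.tensor ((brAssHat k).obj m) ((woronowicz k).obj n) ⟶ (woronowicz k).obj N where
  germ := fun R : FinQuot N => Pro.Germ.mk
    (X := Pro.tensor ((brAssHat k).obj m) ((woronowicz k).obj n))
    ((cableKer h R, R.comap (shift (N := N) i (by omega))) : FinQuot m × FinQuot n)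
    (ModuleCat.ofHom (LinearMap.codRestrict (worKer k R) _
      (quotCirc_mem_worKer k h i (R := R) le_rfl le_rfl)))
  compat := fun {R R' : FinQuot N} f => by
    refine Pro.Germ.mk_eq (X := Pro.tensor ((brAssHat k).obj m) ((woronowicz k).obj n))
      ((homOfLE (cableKer_mono h (leOfHom f)) : cableKer h R ⟶ cableKer h R'),
        (homOfLE (FiniteIndexNormalSubgroup.comap_mono _ (leOfHom f)) :
          R.comap (shift (N := N) i (by omega)) ⟶ R'.comap (shift (N := N) i (by omega)))) ?_
    exact ModuleCat.hom_ext (TensorProduct.ext (LinearMap.ext fun x => LinearMap.ext fun w =>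
      Subtype.ext (quotAlgMap_quotCirc k h i (leOfHom f) x w.1)))

theorem isLeftIdeal_woronowicz : IsLeftIdeal (brAssHat k) (woronowicz k) (woronowiczIncl k) where
  mono := mono_woronowiczIncl k
  equivariant _ _ := rfl
  circ_mem {m n N} h i := ⟨woronowiczCirc k h i, Pro.hom_ext fun R =>
    congrArg (Pro.Germ.mk (X := Pro.tensor ((brAssHat k).obj m) ((woronowicz k).obj n))
      ((cableKer h R, R.comap (shift (N := N) i (by omega))) : FinQuot m × FinQuot n))
      (ModuleCat.hom_ext (TensorProduct.ext (LinearMap.ext fun _ => LinearMap.ext fun _ => rfl)))⟩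

end LeftIdeal

/-! ### Braid group actions and concatenation -/

section BraidActions

variable {C : Type u} [Category.{v} C]

theorem comp_hom_eq_of_gen {X Y : C} {n : ℕ} {ρ : Braid n →* Aut X} {ρ' : Braid n →* Aut Y}
    {f : X ⟶ Y}
    (h : ∀ j, j + 1 < n → f ≫ (ρ' (braidGen n j)).hom = (ρ (braidGen n j)).hom ≫ f)
    (g : Braid n) : f ≫ (ρ' g).hom = (ρ g).hom ≫ f := by
  induction g using braid_induction with
  | gen j hj => exact h j hj
  | one =>
    rw [map_one, map_one]
    exact (Category.comp_id f).trans (Category.id_comp f).symm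
  | mul x y hx hy =>
    rw [map_mul, map_mul]
    change f ≫ (ρ' y).hom ≫ (ρ' x).hom = ((ρ y).hom ≫ (ρ x).hom) ≫ f
    rw [reassoc_of% hy, hx, Category.assoc]
  | inv x hx =>
    rw [map_inv, map_inv]
    exact (Iso.comp_inv_eq (ρ' x)).2
      (by rw [Category.assoc, hx]; exact (Iso.inv_hom_id_assoc (ρ x) f).symm)

variable [MonoidalCategory C] (V : C)

theorem whiskerRight_comp_concat_succ {p q : ℕ} {f : tensorPow V p ⟶ tensorPow V p}
    {g : tensorPow V (p + q) ⟶ tensorPow V (p + q)}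
    (h : (concat V p q).hom ≫ g = f ▷ tensorPow V q ≫ (concat V p q).hom) :
    (concat V p (q + 1)).hom ≫ g ▷ V =
      f ▷ tensorPow V (q + 1) ≫ (concat V p (q + 1)).hom := by
  simp only [concat, tensorPow, Iso.trans_hom, Iso.symm_hom, whiskerRightIso_hom]
  rw [Category.assoc, ← comp_whiskerRight, h, comp_whiskerRight,
    associator_inv_naturality_left_assoc]

theorem whiskerLeft_comp_concat_succ {p q : ℕ} {f : tensorPow V q ⟶ tensorPow V q}
    {g : tensorPow V (p + q) ⟶ tensorPow V (p + q)}
    (h : (concat V p q).hom ≫ g = tensorPow V p ◁ f ≫ (concat V p q).hom) :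
    (concat V p (q + 1)).hom ≫ g ▷ V =
      tensorPow V p ◁ (f ▷ V) ≫ (concat V p (q + 1)).hom := by
  simp only [concat, tensorPow, Iso.trans_hom, Iso.symm_hom, whiskerRightIso_hom]
  rw [Category.assoc, ← comp_whiskerRight, h, comp_whiskerRight,
    associator_inv_naturality_middle_assoc]

variable [BraidedCategory C]

theorem braidMap_one (n : ℕ) : braidMap V n 1 = 𝟙 _ := by rw [braidMap, map_one]; rfl

theorem braidMap_mul (n : ℕ) (g h : Braid n) :
    braidMap V n (g * h) = braidMap V n h ≫ braidMap V n g := by rw [braidMap, map_mul]; rfl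

theorem braidAct_gen {n i : ℕ} (hi : i + 1 < n) :
    braidAct V n (braidGen n i) = genAct V n i := by
  rw [braidAct, braidLift_gen _ _ _ hi]

theorem genAct_succ : ∀ {n i : ℕ}, i + 1 < n →
    genAct V (n + 1) i = whiskerAut (tensorPow V n) V (genAct V n i)
  | _ + 1, _, h => genAct_of_ne V (by omega)

theorem braidAct_shift_succ {n : ℕ} (g : Braid n) :
    braidAct V (n + 1) (shift 0 (by omega) g) =
      whiskerAut (tensorPow V n) V (braidAct V n g) := by
  induction g using braid_induction with
  | gen j hj =>
    rw [shift_gen _ _ hj, Nat.zero_add, braidAct_gen V (by omega), braidAct_gen V hj,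
      genAct_succ V hj]
  | one => simp only [map_one]; rfl
  | mul x y hx hy => rw [map_mul, map_mul, map_mul, map_mul, hx, hy]; rfl
  | inv x hx => rw [map_inv, map_inv, map_inv, map_inv, hx]; rfl

theorem concat_genAct_left (p i : ℕ) (hi : i + 1 < p) : ∀ q,
    (concat V p q).hom ≫ (genAct V (p + q) i).hom =
      (genAct V p i).hom ▷ tensorPow V q ≫ (concat V p q).hom
  | 0 => (rightUnitor_naturality _).symm
  | q + 1 =>
    (congrArg ((concat V p (q + 1)).hom ≫ ·) (congrArg Iso.hom
      (genAct_succ V (hi.trans_le (Nat.le_add_right p q))))).trans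
        (whiskerRight_comp_concat_succ V (concat_genAct_left p i hi q))

theorem lastBraid_naturality {X Y : C} (f : X ⟶ Y) :
    (lastBraid X V).hom ≫ f ▷ V ▷ V = f ▷ V ▷ V ≫ (lastBraid Y V).hom := by
  simp only [lastBraid, Iso.trans_hom, whiskerLeftIso_hom, Iso.symm_hom, Category.assoc]
  rw [← associator_inv_naturality_left, whisker_exchange_assoc, associator_naturality_left_assoc]

theorem lastBraid_tensor (X Y : C) :
    (α_ X (Y ⊗ V) V).inv ≫ (α_ X Y V).inv ▷ V ≫ (lastBraid (X ⊗ Y) V).hom =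
      X ◁ (lastBraid Y V).hom ≫ (α_ X (Y ⊗ V) V).inv ≫ (α_ X Y V).inv ▷ V := by
  simp only [lastBraid, Iso.trans_hom, whiskerLeftIso_hom, Iso.symm_hom]
  monoidal

theorem concat_lastBraid (p q : ℕ) :
    (concat V p (q + 2)).hom ≫ (lastBraid (tensorPow V (p + q)) V).hom =
      tensorPow V p ◁ (lastBraid (tensorPow V q) V).hom ≫ (concat V p (q + 2)).hom := by
  simp only [concat, tensorPow, Iso.trans_hom, Iso.symm_hom, whiskerRightIso_hom]
  rw [comp_whiskerRight, Category.assoc, Category.assoc, ← lastBraid_naturality,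
    reassoc_of% lastBraid_tensor V (tensorPow V p) (tensorPow V q)]

theorem concat_genAct_right (p : ℕ) : ∀ (q j : ℕ), j + 1 < q →
    (concat V p q).hom ≫ (genAct V (p + q) (p + j)).hom =
      tensorPow V p ◁ (genAct V q j).hom ≫ (concat V p q).hom
  | q + 1, j, hj => by
    by_cases h : j + 1 < q
    · rw [genAct_succ V h]
      exact (congrArg ((concat V p (q + 1)).hom ≫ ·)
        (congrArg Iso.hom (genAct_succ V (Nat.add_lt_add_left h p)))).trans
          (whiskerLeft_comp_concat_succ V (concat_genAct_right p q j h))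
    · obtain rfl : q = j + 1 := by omega
      rw [genAct_last V j]
      exact (congrArg ((concat V p (j + 2)).hom ≫ ·)
        (congrArg Iso.hom (genAct_last V (p + j)))).trans (concat_lastBraid V p j)

theorem concat_shift_left {p q : ℕ} (g : Braid p) :
    (concat V p q).hom ≫ braidMap V (p + q) (shift 0 (by omega) g) =
      braidMap V p g ▷ tensorPow V q ≫ (concat V p q).hom := by
  refine comp_hom_eq_of_gen (ρ := ((tensorRight (tensorPow V q)).mapAut _).comp (braidAct V p))
    (ρ' := (braidAct V (p + q)).comp (shift 0 (by omega))) (fun j hj => ?_) g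
  rw [MonoidHom.comp_apply, MonoidHom.comp_apply, shift_gen _ _ hj, Nat.zero_add,
    braidAct_gen V (by omega), braidAct_gen V hj]
  exact concat_genAct_left V p j hj q

theorem concat_shift_right {p q : ℕ} (g : Braid q) :
    (concat V p q).hom ≫ braidMap V (p + q) (shift p le_rfl g) =
      tensorPow V p ◁ braidMap V q g ≫ (concat V p q).hom := by
  refine comp_hom_eq_of_gen (ρ := ((tensorLeft (tensorPow V p)).mapAut _).comp (braidAct V q))
    (ρ' := (braidAct V (p + q)).comp (shift p le_rfl)) (fun j hj => ?_) g
  rw [MonoidHom.comp_apply, MonoidHom.comp_apply, shift_gen _ _ hj,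
    braidAct_gen V (by omega), braidAct_gen V hj]
  exact concat_genAct_right V p q j hj

theorem concat_juxt {p q : ℕ} (g : Braid p) (h : Braid q) :
    (concat V p q).hom ≫ braidMap V (p + q) (juxt g h) =
      (braidMap V p g ⊗ₘ braidMap V q h) ≫ (concat V p q).hom := by
  rw [juxt, braidMap_mul, ← Category.assoc, concat_shift_left, Category.assoc, concat_shift_right,
    ← Category.assoc, ← MonoidalCategory.tensorHom_def]

end BraidActions

section SymmetrizerActions

variable (k : Type w) [Field k]

theorem quantumSymmetrizer_zero : quantumSymmetrizer k 0 = 1 := by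
  rw [quantumSymmetrizer, Fintype.sum_subsingleton _ 1, matsumoto_one]
  rfl

variable {C : Type u} [Category.{v} C] [Preadditive C] [Linear k C] [MonoidalCategory C]
  [BraidedCategory C] (V : C)

theorem algAct_single (n : ℕ) (g : Braid n) (c : k) :
    algAct k V n (MonoidAlgebra.single g c) = c • braidMap V n g :=
  MonoidAlgebra.lift_single _ _ _

theorem algAct_mul (n : ℕ) (x y : MonoidAlgebra k (Braid n)) :
    algAct k V n (x * y) = algAct k V n y ≫ algAct k V n x := map_mul _ _ _

theorem algAct_add (n : ℕ) (x y : MonoidAlgebra k (Braid n)) :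
    algAct k V n (x + y) = (algAct k V n x + algAct k V n y : tensorPow V n ⟶ tensorPow V n) :=
  map_add _ _ _

variable [MonoidalPreadditive C] [MonoidalLinear k C]

theorem concat_algAct_shiftAlg_left {p q : ℕ} (x : MonoidAlgebra k (Braid p)) :
    (concat V p q).hom ≫ algAct k V (p + q) (shiftAlg k 0 (by omega) x) =
      algAct k V p x ▷ tensorPow V q ≫ (concat V p q).hom := by
  induction x using MonoidAlgebra.induction_linear with
  | zero => simp only [map_zero, Limits.comp_zero, MonoidalPreadditive.zero_whiskerRight,
      Limits.zero_comp]
  | add x y hx hy => rw [map_add, algAct_add, algAct_add, Preadditive.comp_add,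
      MonoidalPreadditive.add_whiskerRight, Preadditive.add_comp, hx, hy]
  | single g c => simp only [shiftAlg_single, algAct_single, Linear.comp_smul,
      MonoidalLinear.smul_whiskerRight, Linear.smul_comp, concat_shift_left]

theorem concat_algAct_shiftAlg_right {p q : ℕ} (x : MonoidAlgebra k (Braid q)) :
    (concat V p q).hom ≫ algAct k V (p + q) (shiftAlg k p le_rfl x) =
      tensorPow V p ◁ algAct k V q x ≫ (concat V p q).hom := by
  induction x using MonoidAlgebra.induction_linear with
  | zero => simp only [map_zero, Limits.comp_zero, MonoidalPreadditive.whiskerLeft_zero,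
      Limits.zero_comp]
  | add x y hx hy => rw [map_add, algAct_add, algAct_add, Preadditive.comp_add,
      MonoidalPreadditive.whiskerLeft_add, Preadditive.add_comp, hx, hy]
  | single g c => simp only [shiftAlg_single, algAct_single, Linear.comp_smul,
      MonoidalLinear.whiskerLeft_smul, Linear.smul_comp, concat_shift_right]

theorem algAct_shiftAlg_succ {n : ℕ} (x : MonoidAlgebra k (Braid n)) :
    algAct k V (n + 1) (shiftAlg k 0 (by omega) x) = algAct k V n x ▷ V := by
  induction x using MonoidAlgebra.induction_linear with
  | zero =>
    rw [map_zero, map_zero, map_zero]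
    exact MonoidalPreadditive.zero_whiskerRight.symm
  | add x y hx hy =>
    rw [map_add, algAct_add, algAct_add, hx, hy]
    exact (MonoidalPreadditive.add_whiskerRight _ _).symm
  | single g c =>
    rw [shiftAlg_single, algAct_single, algAct_single, braidMap, braidAct_shift_succ]
    exact (MonoidalLinear.smul_whiskerRight c _ V).symm

theorem iterShuffle_eq_algAct : ∀ n, iterShuffle k V n = algAct k V n (quantumSymmetrizer k n)
  | 0 => by rw [quantumSymmetrizer_zero, map_one]; rfl
  | n + 1 => by
    rw [quantumSymmetrizer_succ, algAct_mul, algAct_shiftAlg_succ, iterShuffle,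
      iterShuffle_eq_algAct n]
    rfl

theorem concat_algAct_quantumSymmetrizer (p q : ℕ) :
    (concat V p q).hom ≫ algAct k V (p + q) (quantumSymmetrizer k (p + q)) =
      (algAct k V p (quantumSymmetrizer k p) ⊗ₘ algAct k V q (quantumSymmetrizer k q)) ≫
        (concat V p q).hom ≫ algAct k V (p + q) (shuffleSum k (p + q) p) := by
  rw [quantumSymmetrizer_add, algAct_mul, algAct_mul, reassoc_of% concat_algAct_shiftAlg_left,
    reassoc_of% concat_algAct_shiftAlg_right, MonoidalCategory.tensorHom_def, Category.assoc]

end SymmetrizerActions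

/-! ### The tensor algebra -/

section ConcatCoherence

variable {C : Type u} [Category.{v} C] [MonoidalCategory C] (V : C)

theorem eqToHom_comp_tensorPow_family {m n : ℕ} (h : m = n) {Z : C}
    (f : ∀ n, tensorPow V n ⟶ Z) : eqToHom (congrArg (tensorPow V) h) ≫ f n = f m := by
  subst h
  rw [eqToHom_refl, Category.id_comp]

theorem eqToHom_tensorPow_succ {m n : ℕ} (h : m = n) :
    eqToHom (congrArg (fun n => tensorPow V (n + 1)) h) =
      eqToHom (congrArg (tensorPow V) h) ▷ V := by
  subst h
  exact (id_whiskerRight _ _).symm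

theorem whiskerRight_comp_eq_leftUnitor {B Y : C} {c : 𝟙_ C ⊗ B ⟶ Y} {e : Y ⟶ B}
    (h : c ≫ e = (λ_ B).hom) :
    ((α_ (𝟙_ C) B V).inv ≫ c ▷ V) ≫ e ▷ V = (λ_ (B ⊗ V)).hom := by
  rw [Category.assoc, ← comp_whiskerRight, h, leftUnitor_tensor_hom]

theorem concat_zero_left : ∀ q, (concat V 0 q).hom ≫
    eqToHom (congrArg (tensorPow V) (Nat.zero_add q)) = (λ_ (tensorPow V q)).hom
  | 0 => (Category.comp_id _).trans unitors_equal.symm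
  | q + 1 =>
    (congrArg ((concat V 0 (q + 1)).hom ≫ ·)
      (eqToHom_tensorPow_succ V (Nat.zero_add q))).trans
        (whiskerRight_comp_eq_leftUnitor V (concat_zero_left q))

theorem whiskerRight_comp_eq_associator {A B D Y Z Z' X : C} {c : A ⊗ B ⟶ Y} {d : Y ⊗ D ⟶ Z}
    {e : Z ⟶ Z'} {c' : B ⊗ D ⟶ X} {d' : A ⊗ X ⟶ Z'}
    (h : c ▷ D ≫ d ≫ e = (α_ A B D).hom ≫ A ◁ c' ≫ d') :
    c ▷ (D ⊗ V) ≫ ((α_ Y D V).inv ≫ d ▷ V) ≫ e ▷ V =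
      (α_ A B (D ⊗ V)).hom ≫ A ◁ ((α_ B D V).inv ≫ c' ▷ V) ≫ (α_ A X V).inv ≫ d' ▷ V := by
  have hV : c ▷ D ▷ V ≫ d ▷ V ≫ e ▷ V = (α_ A B D).hom ▷ V ≫ (A ◁ c') ▷ V ≫ d' ▷ V := by
    simpa only [comp_whiskerRight] using congrArg (· ▷ V) h
  rw [Category.assoc, associator_inv_naturality_left_assoc, hV]
  simp

theorem concat_assoc (p q : ℕ) : ∀ r, (concat V p q).hom ▷ tensorPow V r ≫
    (concat V (p + q) r).hom ≫ eqToHom (congrArg (tensorPow V) (Nat.add_assoc p q r)) =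
      (α_ _ _ _).hom ≫ tensorPow V p ◁ (concat V q r).hom ≫ (concat V p (q + r)).hom
  | 0 => by
    change (concat V p q).hom ▷ 𝟙_ C ≫ (ρ_ (tensorPow V (p + q))).hom ≫ 𝟙 (tensorPow V (p + q)) =
      (α_ _ _ (𝟙_ C)).hom ≫ tensorPow V p ◁ (ρ_ (tensorPow V q)).hom ≫ (concat V p q).hom
    rw [Category.comp_id, rightUnitor_naturality, rightUnitor_tensor_hom, Category.assoc]
  | r + 1 =>
    (congrArg (fun e => (concat V p q).hom ▷ tensorPow V (r + 1) ≫
      (concat V (p + q) (r + 1)).hom ≫ e) (eqToHom_tensorPow_succ V (Nat.add_assoc p q r))).trans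
        (whiskerRight_comp_eq_associator V (concat_assoc p q r))

end ConcatCoherence

section CoproductHomExt

variable {C : Type u} [Category.{v} C] [HasCountableCoproducts C]

theorem preservesCoproduct_hom_ext (F : C ⥤ C) [PreservesColimitsOfShape (Discrete ℕ) F] {Y : ℕ → C}
    {Z : C} {f g : F.obj (∐ Y) ⟶ Z}
    (h : ∀ q, F.map (Sigma.ι Y q) ≫ f = F.map (Sigma.ι Y q) ≫ g) : f = g :=
  (isColimitOfPreserves F (colimit.isColimit (Discrete.functor Y))).hom_ext fun ⟨q⟩ => h q

variable [MonoidalCategory C] [BraidedCategory C]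
  [∀ X : C, PreservesColimitsOfShape (Discrete ℕ) (tensorLeft X)]

instance (X : C) : PreservesColimitsOfShape (Discrete ℕ) (tensorRight X) :=
  preservesColimitsOfShape_of_natIso (BraidedCategory.tensorLeftIsoTensorRight X)

theorem coproduct_tensor_hom_ext {Y Y' : ℕ → C} {Z : C} {f g : (∐ Y) ⊗ (∐ Y') ⟶ Z}
    (h : ∀ p q, (Sigma.ι Y p ⊗ₘ Sigma.ι Y' q) ≫ f = (Sigma.ι Y p ⊗ₘ Sigma.ι Y' q) ≫ g) : f = g :=
  preservesCoproduct_hom_ext (tensorLeft _) fun q =>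
    preservesCoproduct_hom_ext (tensorRight _) fun p => by
      have hpq := h p q
      rwa [MonoidalCategory.tensorHom_def, Category.assoc, Category.assoc] at hpq

theorem coproduct_tensor₃_hom_ext {Y Y' Y'' : ℕ → C} {Z : C}
    {f g : ((∐ Y) ⊗ (∐ Y')) ⊗ (∐ Y'') ⟶ Z}
    (h : ∀ p q r, ((Sigma.ι Y p ⊗ₘ Sigma.ι Y' q) ⊗ₘ Sigma.ι Y'' r) ≫ f =
      ((Sigma.ι Y p ⊗ₘ Sigma.ι Y' q) ⊗ₘ Sigma.ι Y'' r) ≫ g) : f = g :=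
  preservesCoproduct_hom_ext (tensorLeft _) fun r =>
    preservesCoproduct_hom_ext (tensorLeft _ ⋙ tensorRight _) fun q =>
      preservesCoproduct_hom_ext (tensorRight _ ⋙ tensorRight _) fun p => by
        have hpqr := h p q r
        simp only [MonoidalCategory.tensorHom_def, comp_whiskerRight, Category.assoc] at hpqr
        exact hpqr

end CoproductHomExt

section TensorAlgToCo

variable {C : Type u} [Category.{v} C] [HasCountableCoproducts C] [MonoidalCategory C]
  [BraidedCategory C] (V : C) (k : Type w) [Field k] [Preadditive C] [Linear k C]
  [MonoidalPreadditive C] [MonoidalLinear k C]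

theorem ι_tensorAlgToCo (n : ℕ) : tensorAlg.ι V n ≫ tensorAlgToCo k V =
    algAct k V n (quantumSymmetrizer k n) ≫ tensorAlg.ι V n := by
  rw [← iterShuffle_eq_algAct]
  exact Sigma.ι_map _ _

end TensorAlgToCo

section TensorAlgebra

variable {C : Type u} [Category.{v} C] [HasCountableCoproducts C] [MonoidalCategory C]
  [BraidedCategory C] [∀ X : C, PreservesColimitsOfShape (Discrete ℕ) (tensorLeft X)] (V : C)

theorem ι_concatMul (p q : ℕ) : (tensorAlg.ι V p ⊗ₘ tensorAlg.ι V q) ≫ concatMul V =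
    (concat V p q).hom ≫ tensorAlg.ι V (p + q) := ι_descTwo _ p q

theorem concatMul_one_left :
    tensorAlg.ι V 0 ▷ tensorAlg V ≫ concatMul V = (λ_ (tensorAlg V)).hom :=
  preservesCoproduct_hom_ext (tensorLeft (𝟙_ C)) fun q => by
    change 𝟙_ C ◁ tensorAlg.ι V q ≫ tensorAlg.ι V 0 ▷ tensorAlg V ≫ concatMul V =
      𝟙_ C ◁ tensorAlg.ι V q ≫ (λ_ (tensorAlg V)).hom
    have concat_ι : (concat V 0 q).hom ≫ tensorAlg.ι V (0 + q) =
        (λ_ (tensorPow V q)).hom ≫ tensorAlg.ι V q := by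
      rw [← concat_zero_left, ← eqToHom_comp_tensorPow_family V (Nat.zero_add q) (tensorAlg.ι V)]
      exact (Category.assoc _ _ _).symm
    rw [leftUnitor_naturality]
    exact (MonoidalCategory.tensorHom_def'_assoc _ _ _).symm.trans
      ((ι_concatMul V 0 q).trans concat_ι)

theorem concatMul_one_right :
    tensorAlg V ◁ tensorAlg.ι V 0 ≫ concatMul V = (ρ_ (tensorAlg V)).hom :=
  preservesCoproduct_hom_ext (tensorRight (𝟙_ C)) fun p => by
    change tensorAlg.ι V p ▷ 𝟙_ C ≫ tensorAlg V ◁ tensorAlg.ι V 0 ≫ concatMul V =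
      tensorAlg.ι V p ▷ 𝟙_ C ≫ (ρ_ (tensorAlg V)).hom
    rw [rightUnitor_naturality]
    exact (MonoidalCategory.tensorHom_def_assoc _ _ _).symm.trans (ι_concatMul V p 0)

theorem concatMul_assoc : concatMul V ▷ tensorAlg V ≫ concatMul V =
    (α_ _ _ _).hom ≫ tensorAlg V ◁ concatMul V ≫ concatMul V :=
  coproduct_tensor₃_hom_ext fun p q r => by
    change ((tensorAlg.ι V p ⊗ₘ tensorAlg.ι V q) ⊗ₘ tensorAlg.ι V r) ≫ _ =
      ((tensorAlg.ι V p ⊗ₘ tensorAlg.ι V q) ⊗ₘ tensorAlg.ι V r) ≫ _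
    have mul_left : ((tensorAlg.ι V p ⊗ₘ tensorAlg.ι V q) ⊗ₘ tensorAlg.ι V r) ≫
        concatMul V ▷ tensorAlg V = (concat V p q).hom ▷ tensorPow V r ≫
          (tensorAlg.ι V (p + q) ⊗ₘ tensorAlg.ι V r) := by
      rw [MonoidalCategory.tensorHom_comp_whiskerRight, ι_concatMul,
        MonoidalCategory.whiskerRight_comp_tensorHom]
    have mul_right : (tensorAlg.ι V p ⊗ₘ (tensorAlg.ι V q ⊗ₘ tensorAlg.ι V r)) ≫
        tensorAlg V ◁ concatMul V = tensorPow V p ◁ (concat V q r).hom ≫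
          (tensorAlg.ι V p ⊗ₘ tensorAlg.ι V (q + r)) := by
      rw [MonoidalCategory.tensorHom_comp_whiskerLeft, ι_concatMul,
        MonoidalCategory.whiskerLeft_comp_tensorHom]
    rw [reassoc_of% mul_left, ι_concatMul, MonoidalCategory.associator_naturality_assoc,
      reassoc_of% mul_right, ι_concatMul,
      ← eqToHom_comp_tensorPow_family V (Nat.add_assoc p q r) (tensorAlg.ι V)]
    simpa only [Category.assoc] using
      congrArg (· ≫ tensorAlg.ι V (p + (q + r))) (concat_assoc V p q r)

/-- The algebra structure of the tensor algebra `T(V)`. It is not an instance, since the tensor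
coalgebra has the same underlying object. -/
@[reducible]
def tensorAlgMonObj : MonObj (tensorAlg V) where
  one := tensorAlg.ι V 0
  mul := concatMul V
  one_mul := concatMul_one_left V
  mul_one := concatMul_one_right V
  mul_assoc := concatMul_assoc V

variable (k : Type w) [Field k] [Preadditive C] [Linear k C]

theorem ι_shuffleMul (p q : ℕ) : (tensorAlg.ι V p ⊗ₘ tensorAlg.ι V q) ≫ shuffleMul k V =
    (concat V p q).hom ≫ algAct k V (p + q) (shuffleSum k (p + q) p) ≫ tensorAlg.ι V (p + q) :=
  ι_descTwo _ p q

variable [MonoidalPreadditive C] [MonoidalLinear k C]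

theorem concatMul_tensorAlgToCo : concatMul V ≫ tensorAlgToCo k V =
    (tensorAlgToCo k V ⊗ₘ tensorAlgToCo k V) ≫ shuffleMul k V :=
  coproduct_tensor_hom_ext fun p q => by
    change (tensorAlg.ι V p ⊗ₘ tensorAlg.ι V q) ≫ _ = (tensorAlg.ι V p ⊗ₘ tensorAlg.ι V q) ≫ _
    rw [reassoc_of% ι_concatMul, ι_tensorAlgToCo, reassoc_of% concat_algAct_quantumSymmetrizer,
      MonoidalCategory.tensorHom_comp_tensorHom_assoc, ι_tensorAlgToCo, ι_tensorAlgToCo,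
      ← MonoidalCategory.tensorHom_comp_tensorHom_assoc, ι_shuffleMul]

end TensorAlgebra

/-! ### The Nichols algebra -/

section SplitQuotients

variable {C : Type u} [Category.{v} C] [MonoidalCategory C]

instance isSplitEpi_tensorHom {X X' Y Y' : C} (f : X ⟶ Y) (g : X' ⟶ Y') [IsSplitEpi f]
    [IsSplitEpi g] : IsSplitEpi (f ⊗ₘ g) :=
  ⟨⟨⟨section_ f ⊗ₘ section_ g, by
    rw [MonoidalCategory.tensorHom_comp_tensorHom, IsSplitEpi.id, IsSplitEpi.id,
      MonoidalCategory.id_tensorHom_id]⟩⟩⟩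

open MonObj in
/-- The algebra structure on a split quotient of an algebra, for a product on the quotient with
which the projection is compatible. -/
@[reducible]
def monObjOfIsSplitEpi {T B : C} [MonObj T] (π : T ⟶ B) [IsSplitEpi π] (m : B ⊗ B ⟶ B)
    (hm : μ[T] ≫ π = (π ⊗ₘ π) ≫ m) : MonObj B where
  one := η[T] ≫ π
  mul := m
  one_mul := by
    rw [← cancel_epi (𝟙 (𝟙_ C) ⊗ₘ π), MonoidalCategory.id_tensorHom, leftUnitor_naturality,
      ← MonObj.one_mul, Category.assoc, hm, ← MonoidalCategory.tensorHom_def'_assoc,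
      MonoidalCategory.whiskerRight_comp_tensorHom_assoc]
  mul_one := by
    rw [← cancel_epi (π ⊗ₘ 𝟙 (𝟙_ C)), MonoidalCategory.tensorHom_id, rightUnitor_naturality,
      ← MonObj.mul_one, Category.assoc, hm, ← MonoidalCategory.tensorHom_def_assoc,
      MonoidalCategory.whiskerLeft_comp_tensorHom_assoc]
  mul_assoc := by
    rw [← cancel_epi ((π ⊗ₘ π) ⊗ₘ π), MonoidalCategory.associator_naturality_assoc,
      MonoidalCategory.tensorHom_comp_whiskerRight_assoc,
      MonoidalCategory.tensorHom_comp_whiskerLeft_assoc, ← hm,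
      ← MonoidalCategory.whiskerRight_comp_tensorHom_assoc,
      ← MonoidalCategory.whiskerLeft_comp_tensorHom_assoc, ← hm, MonObj.mul_assoc_assoc]

end SplitQuotients

section NicholsAlgebra

variable {C : Type u} [Category.{v} C] [HasCountableCoproducts C] [MonoidalCategory C]
  [BraidedCategory C] (k : Type w) [Field k] [Abelian C] [Linear k C] (V : C)

theorem proj_incl : nichols.proj k V ≫ nichols.incl k V = tensorAlgToCo k V := image.fac _

instance : Epi (nichols.proj k V) := inferInstanceAs (Epi (factorThruImage _))

instance : Mono (nichols.incl k V) := inferInstanceAs (Mono (image.ι _))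

variable {k V} in
theorem incl_comp_proj {t : tensorAlg V ⟶ tensorAlg V}
    (ht : tensorAlgToCo k V ≫ t ≫ tensorAlgToCo k V = tensorAlgToCo k V) :
    nichols.incl k V ≫ t ≫ nichols.proj k V = 𝟙 _ := by
  rw [← cancel_epi (nichols.proj k V), ← cancel_mono (nichols.incl k V), Category.assoc,
    Category.assoc, Category.assoc, proj_incl, reassoc_of% proj_incl, ht, Category.comp_id,
    proj_incl]

variable {k V} in
theorem isSplitEpi_proj {t : tensorAlg V ⟶ tensorAlg V}
    (ht : tensorAlgToCo k V ≫ t ≫ tensorAlgToCo k V = tensorAlgToCo k V) :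
    IsSplitEpi (nichols.proj k V) :=
  ⟨⟨⟨nichols.incl k V ≫ t, by rw [Category.assoc, incl_comp_proj ht]⟩⟩⟩

variable [∀ X : C, PreservesColimitsOfShape (Discrete ℕ) (tensorLeft X)]
  [IsSplitEpi (nichols.proj k V)]

/-- The product of the Nichols algebra: concatenation of representatives. -/
def nicholsMul : nichols k V ⊗ nichols k V ⟶ nichols k V :=
  (section_ (nichols.proj k V) ⊗ₘ section_ (nichols.proj k V)) ≫ concatMul V ≫ nichols.proj k V

variable [MonoidalPreadditive C] [MonoidalLinear k C]

theorem nicholsMul_incl : nicholsMul k V ≫ nichols.incl k V =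
    (nichols.incl k V ⊗ₘ nichols.incl k V) ≫ shuffleMul k V := by
  have section_tensorAlgToCo :
      section_ (nichols.proj k V) ≫ tensorAlgToCo k V = nichols.incl k V := by
    rw [← proj_incl, IsSplitEpi.id_assoc]
  rw [nicholsMul, Category.assoc, Category.assoc, proj_incl, concatMul_tensorAlgToCo,
    MonoidalCategory.tensorHom_comp_tensorHom_assoc, section_tensorAlgToCo]

theorem concatMul_proj : concatMul V ≫ nichols.proj k V =
    (nichols.proj k V ⊗ₘ nichols.proj k V) ≫ nicholsMul k V := by
  rw [← cancel_mono (nichols.incl k V), Category.assoc, Category.assoc, nicholsMul_incl,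
    proj_incl, concatMul_tensorAlgToCo, MonoidalCategory.tensorHom_comp_tensorHom_assoc, proj_incl]

/-- The algebra structure on the Nichols algebra as a split quotient of the tensor algebra. -/
@[reducible]
def nicholsMonObj : MonObj (nichols k V) :=
  letI := tensorAlgMonObj V
  monObjOfIsSplitEpi (nichols.proj k V) (nicholsMul k V) (concatMul_proj k V)

theorem isNicholsAlgebra :
    letI := nicholsMonObj k V
    IsNicholsAlgebra k V :=
  letI := nicholsMonObj k V
  { one_incl := by
      refine (Category.assoc _ _ _).trans ?_
      rw [proj_incl]
      refine (ι_tensorAlgToCo V k 0).trans ?_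
      rw [quantumSymmetrizer_zero, map_one]
      exact Category.id_comp _
    mul_incl := nicholsMul_incl k V
    one_proj := rfl
    mul_proj := concatMul_proj k V }

end NicholsAlgebra

/-! ### Finitely braided objects -/

section FinitelyBraided

variable (k : Type w) [Field k] {C : Type u} [Category.{v} C] [MonoidalCategory C]
  [BraidedCategory C] {V : C}

/-- The finite quotient through which the braid group acts on a tensor power of `V`. -/
def kerQuot (hV : FinitelyBraided V) (n : ℕ) : FinQuot n :=
  haveI := hV n
  .ofSubgroup (braidAct V n).ker

theorem mem_kerQuot (hV : FinitelyBraided V) {n : ℕ} {g : Braid n} :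
    g ∈ (kerQuot hV n).toSubgroup ↔ braidMap V n g = 𝟙 _ := by
  have := hV n
  rw [kerQuot, FiniteIndexNormalSubgroup.toSubgroup_ofSubgroup, MonoidHom.mem_ker]
  exact ⟨fun h => congrArg Iso.hom h, fun h => Iso.ext h⟩

variable (V) in
/-- The action of the braid group on a tensor power by endomorphisms, rather than by automorphisms
as in `braidAct`. -/
def braidEnd (n : ℕ) : Braid n →* End (tensorPow V n) where
  toFun := braidMap V n
  map_one' := braidMap_one V n
  map_mul' := braidMap_mul V n

variable (hV : FinitelyBraided V)

/-- The elements `t n` of the group rings of the braid groups are inner inverses of the quantum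
symmetrizers, in the sense that `𝐒 t 𝐒 = 𝐒`, over the finite quotients through which the braid
groups act on the tensor powers of `V`. -/
def IsSymmetrizerInnerInverse (t : ∀ n, MonoidAlgebra k (Braid n)) : Prop :=
  ∀ n, toQuotAlg k (kerQuot hV n) (quantumSymmetrizer k n * t n * quantumSymmetrizer k n) =
    toQuotAlg k (kerQuot hV n) (quantumSymmetrizer k n)

theorem exists_isSymmetrizerInnerInverse [CharZero k] :
    ∃ t, IsSymmetrizerInnerInverse k hV t := by
  choose t ht using fun n => exists_quantumSymmetrizer_mul_mul k (kerQuot hV n)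
  exact ⟨t, ht⟩

variable [Preadditive C] [Linear k C]

/-- The action on a tensor power of the group ring of the finite quotient of the braid group through
which the braid group acts. -/
def quotAct (n : ℕ) : QuotAlg k (kerQuot hV n) →ₐ[k] End (tensorPow V n) :=
  MonoidAlgebra.lift k _ _ (QuotientGroup.lift (kerQuot hV n).toSubgroup (braidEnd V n)
    fun _ hg => (mem_kerQuot hV).1 hg)

theorem quotAct_single {n : ℕ} (g : Braid n) :
    quotAct k hV n (MonoidAlgebra.single (g : Braid n ⧸ (kerQuot hV n).toSubgroup) 1) =
      braidMap V n g :=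
  (MonoidAlgebra.lift_single _ _ _).trans (one_smul _ _)

theorem quotAct_mul {n : ℕ} (x y : QuotAlg k (kerQuot hV n)) :
    quotAct k hV n (x * y) = quotAct k hV n y ≫ quotAct k hV n x := map_mul _ _ _

theorem quotAct_toQuotAlg {n : ℕ} (x : MonoidAlgebra k (Braid n)) :
    quotAct k hV n (toQuotAlg k (kerQuot hV n) x) = algAct k V n x := by
  have quotAct_comp : (quotAct k hV n).comp (toQuotAlg k (kerQuot hV n)) = algAct k V n :=
    MonoidAlgebra.algHom_ext (fun g => by
      rw [AlgHom.comp_apply, toQuotAlg_single, quotAct_single, algAct_single, one_smul])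
      (Subsingleton.elim _ _)
  exact AlgHom.congr_fun quotAct_comp x

variable [HasCountableCoproducts C]

variable (V) in
/-- The action on the tensor algebra of a family of elements of the group rings of the braid groups,
of which the `n`-th acts on the `n`-th tensor power. -/
def tensorAlgAct (t : ∀ n, MonoidAlgebra k (Braid n)) : tensorAlg V ⟶ tensorAlg V :=
  Limits.Sigma.map fun n => algAct k V n (t n)

theorem ι_tensorAlgAct (t : ∀ n, MonoidAlgebra k (Braid n)) (n : ℕ) :
    tensorAlg.ι V n ≫ tensorAlgAct k V t = algAct k V n (t n) ≫ tensorAlg.ι V n := Sigma.ι_map _ _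

variable [MonoidalPreadditive C] [MonoidalLinear k C]

variable {k hV} in
theorem IsSymmetrizerInnerInverse.tensorAlgToCo_comp {t : ∀ n, MonoidAlgebra k (Braid n)}
    (ht : IsSymmetrizerInnerInverse k hV t) :
    tensorAlgToCo k V ≫ tensorAlgAct k V t ≫ tensorAlgToCo k V = tensorAlgToCo k V :=
  Sigma.hom_ext _ _ fun n => by
    change tensorAlg.ι V n ≫ _ = tensorAlg.ι V n ≫ _
    have algAct_symmetrizer : algAct k V n (quantumSymmetrizer k n) ≫ algAct k V n (t n) ≫
        algAct k V n (quantumSymmetrizer k n) = algAct k V n (quantumSymmetrizer k n) := by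
      rw [← algAct_mul, ← algAct_mul, ← quotAct_toQuotAlg k hV, ht n, quotAct_toQuotAlg]
    rw [reassoc_of% ι_tensorAlgToCo, reassoc_of% ι_tensorAlgAct, ι_tensorAlgToCo,
      reassoc_of% algAct_symmetrizer]

end FinitelyBraided

/-! ### The terms of `Nic[V]` -/

section Balanced

variable {k : Type w} [Field k] {C : Type u} [Category.{v} C] [Preadditive C] [Linear k C]
  [HasCoproducts.{w} C] [HasCoequalizers C]
  {G : Type} {M : ModuleCat.{w} k} {ρ : G → (M ⟶ M)} {X : C} {a : G → (X ⟶ X)}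

theorem bal.ι_zero : (bal.ι (0 : M) : X ⟶ bal M ρ a) = 0 := by
  have h := bal.ι_smul_add (ρ := ρ) (a := a) (-1) (0 : M) 0
  rwa [smul_zero, add_zero, neg_smul, one_smul, neg_add_cancel] at h

variable (M ρ a) in
/-- The map `m ↦ (x ↦ m ⊗ x)` as a linear map. -/
def bal.ιLin : M →ₗ[k] (X ⟶ bal M ρ a) where
  toFun := bal.ι
  map_add' m m' := by
    have h := bal.ι_smul_add (ρ := ρ) (a := a) 1 m m'
    rwa [one_smul, one_smul] at h
  map_smul' c m := by
    have h := bal.ι_smul_add (ρ := ρ) (a := a) c m 0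
    rwa [add_zero, bal.ι_zero, add_zero] at h

/-- The universal property of the balanced tensor product, for a linear map. -/
def bal.descLin {Z : C} (L : M →ₗ[k] (X ⟶ Z)) (hL : ∀ g m, L (ρ g m) = a g ≫ L m) :
    bal M ρ a ⟶ Z :=
  bal.desc L (fun c m m' => by rw [map_add, map_smul]) hL

theorem bal.ι_descLin {Z : C} (L : M →ₗ[k] (X ⟶ Z)) (hL : ∀ g m, L (ρ g m) = a g ≫ L m)
    (m : M) : bal.ι m ≫ bal.descLin L hL = L m := bal.ι_desc _ _ _ m

end Balanced

section NicTerm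

variable (k : Type w) [Field k] {C : Type u} [Category.{v} C] [Preadditive C] [Linear k C]
  [HasCoproducts.{w} C] [HasCoequalizers C] [MonoidalCategory C] [BraidedCategory C] {V : C}

variable (V) in
/-- The map `x ↦ (v ↦ x ⊗ v)` from the group ring of the braid group to the maps from a tensor power
to a term of `Nic[V]`. -/
def nicι {n : ℕ} (Q : FinQuot n) :
    MonoidAlgebra k (Braid n) →ₗ[k] (tensorPow V n ⟶ artinTerm (nic k) V n Q) :=
  bal.ιLin (((nic k).obj n).diag.obj Q) (fun g => ((nic k).act n g).app Q) (braidMap V n) ∘ₗ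
    (worKer k Q).mkQ ∘ₗ (toQuotAlg k Q).toLinearMap

theorem nicι_single {n : ℕ} (Q : FinQuot n) (g : Braid n) :
    nicι k V Q (MonoidAlgebra.single g 1) = braidMap V n g ≫ nicι k V Q 1 := by
  refine Eq.trans ?_ (bal.ι_act (ρ := fun g => ((nic k).act n g).app Q) g (nicClass k 1 Q))
  refine congrArg (artinTerm.ι (nic k) V n Q) ?_
  change (worKer k Q).mkQ _ = (worKer k Q).mkQ (rightMul k Q g _)
  rw [rightMul_apply, map_one, one_mul]
  exact congrArg (worKer k Q).mkQ (toQuotAlg_single k Q g 1)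

theorem nicι_eq_algAct_comp {n : ℕ} (Q : FinQuot n) (x : MonoidAlgebra k (Braid n)) :
    nicι k V Q x = algAct k V n x ≫ nicι k V Q 1 := by
  induction x using MonoidAlgebra.induction_linear with
  | zero => rw [map_zero, map_zero]; exact zero_comp.symm
  | add x y hx hy => rw [map_add, algAct_add, Preadditive.add_comp, hx, hy]
  | single g c =>
    rw [algAct_single, Linear.smul_comp, ← nicι_single, ← map_smul, MonoidAlgebra.smul_single,
      smul_eq_mul, mul_one]

theorem nicι_eq_of_mem {n : ℕ} (Q : FinQuot n) {x y : MonoidAlgebra k (Braid n)}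
    (h : toQuotAlg k Q (x - y) ∈ worKer k Q) : nicι k V Q x = nicι k V Q y := by
  refine congrArg (artinTerm.ι (nic k) V n Q) ?_
  rw [map_sub] at h
  exact (Submodule.Quotient.eq _).2 h

theorem nicι_map {n : ℕ} {P Q : FinQuot n} (f : P ⟶ Q) (x : MonoidAlgebra k (Braid n)) :
    nicι k V P x ≫ artinTerm.map (nic k) V n f = nicι k V Q x :=
  (artinTerm.ι_map (nic k) V n f _).trans
    (congrArg (artinTerm.ι (nic k) V n Q) (nicClass_compat k x f))

theorem nicTerm_hom_ext {n : ℕ} {Q : FinQuot n} {Z : C} {f g : artinTerm (nic k) V n Q ⟶ Z}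
    (h : ∀ x, nicι k V Q x ≫ f = nicι k V Q x ≫ g) : f = g :=
  artinTerm.hom_ext fun m => by
    obtain ⟨y, rfl⟩ := (worKer k Q).mkQ_surjective m
    obtain ⟨x, rfl⟩ := toQuotAlg_surjective k Q y
    exact h x

-- By strictness, `x - y` may be corrected by an element `z` of the Woronowicz ideal so that it acts
-- as zero on the tensor power.
theorem nicι_eq_of_quantumSymmetrizer_mul [CharZero k] (hV : FinitelyBraided V) {n : ℕ}
    (Q : FinQuot n) {x y : MonoidAlgebra k (Braid n)}
    (h : toQuotAlg k (kerQuot hV n) (quantumSymmetrizer k n * x) =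
      toQuotAlg k (kerQuot hV n) (quantumSymmetrizer k n * y)) :
    nicι k V Q x = nicι k V Q y := by
  have sub_mem : toQuotAlg k (kerQuot hV n) (x - y) ∈ worKer k (kerQuot hV n) := by
    rw [worKer, LinearMap.mem_ker, symMul, LinearMap.mulLeft_apply, ← map_mul, mul_sub, map_sub, h,
      sub_self]
  obtain ⟨d, hd, hdxy⟩ :=
    exists_mem_worKer_quotAlgMap_eq k (inf_le_left : kerQuot hV n ⊓ Q ≤ _) sub_mem
  obtain ⟨z, rfl⟩ := toQuotAlg_surjective k _ d
  rw [quotAlgMap_toQuotAlg] at hdxy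
  have algAct_z : algAct k V n x = algAct k V n (y + z) := by
    rw [← quotAct_toQuotAlg k hV, ← quotAct_toQuotAlg k hV, map_add, hdxy, ← map_add,
      add_sub_cancel]
  have z_mem : toQuotAlg k Q (y + z - y) ∈ worKer k Q := by
    rw [add_sub_cancel_left, ← quotAlgMap_toQuotAlg k (inf_le_right : kerQuot hV n ⊓ Q ≤ Q)]
    exact quotAlgMap_mem k _ _ hd
  calc nicι k V Q x = algAct k V n x ≫ nicι k V Q 1 := nicι_eq_algAct_comp k Q x
    _ = nicι k V Q (y + z) := by rw [algAct_z, ← nicι_eq_algAct_comp]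
    _ = nicι k V Q y := nicι_eq_of_mem k Q z_mem

variable [HasCountableCoproducts C]

variable (V) in
/-- The terms of the inverse system `Nic[V]`. -/
def nicSum (j : ∀ n, FinQuot n) : C := ∐ fun n => artinTerm (nic k) V n (j n)

variable (V) in
/-- The inclusion of a summand in a term of `Nic[V]`. -/
def nicSum.ι (j : ∀ n, FinQuot n) (n : ℕ) : artinTerm (nic k) V n (j n) ⟶ nicSum k V j :=
  Sigma.ι (fun n => artinTerm (nic k) V n (j n)) n

theorem nicSum_hom_ext {j : ∀ n, FinQuot n} {Z : C} {f g : nicSum k V j ⟶ Z}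
    (h : ∀ n x, nicι k V (j n) x ≫ nicSum.ι k V j n ≫ f = nicι k V (j n) x ≫ nicSum.ι k V j n ≫ g) :
    f = g := Sigma.hom_ext _ _ fun n => nicTerm_hom_ext k (h n)

/-- The transition maps of the inverse system `Nic[V]`. -/
def nicSum.map {j j' : ∀ n, FinQuot n} (f : j ⟶ j') : nicSum k V j ⟶ nicSum k V j' :=
  (artin (nic k) V).diag.map f

theorem nicSum.ι_map {j j' : ∀ n, FinQuot n} (f : j ⟶ j') (n : ℕ) :
    nicSum.ι k V j n ≫ nicSum.map k f =
      artinTerm.map (nic k) V n (f n) ≫ nicSum.ι k V j' n :=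
  Sigma.ι_map (fun n => artinTerm.map (nic k) V n (f n)) n

theorem nicι_ι_map {j j' : ∀ n, FinQuot n} (f : j ⟶ j') {n : ℕ} (x : MonoidAlgebra k (Braid n)) :
    nicι k V (j n) x ≫ nicSum.ι k V j n ≫ nicSum.map k f =
      nicι k V (j' n) x ≫ nicSum.ι k V j' n := by
  rw [nicSum.ι_map, ← Category.assoc, nicι_map]

variable (V) in
/-- The map from the tensor algebra to a term of `Nic[V]` given by `v ↦ 1 ⊗ v`. -/
def toNicSum (j : ∀ n, FinQuot n) : tensorAlg V ⟶ nicSum k V j :=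
  Sigma.desc fun n => nicι k V (j n) 1 ≫ nicSum.ι k V j n

theorem ι_toNicSum (j : ∀ n, FinQuot n) (n : ℕ) :
    tensorAlg.ι V n ≫ toNicSum k V j = nicι k V (j n) 1 ≫ nicSum.ι k V j n := Sigma.ι_desc _ _

theorem toNicSum_map {j j' : ∀ n, FinQuot n} (f : j ⟶ j') :
    toNicSum k V j ≫ nicSum.map k f = toNicSum k V j' :=
  Sigma.hom_ext _ _ fun n => by
    change tensorAlg.ι V n ≫ _ = tensorAlg.ι V n ≫ _
    rw [reassoc_of% ι_toNicSum, nicι_ι_map, ι_toNicSum]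

end NicTerm

/-! ### The isomorphism between `Nic[V]` and the Nichols algebra -/

section NicholsToNicSum

variable (k : Type w) [Field k] {C : Type u} [Category.{v} C] [Abelian C] [Linear k C]
  [MonoidalCategory C] [BraidedCategory C] [HasCoproducts.{w} C] [HasCountableCoproducts C] (V : C)
  (t : ∀ n, MonoidAlgebra k (Braid n))

/-- The map from the Nichols algebra to a term of `Nic[V]` given by `v ↦ 1 ⊗ t v`. If `t` consists
of inner inverses of the quantum symmetrizers, it inverts `x ⊗ v ↦ x v`. -/
def nicholsToNicSum (j : ∀ n, FinQuot n) : nichols k V ⟶ nicSum k V j :=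
  nichols.incl k V ≫ tensorAlgAct k V t ≫ toNicSum k V j

theorem nicholsToNicSum_map {j j' : ∀ n, FinQuot n} (f : j ⟶ j') :
    nicholsToNicSum k V t j ≫ nicSum.map k f = nicholsToNicSum k V t j' := by
  rw [nicholsToNicSum, Category.assoc, Category.assoc, toNicSum_map, nicholsToNicSum]

end NicholsToNicSum

section Comparison

variable (k : Type w) [Field k] {C : Type u} [Category.{v} C] [Abelian C] [Linear k C]
  [MonoidalCategory C] [MonoidalPreadditive C] [MonoidalLinear k C] [BraidedCategory C]
  [HasCountableCoproducts C] {V : C} (hV : FinitelyBraided V)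

/-- The map `x ↦ (v ↦ x v)` from the group ring of a quotient of the braid group to the maps from a
tensor power to the Nichols algebra. -/
def quotActProj (n : ℕ) : QuotAlg k (kerQuot hV n) →ₗ[k] (tensorPow V n ⟶ nichols k V) :=
  Linear.rightComp k _ (tensorAlg.ι V n ≫ nichols.proj k V) ∘ₗ (quotAct k hV n).toLinearMap

theorem worKer_le_ker_quotActProj (n : ℕ) :
    worKer k (kerQuot hV n) ≤ LinearMap.ker (quotActProj k hV n) := by
  intro x hx
  rw [worKer, LinearMap.mem_ker, symMul, LinearMap.mulLeft_apply] at hx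
  rw [LinearMap.mem_ker]
  change quotAct k hV n x ≫ tensorAlg.ι V n ≫ nichols.proj k V = 0
  rw [← cancel_mono (nichols.incl k V), zero_comp, Category.assoc, Category.assoc, proj_incl,
    ι_tensorAlgToCo, ← quotAct_toQuotAlg k hV, ← Category.assoc, ← quotAct_mul, hx, map_zero,
    zero_comp]

variable [HasCoproducts.{w} C]

/-- The map from the `n`-th summand of `Nic[V]` to the Nichols algebra given by `x ⊗ v ↦ x v`. -/
def nicTermProj (n : ℕ) : artinTerm (nic k) V n (kerQuot hV n) ⟶ nichols k V :=
  bal.descLin ((worKer k (kerQuot hV n)).liftQ (quotActProj k hV n)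
      (worKer_le_ker_quotActProj k hV n)) fun g m => by
    obtain ⟨x, rfl⟩ := (worKer k (kerQuot hV n)).mkQ_surjective m
    change quotAct k hV n (rightMul k _ g x) ≫ _ = braidMap V n g ≫ quotAct k hV n x ≫ _
    rw [rightMul_apply, quotAct_mul, quotAct_single, Category.assoc]

theorem nicι_nicTermProj {n : ℕ} (x : MonoidAlgebra k (Braid n)) :
    nicι k V (kerQuot hV n) x ≫ nicTermProj k hV n =
      algAct k V n x ≫ tensorAlg.ι V n ≫ nichols.proj k V := by
  rw [← quotAct_toQuotAlg k hV]
  exact bal.ι_descLin _ _ _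

/-- The map from a term of `Nic[V]` to the Nichols algebra given by `x ⊗ v ↦ x v`. -/
def nicSumProj : nicSum k V (kerQuot hV) ⟶ nichols k V := Sigma.desc fun n => nicTermProj k hV n

theorem nicι_ι_nicSumProj {n : ℕ} (x : MonoidAlgebra k (Braid n)) :
    nicι k V (kerQuot hV n) x ≫ nicSum.ι k V (kerQuot hV) n ≫ nicSumProj k hV =
      algAct k V n x ≫ tensorAlg.ι V n ≫ nichols.proj k V := by
  rw [← nicι_nicTermProj k hV]
  exact congrArg (nicι k V (kerQuot hV n) x ≫ ·) (Sigma.ι_desc _ _)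

theorem toNicSum_nicSumProj : toNicSum k V (kerQuot hV) ≫ nicSumProj k hV = nichols.proj k V :=
  Sigma.hom_ext _ _ fun n => by
    change tensorAlg.ι V n ≫ _ = tensorAlg.ι V n ≫ _
    rw [reassoc_of% ι_toNicSum, nicι_ι_nicSumProj, map_one]
    exact Category.id_comp _

variable {k hV} {t : ∀ n, MonoidAlgebra k (Braid n)}

theorem nicholsToNicSum_nicSumProj (ht : IsSymmetrizerInnerInverse k hV t) :
    nicholsToNicSum k V t (kerQuot hV) ≫ nicSumProj k hV = 𝟙 _ := by
  rw [nicholsToNicSum, Category.assoc, Category.assoc, toNicSum_nicSumProj,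
    incl_comp_proj ht.tensorAlgToCo_comp]

theorem map_nicSumProj_nicholsToNicSum [CharZero k] (ht : IsSymmetrizerInnerInverse k hV t)
    {l j : ∀ n, FinQuot n} (a : l ⟶ kerQuot hV) (b : l ⟶ j) :
    nicSum.map k a ≫ nicSumProj k hV ≫ nicholsToNicSum k V t j = nicSum.map k b :=
  nicSum_hom_ext k fun n x => by
    have nicι_mul : nicι k V (j n) (t n * quantumSymmetrizer k n * x) = nicι k V (j n) x :=
      nicι_eq_of_quantumSymmetrizer_mul k hV (j n) (by
        rw [← mul_assoc, ← mul_assoc, map_mul, ht, ← map_mul])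
    have nicι_map_proj := nicι_ι_map (V := V) k a x
    rw [reassoc_of% nicι_map_proj, nicι_ι_map, reassoc_of% nicι_ι_nicSumProj, nicholsToNicSum,
      reassoc_of% proj_incl, reassoc_of% ι_tensorAlgToCo, reassoc_of% ι_tensorAlgAct, ι_toNicSum,
      ← nicι_mul, nicι_eq_algAct_comp k (j n) (t n * _ * _), algAct_mul, algAct_mul,
      Category.assoc, Category.assoc, Category.assoc]

/-- The isomorphism between `Nic[V]` and the Nichols algebra: in one direction it is given by
`x ⊗ v ↦ x v`, in the other by applying an inner inverse of the quantum symmetrizer. -/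
def nicIso [CharZero k] (ht : IsSymmetrizerInnerInverse k hV t) :
    artin (nic k) V ≅ (Pro.const C).obj (nichols k V) where
  hom :=
    { germ := fun _ => Pro.Germ.mk (X := artin (nic k) V) (kerQuot hV) (nicSumProj k hV)
      compat := fun _ => congrArg (Pro.Germ.mk (X := artin (nic k) V) (kerQuot hV))
        (Category.comp_id (nicSumProj k hV)) }
  inv :=
    { germ := fun j => Pro.Germ.mk (X := (Pro.const C).obj (nichols k V)) ⟨⟨⟩⟩
        (nicholsToNicSum k V t j)
      compat := fun {j j'} f =>
        congrArg (Pro.Germ.mk (X := (Pro.const C).obj (nichols k V)) ⟨⟨⟩⟩)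
          (nicholsToNicSum_map k V t f) }
  hom_inv_id := Pro.hom_ext fun j => by
    let l : ∀ n, FinQuot n := fun n => kerQuot hV n ⊓ j n
    let toKer : l ⟶ kerQuot hV := fun n => homOfLE (inf_le_left : l n ≤ kerQuot hV n)
    let toIndex : l ⟶ j := fun n => homOfLE (inf_le_right : l n ≤ j n)
    exact Pro.Germ.sound (X := artin (nic k) V) toKer toIndex
      ((map_nicSumProj_nicholsToNicSum ht toKer toIndex).trans (Category.comp_id _).symm)
  inv_hom_id := Pro.hom_ext fun _ =>
    congrArg (Pro.Germ.mk (X := (Pro.const C).obj (nichols k V)) ⟨⟨⟩⟩)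
      (nicholsToNicSum_nicSumProj ht)

theorem nicEval_nicIso [CharZero k] (ht : IsSymmetrizerInnerInverse k hV t) {n : ℕ}
    (g : Braid n) : nicEval k V g ≫ (nicIso ht).hom = (Pro.const C).map
      (braidMap V n g ≫ tensorAlg.ι V n ≫ nichols.proj k V) :=
  Pro.hom_ext fun _ => congrArg (Pro.Germ.mk (X := (Pro.const C).obj (tensorPow V n)) ⟨⟨⟩⟩) (by
    change (nicι k V (kerQuot hV n) (MonoidAlgebra.single g 1) ≫ nicSum.ι k V (kerQuot hV) n) ≫
      nicSumProj k hV = braidMap V n g ≫ tensorAlg.ι V n ≫ nichols.proj k V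
    rw [Category.assoc, nicι_ι_nicSumProj, algAct_single, one_smul])

end Comparison

section OperadicStructure

variable (k : Type w) [Field k] {C : Type u} [Category.{v} C] [Abelian C] [Linear k C]
  [MonoidalCategory C] [BraidedCategory C] [HasCountableCoproducts C]
  [∀ X : C, PreservesColimitsOfShape (Discrete ℕ) (tensorLeft X)] {V : C} [MonObj (nichols k V)]

open MonObj in
theorem IsNicholsAlgebra.tensorHom_mul (hB : IsNicholsAlgebra k V) {p q : ℕ} (g : Braid p)
    (h : Braid q) :
    ((braidMap V p g ≫ tensorAlg.ι V p ≫ nichols.proj k V) ⊗ₘ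
        (braidMap V q h ≫ tensorAlg.ι V q ≫ nichols.proj k V)) ≫ μ[nichols k V] =
      (concat V p q).hom ≫ braidMap V (p + q) (juxt g h) ≫ tensorAlg.ι V (p + q) ≫
        nichols.proj k V := by
  rw [← MonoidalCategory.tensorHom_comp_tensorHom, ← MonoidalCategory.tensorHom_comp_tensorHom,
    Category.assoc, Category.assoc, ← hB.mul_proj, reassoc_of% ι_concatMul,
    reassoc_of% concat_juxt]

variable [HasCoproducts.{w} C]

open MonObj in
theorem isNicAlgebra_of_isMonHom (hB : IsNicholsAlgebra k V)
    (e : artin (nic k) V ≅ (Pro.const C).obj (nichols k V))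
    (he : ∀ {n : ℕ} (g : Braid n), nicEval k V g ≫ e.hom = (Pro.const C).map
      (braidMap V n g ≫ tensorAlg.ι V n ≫ nichols.proj k V))
    [MonObj (artin (nic k) V)] [IsMonHom e.hom] : IsNicAlgebra k V where
  one := by
    refine (cancel_mono e.hom).1 ((IsMonHom.one_hom e.hom).trans (Eq.trans ?_ (he (n := 0) 1).symm))
    refine (Category.id_comp _).trans (congrArg (Pro.const C).map ?_)
    rw [← hB.one_proj, braidMap_one]
    exact (Category.id_comp _).symm
  mul {p q} g h := by
    rw [← cancel_mono e.hom, Category.assoc, IsMonHom.mul_hom,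
      MonoidalCategory.tensorHom_comp_tensorHom_assoc, he, he, Category.assoc, Category.assoc, he,
      ← Functor.map_comp, ← hB.tensorHom_mul]
    refine Eq.trans ?_ (congrArg (Functor.LaxMonoidal.μ (Pro.const C) _ _ ≫ ·)
      ((Pro.const C).map_comp _ _).symm)
    rw [← Functor.LaxMonoidal.μ_natural_assoc]
    rfl

end OperadicStructure

end

end BraidedNichols

theorem mainTheorem12 {k : Type w} [Field k] [CharZero k] :
    ((BraidedNichols.woronowicz k).IsStrict ∧
      BraidedNichols.IsLeftIdeal (BraidedNichols.brAssHat k) (BraidedNichols.woronowicz k)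
        (BraidedNichols.woronowiczIncl k)) ∧
    ∀ {C : Type u} [Category.{v} C] [Abelian C] [Linear k C] [MonoidalCategory C]
      [MonoidalPreadditive C] [MonoidalLinear k C] [BraidedCategory C]
      [HasCoproducts.{w} C] [HasCountableCoproducts C]
      [∀ X : C, PreservesColimitsOfShape (Discrete ℕ) (tensorLeft X)]
      (V : C), BraidedNichols.FinitelyBraided V →
      ∃ (_ : MonObj (BraidedNichols.nichols k V))
        (_ : MonObj (BraidedNichols.artin (BraidedNichols.nic k) V)),
        BraidedNichols.IsNicholsAlgebra k V ∧ BraidedNichols.IsNicAlgebra k V ∧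
        ∃ e : BraidedNichols.artin (BraidedNichols.nic k) V ≅
            (BraidedNichols.Pro.const C).obj (BraidedNichols.nichols k V),
          IsMonHom e.hom ∧
          ∀ n, BraidedNichols.nicEval k V (1 : BraidedNichols.Braid n) ≫ e.hom =
            (BraidedNichols.Pro.const C).map
              (BraidedNichols.tensorAlg.ι V n ≫ BraidedNichols.nichols.proj k V) := by
  refine ⟨⟨BraidedNichols.woronowicz_isStrict k, BraidedNichols.isLeftIdeal_woronowicz k⟩, ?_⟩
  intro C _ _ _ _ _ _ _ _ _ _ V hV
  obtain ⟨t, ht⟩ := BraidedNichols.exists_isSymmetrizerInnerInverse k hV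
  have := BraidedNichols.isSplitEpi_proj ht.tensorAlgToCo_comp
  let _ := BraidedNichols.nicholsMonObj k V
  let e := BraidedNichols.nicIso ht
  let _ := MonObj.ofIso e.symm
  have isMonHom_symm : IsMonHom e.symm.hom := isMonHom_ofIso e.symm
  have isMonHom_e : IsMonHom e.hom := inferInstanceAs (IsMonHom e.symm.inv)
  have hB := BraidedNichols.isNicholsAlgebra k V
  refine ⟨inferInstance, inferInstance, hB,
    BraidedNichols.isNicAlgebra_of_isMonHom k hB e (BraidedNichols.nicEval_nicIso ht), e,
    isMonHom_e, fun n => ?_⟩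
  rw [BraidedNichols.nicEval_nicIso, BraidedNichols.braidMap_one, Category.id_comp]
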